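/- **Setting.** Let $(\mathbf M,J,j)$ be an involutive closed symmetric monoidal category with all small colimits: $\mathbf M$ is a cocomplete closed symmetric monoidal category with unit $I$, $(J,J_2,J_0):\mathbf M\to\mathbf M$ is a symmetric monoidal functor and $j:\mathrm{Id}\cong J^2$ is a monoidal natural isomorphism with $jJ=Jj$. A $\ast$-object is an object $X$ with a morphism $\ast:X\to JX$ such that $(J\ast)\circ\ast=j_X$. Let $(\mathbf C,\perp)$ be an orthogonal category: a small category $\mathbf C$ with a symmetric relation $\perp$ on pairs of morphisms with the same target, stable under post-composition with a morphism and under pre-composition of each of the two members. Let $\mathbf C_0$ be its set of objects. *The colored $\ast$-operad $\mathcal O_{(\mathbf C,\perp)}$.* It is the $\mathbf C_0$-colored operad in $\mathbf M$ whose object of operations from $\underline c=(c_1,\dots,c_n)$ to $t$ is the coproduct of copies of $I$ indexed by the set $\big(\Sigma_n\times\prod_i\mathbf C(c_i,t)\big)/\!\sim_\perp$. Here $\sim_\perp$ is the equivalence relation generated by $(\sigma,\underline f)\sim(\tau\sigma,\underline f)$ for the transpositions $\tau$ of two adjacent places $k,k+1$ with $f_{\sigma^{-1}(k)}\perp f_{\sigma^{-1}(k+1)}$.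 Permutations act by $[\sigma,\underline f]\mapsto[\sigma\sigma',\underline f\sigma']$, the units are $[e,\mathrm{id}_t]$, and the composition is induced by $$\big([\sigma,\underline f],[\tau_1,\underline g_1],\dots,[\tau_n,\underline g_n]\big)\mapsto[\sigma(\tau_1,\dots,\tau_n),(f_i g_{ij})_{i,j}],$$ where $\sigma(\tau_1,\dots,\tau_n)$ is the block permutation. Its $\ast$-structure $\mathcal O\binom{t}{\underline c}\to J\mathcal O\binom{t}{\underline c}$ is induced by $[\sigma,\underline f]\mapsto[\rho_n\sigma,\underline f]$, with $\rho_n$ the order-reversal permutation, and by $J_0:I\to JI$. *$\ast$-algebras.* A $\ast$-algebra over a colored $\ast$-operad $\mathcal O$ is an $\mathcal O$-algebra $(A,\alpha)$ with $\ast$-object structures $\ast_t:A_t\to JA_t$ for all colors $t$ such that $\ast_t\circ\alpha=J(\alpha)\circ J_2\circ(\ast\otimes\bigotimes_i\ast_{c_i})$ on $\mathcal O\binom{t}{\underline c}\otimes\bigotimes_i A_{c_i}$, where $J_2$ stands for its iterates. Morphisms are the families of morphisms compatible with $\alpha$ and $\ast$. *Order-reversing $\ast$-monoids.* These are the quadruples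 $(A,\mu,\eta,\ast)$ of a monoid $(A,\mu,\eta)$ in $\mathbf M$ and a $\ast$-object structure $\ast:A\to JA$ with $\ast\circ\mu=J(\mu^{\mathrm{op}})\circ J_2\circ(\ast\otimes\ast)$ and $\ast\circ\eta=J(\eta)\circ J_0$, where $\mu^{\mathrm{op}}$ is the opposite multiplication. Morphisms are the monoid morphisms compatible with $\ast$. They form the category ${\ast\text{-}\mathbf{Mon}}_{\mathrm{rev}}(\mathbf M,J,j)$. A functor $\mathfrak A$ from $\mathbf C$ to this category is $\perp$-commutative if $\mu_c\circ(\mathfrak A(f_1)\otimes\mathfrak A(f_2))=\mu_c^{\mathrm{op}}\circ(\mathfrak A(f_1)\otimes\mathfrak A(f_2))$ for all $f_1:c_1\to c$ and $f_2:c_2\to c$ with $f_1\perp f_2$. The $\perp$-commutative functors, with all natural transformations, form the category ${\ast\text{-}\mathbf{Mon}}_{\mathrm{rev}}(\mathbf M,J,j)^{(\mathbf C,\perp)}$. **Proposition.** 1. There is an isomorphism of categories $${\ast\text{-}\mathbf{Alg}}(\mathcal O_{(\mathbf C,\perp)})\;\cong\;{\ast\text{-}\mathbf{Mon}}_{\mathrm{rev}}(\mathbf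 M,J,j)^{(\mathbf C,\perp)},$$ which preserves the underlying families $(A_c,\ast_c)_{c\in\mathbf C_0}$ of $\ast$-objects and the underlying families of morphisms. 2. If $\mathbf C$ is the category $\{\bullet\}$ with one object and only its identity morphism, and $\perp\,=\emptyset$, then there is an isomorphism of categories ${\ast\text{-}\mathbf{Alg}}(\mathcal O_{(\{\bullet\},\emptyset)})\cong{\ast\text{-}\mathbf{Mon}}_{\mathrm{rev}}(\mathbf M,J,j)$, which preserves the underlying $\ast$-objects and their morphisms. 3. Let $\mathbf M=\mathbf{Vec}_{\mathbb C}$ be the category of complex vector spaces, with $J=\overline{(-)}$ the complex conjugate vector space, $J_2:\overline V\otimes\overline W\to\overline{V\otimes W}$, $v\otimes w\mapsto v\otimes w$, $J_0:\mathbb C\to\overline{\mathbb C}$ complex conjugation, and $j=\mathrm{id}$. Then the functor which sends an associative unital $\ast$-algebra $A$ over $\mathbb C$ (with $(ab)^\ast=b^\ast a^\ast$) to the quadruple $(A,\mu,\eta,\ast)$ with $\mu(a\otimes b)=ab$, $\eta(1)=1$ and the same involution is an isomorphism from the category of associative unital $\ast$-algebras over $\mathbb C$ and unital $\ast$-homomorphisms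 to ${\ast\text{-}\mathbf{Mon}}_{\mathrm{rev}}(\mathbf{Vec}_{\mathbb C},\overline{(-)},\mathrm{id})$. -/

import Mathlib

open CategoryTheory MonoidalCategory MonoidalCategoryStruct Limits
universe v u w
set_option linter.unusedSectionVars false
set_option linter.unusedVariables false

namespace AQFT

/-- An orthogonality relation on `C`. -/
structure Orthogonality (C : Type u) [Category.{v} C] where
  rel : ∀ {c₁ c₂ c : C}, (c₁ ⟶ c) → (c₂ ⟶ c) → Prop
  symm : ∀ {c₁ c₂ c : C} {f₁ : c₁ ⟶ c} {f₂ : c₂ ⟶ c}, rel f₁ f₂ → rel f₂ f₁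
  postcomp : ∀ {c₁ c₂ c d : C} {f₁ : c₁ ⟶ c} {f₂ : c₂ ⟶ c} (g : c ⟶ d),
    rel f₁ f₂ → rel (f₁ ≫ g) (f₂ ≫ g)
  precomp : ∀ {b₁ b₂ c₁ c₂ c : C} {f₁ : c₁ ⟶ c} {f₂ : c₂ ⟶ c} (h₁ : b₁ ⟶ c₁) (h₂ : b₂ ⟶ c₂),
    rel f₁ f₂ → rel (h₁ ≫ f₁) (h₂ ≫ f₂)

section Blocks

/-- Concatenation of a finite sequence of finite sequences. -/
abbrev concat {α : Type*} {n : ℕ} {k : Fin n → ℕ} (b : ∀ i, Fin (k i) → α) : Fin (∑ i, k i) → α :=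
  fun x => b (finSigmaFinEquiv.symm x).1 (finSigmaFinEquiv.symm x).2

theorem concat_eq {α : Type*} {n : ℕ} {k : Fin n → ℕ} (b : ∀ i, Fin (k i) → α)
    {x : Fin (∑ i, k i)} {p : (i : Fin n) × Fin (k i)} (h : finSigmaFinEquiv.symm x = p) :
    concat b x = b p.1 p.2 := by subst h; rfl

/-- The bijection of concatenated sequences which permutes the blocks by `σ`. -/
def blockEquiv {m n : ℕ} (σ : Fin m ≃ Fin n) (k : Fin n → ℕ) :
    Fin (∑ i, k (σ i)) ≃ Fin (∑ i, k i) :=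
  finSigmaFinEquiv.symm.trans
    ((Equiv.sigmaCongrLeft (β := fun i => Fin (k i)) σ).trans finSigmaFinEquiv)

/-- The block sum of bijections. -/
def sumEquiv {n : ℕ} {k k' : Fin n → ℕ} (e : ∀ i, Fin (k' i) ≃ Fin (k i)) :
    Fin (∑ i, k' i) ≃ Fin (∑ i, k i) :=
  finSigmaFinEquiv.symm.trans ((Equiv.sigmaCongrRight e).trans finSigmaFinEquiv)

/-- The order preserving bijection expressing the associativity of concatenation. -/
def assocEquiv {n : ℕ} {k : Fin n → ℕ} (l : ∀ i, Fin (k i) → ℕ) :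
    Fin (∑ i, ∑ j, l i j) ≃ Fin (∑ x, concat l x) :=
  finSigmaFinEquiv.symm.trans <|
    (Equiv.sigmaCongrRight fun i => (finSigmaFinEquiv (n := l i)).symm).trans <|
    (Equiv.sigmaAssoc fun i j => Fin (l i j)).symm.trans <|
    (Equiv.sigmaCongrLeft (β := fun p : (i : Fin n) × Fin (k i) => Fin (l p.1 p.2))
      (finSigmaFinEquiv (n := k)).symm).symm.trans finSigmaFinEquiv

/-- `σ(τ₁,…,τₙ)`: the block sum of the `τᵢ`, followed by the block permutation which moves the
`i`-th block to the `σ(i)`-th place. -/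
def blockPerm {n : ℕ} {k : Fin n → ℕ} (σ : Equiv.Perm (Fin n))
    (τ : ∀ i, Equiv.Perm (Fin (k i))) : Equiv.Perm (Fin (∑ i, k i)) :=
  (sumEquiv τ).trans <|
    (blockEquiv σ.symm k).symm.trans (finCongr (Equiv.sum_comp σ.symm k))

theorem merge_lt {n : ℕ} {k : Fin n → ℕ} (p q : (i : Fin n) × Fin (k i)) :
    finSigmaFinEquiv p < finSigmaFinEquiv q ↔ Sigma.Lex (· < ·) (fun _ => (· < ·)) p q := by
  have key : ∀ p q : (i : Fin n) × Fin (k i), Sigma.Lex (· < ·) (fun _ => (· < ·)) p q →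
      finSigmaFinEquiv p < finSigmaFinEquiv q := by
    rintro _ _ (@⟨i, j, a, b, h⟩ | @⟨i, a, b, h⟩)
    · have hs : ∀ a : Fin n, ∑ x : Fin a, k (Fin.castLE a.2.le x) =
          ∑ x ∈ Finset.range a, if h : x < n then k ⟨x, h⟩ else 0 := fun a => by
        rw [Finset.sum_range]
        refine Finset.sum_congr rfl fun x _ => ?_
        rw [dif_pos (x.2.trans a.2)]; rfl
      rw [Fin.lt_def, finSigmaFinEquiv_apply, finSigmaFinEquiv_apply]
      dsimp only
      rw [hs, hs]
      have h1 := Finset.sum_le_sum_of_subset (f := fun x => if h : x < n then k ⟨x, h⟩ else 0)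
        (Finset.range_subset_range.2 (Nat.succ_le_of_lt (Fin.lt_def.1 h)))
      rw [Finset.sum_range_succ, dif_pos i.2] at h1
      have := a.2
      simp only [Fin.eta] at h1
      omega
    · rw [Fin.lt_def, finSigmaFinEquiv_apply, finSigmaFinEquiv_apply]
      simpa using h
  refine ⟨fun h => ?_, key p q⟩
  rcases trichotomous_of (Sigma.Lex (· < ·) (fun i => ((· < ·) : Fin (k i) → Fin (k i) → Prop))) p q with h' | h' | h'
  · exact h'
  · subst h'; exact absurd h (lt_irrefl _)
  · exact absurd (key _ _ h') h.not_gt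

theorem equiv_ext_lt {α : Type*} {n : ℕ} (e e' : α ≃ Fin n) (h : ∀ x y, e x < e y → e' x < e' y) :
    e = e' := by
  have hm : StrictMono (e.symm.trans e') := fun a b hab => by
    simpa using h (e.symm a) (e.symm b) (by simpa using hab)
  have := Subsingleton.elim ((StrictMono.orderIsoOfSurjective _ hm (e.symm.trans e').surjective)) (OrderIso.refl _)
  ext x
  have h2 := DFunLike.congr_fun this (e x)
  simp at h2
  simp [h2]

/-- A sequence with one block. -/
def oneBlock (n : ℕ) : Fin (∑ _ : Fin 1, n) ≃ Fin n :=
  finSigmaFinEquiv.symm.trans ((Equiv.sigmaEquivProd (Fin 1) (Fin n)).trans (Equiv.uniqueProd (Fin n) (Fin 1)))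

/-- A sequence of blocks of length one. -/
def unitBlocks (n : ℕ) : Fin (∑ _ : Fin n, 1) ≃ Fin n :=
  finSigmaFinEquiv.symm.trans (Equiv.sigmaUnique (Fin n) fun _ => Fin 1)

theorem concat_one {α : Type*} {n : ℕ} (c : Fin n → α) :
    concat (fun _ : Fin 1 => c) = c ∘ oneBlock n := rfl

theorem concat_unit {α : Type*} {n : ℕ} (c : Fin n → α) :
    concat (fun i (_ : Fin 1) => c i) = c ∘ unitBlocks n := rfl

theorem blockEquiv_split {m n : ℕ} (σ : Fin m ≃ Fin n) (k : Fin n → ℕ)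
    (p : (i : Fin m) × Fin (k (σ i))) :
    finSigmaFinEquiv.symm (blockEquiv σ k (finSigmaFinEquiv p)) = ⟨σ p.1, p.2⟩ := by
  simp [blockEquiv]

theorem sumEquiv_split {n : ℕ} {k k' : Fin n → ℕ} (e : ∀ i, Fin (k' i) ≃ Fin (k i))
    (p : (i : Fin n) × Fin (k' i)) :
    finSigmaFinEquiv.symm (sumEquiv e (finSigmaFinEquiv p)) = ⟨p.1, e p.1 p.2⟩ := by
  simp [sumEquiv]

theorem concat_block {α : Type*} {m n : ℕ} (σ : Fin m ≃ Fin n) {k : Fin n → ℕ}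
    (b : ∀ i, Fin (k i) → α) :
    concat (fun i => b (σ i)) = concat b ∘ blockEquiv σ k := by
  funext x
  obtain ⟨p, rfl⟩ := finSigmaFinEquiv.surjective x
  rw [Function.comp_apply, concat_eq _ (Equiv.symm_apply_apply _ _),
    concat_eq _ (blockEquiv_split σ k p)]

theorem concat_sum {α : Type*} {n : ℕ} {k k' : Fin n → ℕ} (e : ∀ i, Fin (k' i) ≃ Fin (k i))
    {b : ∀ i, Fin (k i) → α} {b' : ∀ i, Fin (k' i) → α} (h : ∀ i, b' i = b i ∘ e i) :
    concat b' = concat b ∘ sumEquiv e := by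
  funext x
  obtain ⟨p, rfl⟩ := finSigmaFinEquiv.surjective x
  rw [Function.comp_apply, concat_eq _ (Equiv.symm_apply_apply _ _),
    concat_eq _ (sumEquiv_split e p), h, Function.comp_apply]

theorem assocEquiv_merge {n : ℕ} {k : Fin n → ℕ} (l : ∀ i, Fin (k i) → ℕ) (x : Fin (∑ i, k i))
    (z : Fin (concat l x)) :
    assocEquiv l (finSigmaFinEquiv ⟨(finSigmaFinEquiv.symm x).1,
      finSigmaFinEquiv ⟨(finSigmaFinEquiv.symm x).2, z⟩⟩) = finSigmaFinEquiv ⟨x, z⟩ := by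
  simp only [assocEquiv, Equiv.trans_apply, Equiv.symm_apply_apply, Equiv.sigmaCongrRight_apply]
  refine congrArg _ ?_
  rw [Equiv.symm_apply_eq]
  rfl

theorem assocEquiv_surj {n : ℕ} {k : Fin n → ℕ} (l : ∀ i, Fin (k i) → ℕ)
    (y : Fin (∑ i, ∑ j, l i j)) : ∃ (x : Fin (∑ i, k i)) (z : Fin (concat l x)),
      y = finSigmaFinEquiv ⟨(finSigmaFinEquiv.symm x).1,
        finSigmaFinEquiv ⟨(finSigmaFinEquiv.symm x).2, z⟩⟩ := by
  obtain ⟨⟨x, z⟩, h⟩ := finSigmaFinEquiv.surjective (assocEquiv l y)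
  exact ⟨x, z, (assocEquiv l).injective (by rw [assocEquiv_merge, h])⟩

theorem concat_assoc {α : Type*} {n : ℕ} {k : Fin n → ℕ} {l : ∀ i, Fin (k i) → ℕ}
    (c : ∀ i j, Fin (l i j) → α) :
    concat (fun i => concat (c i)) = concat (k := concat l) (fun x => c (finSigmaFinEquiv.symm x).1
      (finSigmaFinEquiv.symm x).2) ∘ assocEquiv l := by
  funext y
  obtain ⟨x, z, rfl⟩ := assocEquiv_surj l y
  rw [Function.comp_apply, assocEquiv_merge, concat_eq _ (Equiv.symm_apply_apply _ _),
    concat_eq _ (Equiv.symm_apply_apply _ _), concat_eq _ (Equiv.symm_apply_apply _ _)]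

theorem sigma_fin_ext {α : Type*} {k : α → ℕ} {p q : (i : α) × Fin (k i)} (h : p.1 = q.1)
    (h' : p.2.val = q.2.val) : p = q := by
  obtain ⟨i, j⟩ := p
  obtain ⟨i', j'⟩ := q
  dsimp at h
  subst h
  exact congrArg (Sigma.mk i) (Fin.ext h')

theorem sigmaCongrLeft_val {m n : ℕ} (σ : Fin m ≃ Fin n) (k : Fin n → ℕ)
    (p : (i : Fin m) × Fin (k (σ i))) :
    Equiv.sigmaCongrLeft (β := fun i => Fin (k i)) σ p = ⟨σ p.1, p.2⟩ := rfl

theorem blockPerm_lt {n : ℕ} {k : Fin n → ℕ} (σ : Equiv.Perm (Fin n))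
    (τ : ∀ i, Equiv.Perm (Fin (k i))) (x y : Fin (∑ i, k i)) :
    blockPerm σ τ x < blockPerm σ τ y ↔
      Sigma.Lex (fun i i' => σ i < σ i') (fun i j j' => τ i j < τ i j')
        (finSigmaFinEquiv.symm x) (finSigmaFinEquiv.symm y) := by
  have key : ∀ p : (i : Fin n) × Fin (k i), (Equiv.sigmaCongrLeft
      (β := fun i => Fin (k i)) σ.symm).symm p = ⟨σ p.1, finCongr (by simp) p.2⟩ := by
    rintro ⟨i, j⟩
    rw [Equiv.symm_apply_eq]
    rw [sigmaCongrLeft_val (k := k)]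
    exact sigma_fin_ext (by simp) (by simp)
  obtain ⟨⟨i, j⟩, rfl⟩ := finSigmaFinEquiv.surjective x
  obtain ⟨⟨i', j'⟩, rfl⟩ := finSigmaFinEquiv.surjective y
  simp only [blockPerm, sumEquiv, blockEquiv, Equiv.trans_apply, Equiv.symm_trans_apply,
    Equiv.symm_symm, Equiv.symm_apply_apply, key, Equiv.sigmaCongrRight_apply]
  rw [Fin.lt_def]
  simp only [finCongr_apply_coe]
  rw [← Fin.lt_def, merge_lt, Sigma.lex_iff, Sigma.lex_iff]
  constructor
  · rintro (h | ⟨h, h'⟩)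
    · exact Or.inl h
    · obtain rfl : i = i' := σ.injective h
      exact Or.inr ⟨rfl, by simpa using h'⟩
  · rintro (h | ⟨h, h'⟩)
    · exact Or.inl h
    · dsimp at h
      subst h
      exact Or.inr ⟨rfl, by simpa using h'⟩

theorem finRange_perm {m n : ℕ} (e : Fin m ≃ Fin n) :
    (List.finRange n).Perm ((List.finRange m).map e) := by
  refine (List.perm_ext_iff_of_nodup (List.nodup_finRange n)
    ((List.nodup_finRange m).map e.injective)).2 fun x => ?_
  simpa using ⟨e.symm x, by simp⟩

theorem finRange_sigma {n : ℕ} (k : Fin n → ℕ) :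
    ((List.finRange n).sigma fun i => List.finRange (k i)) =
      (List.finRange (∑ i, k i)).map finSigmaFinEquiv.symm := by
  have h1 : (((List.finRange n).sigma fun i => List.finRange (k i)).map finSigmaFinEquiv).Pairwise
      (· < ·) := by
    rw [List.pairwise_map, List.sigma, List.pairwise_flatMap]
    refine ⟨fun i _ => ?_, (List.pairwise_lt_finRange n).imp fun {i i'} h p hp q hq => ?_⟩
    · rw [List.pairwise_map]
      exact (List.pairwise_lt_finRange _).imp fun h => (merge_lt _ _).2 (Sigma.Lex.right _ _ h)
    · obtain ⟨j, _, rfl⟩ := List.mem_map.1 hp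
      obtain ⟨j', _, rfl⟩ := List.mem_map.1 hq
      exact (merge_lt _ _).2 (Sigma.Lex.left _ _ h)
  have h2 : ((List.finRange n).sigma fun i => List.finRange (k i)).map finSigmaFinEquiv =
      List.finRange (∑ i, k i) := by
    refine List.Perm.eq_of_pairwise (fun a b _ _ h h' => absurd h h'.not_gt) h1
      (List.pairwise_lt_finRange _) ?_
    refine (List.perm_ext_iff_of_nodup (h1.imp fun h => h.ne) (List.nodup_finRange _)).2 fun x => ?_
    obtain ⟨⟨i, j⟩, rfl⟩ := finSigmaFinEquiv.surjective x
    simp [List.mem_sigma]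
  rw [← h2, List.map_map]
  simp

end Blocks

section Tensors
variable {M : Type u} [Category.{v} M] [MonoidalCategory M] {I : Type w} {I' : Type*}

/-- The iterated tensor product `X i₁ ⊗ (X i₂ ⊗ (⋯ ⊗ 𝟙))` over a list of indices. -/
def tens : List I → (I → M) → M
  | [], _ => tensorUnit M
  | i :: l, X => X i ⊗ tens l X

/-- Functoriality of the iterated tensor product. -/
def tensMap : (l : List I) → {X Y : I → M} → (∀ i, X i ⟶ Y i) → (tens l X ⟶ tens l Y)
  | [], _, _, _ => 𝟙 (tensorUnit M)
  | i :: l, _, _, f => f i ⊗ₘ tensMap l f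

/-- The tensor product of a family of points. -/
def tensPoint : (l : List I) → {X : I → M} → (∀ i, tensorUnit M ⟶ X i) → (tensorUnit M ⟶ tens l X)
  | [], _, _ => 𝟙 (tensorUnit M)
  | i :: l, _, p => (λ_ (tensorUnit M)).inv ≫ (p i ⊗ₘ tensPoint l p)

/-- `(⨂ l) ⊗ (⨂ r) ≅ ⨂ (l ++ r)`, by associators and unitors. -/
def tensAppend : (l r : List I) → (X : I → M) → (tens l X ⊗ tens r X ⟶ tens (l ++ r) X)
  | [], r, X => (λ_ (tens r X)).hom
  | i :: l, r, X => (α_ (X i) (tens l X) (tens r X)).hom ≫ X i ◁ tensAppend l r X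

/-- Reindexing along a map of indices. -/
def tensMapIndex (f : I → I') : (l : List I) → (X : I' → M) →
    (tens l (fun i => X (f i)) ⟶ tens (l.map f) X)
  | [], _ => 𝟙 (tensorUnit M)
  | i :: l, X => X (f i) ◁ tensMapIndex f l X

/-- The inverse of `tensMapIndex`. -/
def tensUnmapIndex (f : I → I') : (l : List I) → (X : I' → M) →
    (tens (l.map f) X ⟶ tens l (fun i => X (f i)))
  | [], _ => 𝟙 (tensorUnit M)
  | i :: l, X => X (f i) ◁ tensUnmapIndex f l X

/-- `⨂ᵢ ⨂ⱼ Xᵢⱼ ≅ ⨂_{(i,j)} Xᵢⱼ`, the pairs being ordered lexicographically. -/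
def tensSigma {K : I → Type*} : (l : List I) → (k : ∀ i, List (K i)) → (X : (i : I) × K i → M) →
    (tens l (fun i => tens (k i) (fun j => X ⟨i, j⟩)) ⟶ tens (l.sigma k) X)
  | [], _, _ => 𝟙 (tensorUnit M)
  | i :: l, k, X =>
      (tensMapIndex (Sigma.mk i) (k i) X ⊗ₘ tensSigma l k X) ≫ tensAppend _ _ X

/-- `⨂ᵢ ⨂ⱼ Xᵢⱼ ≅ ⨂ₓ Xₓ`, where `x` runs through the concatenation of the blocks. -/
def tensFlatten {n : ℕ} {k : Fin n → ℕ} (X : ∀ i, Fin (k i) → M) :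
    tens (List.finRange n) (fun i => tens (List.finRange (k i)) (X i)) ⟶
      tens (List.finRange (∑ i, k i)) (concat X) :=
  tensSigma (List.finRange n) (fun i => List.finRange (k i)) (fun p => X p.1 p.2) ≫
    eqToHom (by rw [finRange_sigma]) ≫
      tensUnmapIndex finSigmaFinEquiv.symm (List.finRange (∑ i, k i)) (fun p => X p.1 p.2)

variable [SymmetricCategory M]

/-- `⨂ᵢ (Xᵢ ⊗ Yᵢ) ≅ (⨂ᵢ Xᵢ) ⊗ (⨂ᵢ Yᵢ)`, the canonical shuffle. -/
def tensZip : (l : List I) → (X Y : I → M) →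
    (tens l (fun i => X i ⊗ Y i) ⟶ tens l X ⊗ tens l Y)
  | [], _, _ => (λ_ (tensorUnit M)).inv
  | i :: l, X, Y => (X i ⊗ Y i) ◁ tensZip l X Y ≫ tensorμ (X i) (Y i) (tens l X) (tens l Y)

/-- The symmetry moving the (first) factor with index `i` to the front. -/
def tensPull [DecidableEq I] (X : I → M) (i : I) : (l : List I) → i ∈ l →
    (tens l X ⟶ X i ⊗ tens (l.erase i) X)
  | [], h => absurd h List.not_mem_nil
  | a :: l, h =>
    if e : a = i then
      eqToHom (by subst e; simp [tens])
    else
      X a ◁ tensPull X i l ((List.mem_cons.1 h).resolve_left (Ne.symm e)) ≫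
        (α_ _ _ _).inv ≫ (β_ (X a) (X i)).hom ▷ _ ≫ (α_ _ _ _).hom ≫
        eqToHom (by rw [List.erase_cons_tail (by simpa using e)]; rfl)

/-- The symmetry between the tensor products over two enumerations of the same indices. -/
def tensReorder [DecidableEq I] (X : I → M) : (l l' : List I) → l.Perm l' →
    (tens l X ⟶ tens l' X)
  | l, [], h => eqToHom (by rw [h.eq_nil])
  | l, i :: l', h =>
      tensPull X i l (h.symm.subset List.mem_cons_self) ≫
        X i ◁ tensReorder X (l.erase i) l' (List.cons_perm_iff_perm_erase.1 h.symm).2.symm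

/-- The symmetry `⨂ₖ Xₖ ≅ ⨂ₖ X_{e(k)}` given by a permutation `e`. -/
def tensPerm {m n : ℕ} (e : Fin m ≃ Fin n) (X : Fin n → M) :
    tens (List.finRange n) X ⟶ tens (List.finRange m) (fun i => X (e i)) :=
  tensReorder X (List.finRange n) ((List.finRange m).map e) (finRange_perm e) ≫
    tensUnmapIndex e (List.finRange m) X

end Tensors
section Operations
variable {C : Type u} [Category.{v} C] (P : Orthogonality C)

/-- One transposition of adjacent orthogonal morphisms in the sequence `f σ⁻¹`. -/
inductive Step {n : ℕ} (c : Fin n → C) (t : C) :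
    Equiv.Perm (Fin n) × (∀ i, c i ⟶ t) → Equiv.Perm (Fin n) × (∀ i, c i ⟶ t) → Prop
  | swap (σ : Equiv.Perm (Fin n)) (f : ∀ i, c i ⟶ t) (k k' : Fin n) (hk : k'.val = k.val + 1)
      (h : P.rel (f (σ⁻¹ k)) (f (σ⁻¹ k'))) : Step c t (σ, f) (Equiv.swap k k' * σ, f)

/-- The set `(Σₙ × C(c,t)) / ∼`, where `∼` is generated by transpositions of adjacent orthogonal
pairs. -/
def OpSet {n : ℕ} (c : Fin n → C) (t : C) : Type v := Quot (Step P c t)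

variable {P}
/-- The class `[σ, f]`. -/
def OpSet.mk {n : ℕ} {c : Fin n → C} {t : C} (σ : Equiv.Perm (Fin n)) (f : ∀ i, c i ⟶ t) :
    OpSet P c t := Quot.mk _ (σ, f)

theorem opSet_ind {n : ℕ} {c : Fin n → C} {t : C} {p : OpSet P c t → Prop}
    (h : ∀ σ f, p (.mk σ f)) (x : OpSet P c t) : p x := Quot.ind (fun a => h a.1 a.2) x

theorem mk_eq_iff {n : ℕ} {c : Fin n → C} {t : C} {σ σ' : Equiv.Perm (Fin n)}
    {f f' : ∀ i, c i ⟶ t} : (OpSet.mk σ f : OpSet P c t) = .mk σ' f' ↔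
      f = f' ∧ ∀ x y, σ x < σ y → σ' y < σ' x → P.rel (f x) (f y) := by
  constructor
  · intro h
    have h := Quot.eqvGen_exact h
    generalize ha : (σ, f) = a at h
    generalize hb : (σ', f') = b at h
    suffices a.2 = b.2 ∧ ∀ x y, a.1 x < a.1 y → b.1 y < b.1 x → P.rel (a.2 x) (a.2 y) by
      rw [← ha, ← hb] at this; exact this
    clear ha hb
    induction h with
    | rel a b hab =>
      obtain ⟨σ, f, k, k', hk, h⟩ := hab
      refine ⟨rfl, fun x y h1 h2 => ?_⟩
      dsimp at h1 h2 ⊢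
      have hx : x = σ⁻¹ (σ x) := by simp
      have hy : y = σ⁻¹ (σ y) := by simp
      rw [hx, hy]
      generalize σ x = a at *
      generalize σ y = b at *
      have : a = k ∧ b = k' := by
        rw [Equiv.swap_apply_def, Equiv.swap_apply_def] at h2
        clear hx hy h
        split_ifs at h2 <;> simp only [Fin.lt_def, Fin.ext_iff] at * <;> omega
      rw [this.1, this.2]; exact h
    | refl a => exact ⟨rfl, fun x y h h' => absurd h h'.not_gt⟩
    | symm a b _ ih => exact ⟨ih.1.symm, fun x y h h' => ih.1 ▸ P.symm (ih.2 y x h' h)⟩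
    | trans a b c _ _ ih ih' =>
      refine ⟨ih.1.trans ih'.1, fun x y h h' => ?_⟩
      rcases lt_trichotomy (b.1 x) (b.1 y) with h2 | h2 | h2
      · rw [ih.1]; exact ih'.2 x y h2 h'
      · rw [b.1.injective h2] at h; exact absurd h (lt_irrefl _)
      · exact ih.2 x y h h2
  · rintro ⟨rfl, h⟩
    generalize hN : (Finset.univ.filter fun p : Fin n × Fin n =>
      σ p.1 < σ p.2 ∧ σ' p.2 < σ' p.1).card = N
    induction N using Nat.strong_induction_on generalizing σ with
    | _ N ih =>
    by_cases hs : ∀ k k' : Fin n, k'.val = k.val + 1 → σ' (σ⁻¹ k) < σ' (σ⁻¹ k')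
    · have : StrictMono (fun k => σ' (σ⁻¹ k)) := by
        cases n with
        | zero => exact fun a => a.elim0
        | succ n => exact Fin.strictMono_iff_lt_succ.2 fun i => hs _ _ (by simp)
      rw [equiv_ext_lt σ σ' fun x y hxy => by simpa using this hxy]
    · push Not at hs
      obtain ⟨k, k', hk, hlt⟩ := hs
      have hne : σ⁻¹ k ≠ σ⁻¹ k' := fun h => by
        have := σ⁻¹.injective h; rw [this] at hk; omega
      have hlt : σ' (σ⁻¹ k') < σ' (σ⁻¹ k) :=
        lt_of_le_of_ne hlt fun h => hne (σ'.injective h).symm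
      have hkk : k < k' := by rw [Fin.lt_def]; omega
      have hord : ∀ x y, σ x < σ y → ¬ (σ x = k ∧ σ y = k') →
          (Equiv.swap k k' * σ) x < (Equiv.swap k k' * σ) y := by
        intro x y hxy hn
        rw [Equiv.Perm.mul_apply, Equiv.Perm.mul_apply]
        generalize σ x = a at *
        generalize σ y = b at *
        rw [Equiv.swap_apply_def, Equiv.swap_apply_def]
        clear h hlt hne ih
        split_ifs <;> simp only [Fin.lt_def, Fin.ext_iff] at * <;> omega
      have hord' : ∀ x y, (Equiv.swap k k' * σ) x < (Equiv.swap k k' * σ) y →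
          σ' y < σ' x → σ x < σ y := by
        intro x y hxy hy
        by_contra hc
        have hyx : σ y < σ x := lt_of_le_of_ne (not_lt.1 hc) fun h => by
          rw [σ.injective h] at hy; exact lt_irrefl _ hy
        by_cases hh : σ y = k ∧ σ x = k'
        · rw [← hh.1, ← hh.2] at hlt
          simp at hlt
          exact absurd hlt hy.not_gt
        · exact absurd (hord y x hyx hh) hxy.not_gt
      have hstep : (OpSet.mk σ f : OpSet P c t) = .mk (Equiv.swap k k' * σ) f :=
        Quot.sound (Step.swap σ f k k' hk (h _ _ (by simpa using hkk) hlt))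
      rw [hstep]
      refine ih _ ?_ (fun x y h1 h2 => h x y (hord' x y h1 h2) h2) rfl
      rw [← hN]
      refine Finset.card_lt_card ⟨fun p hp => ?_, fun hp => ?_⟩
      · rw [Finset.mem_filter] at hp ⊢
        exact ⟨hp.1, hord' _ _ hp.2.1 hp.2.2, hp.2.2⟩
      · have := @hp (σ⁻¹ k, σ⁻¹ k') (by
          rw [Finset.mem_filter]; exact ⟨Finset.mem_univ _, by simpa using hkk, hlt⟩)
        rw [Finset.mem_filter] at this
        have := this.2.1
        simp at this
        exact absurd this hkk.not_gt

/-- The action of a permutation, `[σ, f] ↦ [σ e, f e]`. -/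
def OpSet.act {m n : ℕ} {c : Fin n → C} {d : Fin m → C} (e : Fin m ≃ Fin n) (h : d = c ∘ e)
    (t : C) : OpSet P c t → OpSet P d t :=
  Quot.lift (fun a => .mk ((e.trans a.1).trans (finCongr (Fin.equiv_iff_eq.1 ⟨e⟩).symm))
    fun i => eqToHom (congrFun h i) ≫ a.2 (e i)) fun a b hab => by
      have := (mk_eq_iff (P := P)).1 (Quot.sound hab : OpSet.mk a.1 a.2 = OpSet.mk b.1 b.2)
      rw [mk_eq_iff]
      refine ⟨by rw [this.1], fun x y h1 h2 => ?_⟩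
      exact P.precomp _ _ (this.2 (e x) (e y) (by simpa using h1) (by simpa using h2))

/-- Concatenation of families of morphisms to a common target. -/
def concatHom {n : ℕ} {k : Fin n → ℕ} {b : ∀ i, Fin (k i) → C} {t : C}
    (F : ∀ i j, b i j ⟶ t) (x : Fin (∑ i, k i)) : concat b x ⟶ t :=
  F (finSigmaFinEquiv.symm x).1 (finSigmaFinEquiv.symm x).2

theorem concatHom_eq {n : ℕ} {k : Fin n → ℕ} {b : ∀ i, Fin (k i) → C} {t : C}
    (F : ∀ i j, b i j ⟶ t) {x : Fin (∑ i, k i)} {p : (i : Fin n) × Fin (k i)}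
    (h : finSigmaFinEquiv.symm x = p) :
    concatHom F x = eqToHom (concat_eq b h) ≫ F p.1 p.2 := by
  subst h; exact (Category.id_comp _).symm

/-- The composite `[σ(τ₁,…,τₙ), f(g₁,…,gₙ)]` of representatives. -/
def compRep {n : ℕ} {k : Fin n → ℕ} {a : Fin n → C} {b : ∀ i, Fin (k i) → C} {t : C}
    (p : Equiv.Perm (Fin n) × (∀ i, a i ⟶ t))
    (q : ∀ i, Equiv.Perm (Fin (k i)) × (∀ j, b i j ⟶ a i)) : OpSet P (concat b) t :=
  .mk (blockPerm p.1 fun i => (q i).1) (concatHom fun i j => (q i).2 j ≫ p.2 i)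

theorem compRep_congr {n : ℕ} {k : Fin n → ℕ} {a : Fin n → C} {b : ∀ i, Fin (k i) → C} {t : C}
    (p p' : Equiv.Perm (Fin n) × (∀ i, a i ⟶ t))
    (q q' : ∀ i, Equiv.Perm (Fin (k i)) × (∀ j, b i j ⟶ a i))
    (hp : (OpSet.mk p.1 p.2 : OpSet P a t) = .mk p'.1 p'.2)
    (hq : ∀ i, (OpSet.mk (q i).1 (q i).2 : OpSet P (b i) (a i)) = .mk (q' i).1 (q' i).2) :
    (compRep p q : OpSet P (concat b) t) = compRep p' q' := by
  have hp := mk_eq_iff.1 hp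
  have hq := fun i => mk_eq_iff.1 (hq i)
  unfold compRep
  rw [mk_eq_iff]
  refine ⟨congrArg concatHom (by funext i j; rw [(hq i).1, hp.1]), fun x y h1 h2 => ?_⟩
  rw [blockPerm_lt] at h1 h2
  obtain ⟨⟨i, j⟩, rfl⟩ := finSigmaFinEquiv.surjective x
  obtain ⟨⟨i', j'⟩, rfl⟩ := finSigmaFinEquiv.surjective y
  rw [concatHom_eq _ (Equiv.symm_apply_apply _ _), concatHom_eq _ (Equiv.symm_apply_apply _ _)]
  refine P.precomp _ _ ?_
  rw [Equiv.symm_apply_apply, Equiv.symm_apply_apply, Sigma.lex_iff] at h1 h2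
  dsimp only at h1 h2 ⊢
  rcases h1 with h1 | ⟨h1, h1'⟩ <;> rcases h2 with h2 | ⟨h2, h2'⟩
  · exact P.precomp _ _ (hp.2 _ _ h1 h2)
  · subst h2; exact absurd h1 (lt_irrefl _)
  · subst h1; exact absurd h2 (lt_irrefl _)
  · subst h1
    have h3 := (hq _).2 _ _ h1' h2'
    exact P.postcomp _ h3

/-- The operadic composition of sets of operations; it does not depend on the choice of
representatives, see `comp_mk`. -/
noncomputable def OpSet.comp {n : ℕ} {k : Fin n → ℕ} {a : Fin n → C} {b : ∀ i, Fin (k i) → C}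
    {t : C} (p : OpSet P a t) (q : ∀ i, OpSet P (b i) (a i)) : OpSet P (concat b) t :=
  compRep (Quot.out p) fun i => Quot.out (q i)

theorem comp_mk {n : ℕ} {k : Fin n → ℕ} {a : Fin n → C} {b : ∀ i, Fin (k i) → C} {t : C}
    (σ : Equiv.Perm (Fin n)) (f : ∀ i, a i ⟶ t)
    (τ : ∀ i, Equiv.Perm (Fin (k i))) (g : ∀ i j, b i j ⟶ a i) :
    (OpSet.mk σ f : OpSet P a t).comp (fun i => .mk (τ i) (g i)) =
      .mk (blockPerm σ τ) (concatHom fun i j => g i j ≫ f i) :=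
  compRep_congr _ (σ, f) _ (fun i => (τ i, g i)) (Quot.out_eq _) fun _ => Quot.out_eq _

/-- The unit operation `[e, id]`. -/
def OpSet.unit (t : C) : OpSet P (fun _ : Fin 1 => t) t := .mk 1 fun _ => 𝟙 t

/-- Order reversal, `[σ, f] ↦ [ρ σ, f]`. -/
def OpSet.rev {n : ℕ} {c : Fin n → C} {t : C} : OpSet P c t → OpSet P c t :=
  Quot.lift (fun a => .mk (Fin.revPerm * a.1) a.2) fun a b hab => by
    have := (mk_eq_iff (P := P)).1 (Quot.sound hab : OpSet.mk a.1 a.2 = OpSet.mk b.1 b.2)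
    rw [mk_eq_iff]
    refine ⟨this.1, fun x y h1 h2 => P.symm (this.2 y x ?_ ?_)⟩
    · simpa using h1
    · simpa using h2

end Operations

section SetLaws
variable {C : Type u} [Category.{v} C] {P : Orthogonality C}

theorem act_mk {m n : ℕ} {c : Fin n → C} {d : Fin m → C} (e : Fin m ≃ Fin n) (h : d = c ∘ e)
    (t : C) (σ : Equiv.Perm (Fin n)) (f : ∀ i, c i ⟶ t) :
    (OpSet.mk σ f : OpSet P c t).act e h t =
      .mk ((e.trans σ).trans (finCongr (Fin.equiv_iff_eq.1 ⟨e⟩).symm))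
        fun i => eqToHom (congrFun h i) ≫ f (e i) := rfl

theorem act_refl {n : ℕ} {c : Fin n → C} {t : C} (x : OpSet P c t) :
    x.act (Equiv.refl _) rfl t = x := by
  induction x using opSet_ind with | h σ f =>
  rw [act_mk]
  congr 1
  funext i
  exact Category.id_comp _

theorem act_act {m n l : ℕ} {c : Fin n → C} {d : Fin m → C} {d' : Fin l → C} (e : Fin m ≃ Fin n)
    (h : d = c ∘ e) (e' : Fin l ≃ Fin m) (h' : d' = d ∘ e') (t : C) (x : OpSet P c t) :
    (x.act e h t).act e' h' t = x.act (e'.trans e) (by rw [h', h]; rfl) t := by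
  induction x using opSet_ind with | h σ f =>
  rw [act_mk, act_mk, act_mk]
  congr 1
  funext i
  simp

theorem mk_congr {n : ℕ} {c : Fin n → C} {t : C} {σ σ' : Equiv.Perm (Fin n)}
    {f f' : ∀ i, c i ⟶ t} (h : ∀ x y, σ x < σ y → σ' x < σ' y) (h' : ∀ x, f x = f' x) :
    (OpSet.mk σ f : OpSet P c t) = .mk σ' f' := by
  rw [equiv_ext_lt σ σ' h, funext h']

theorem exists_rep {n : ℕ} {k : Fin n → ℕ} {a : Fin n → C} {b : ∀ i, Fin (k i) → C}
    (q : ∀ i, OpSet P (b i) (a i)) : ∃ (τ : ∀ i, Equiv.Perm (Fin (k i)))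
      (g : ∀ i j, b i j ⟶ a i), q = fun i => .mk (τ i) (g i) :=
  ⟨fun i => (Quot.out (q i)).1, fun i => (Quot.out (q i)).2,
    funext fun i => (Quot.out_eq (q i)).symm⟩

theorem comp_act_left {m n : ℕ} {k : Fin n → ℕ} {a : Fin n → C} {b : ∀ i, Fin (k i) → C} {t : C}
    (e : Fin m ≃ Fin n) (p : OpSet P a t) (q : ∀ i, OpSet P (b i) (a i)) :
    (p.act e rfl t).comp (fun i => q (e i)) =
      (p.comp q).act (blockEquiv e k) (concat_block e b) t := by
  induction p using opSet_ind with | h σ f =>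
  obtain ⟨τ, g, rfl⟩ := exists_rep q
  rw [act_mk, comp_mk, comp_mk, act_mk]
  refine mk_congr (fun x y h => ?_) (fun x => ?_)
  · obtain ⟨⟨i, j⟩, rfl⟩ := finSigmaFinEquiv.surjective x
    obtain ⟨⟨i', j'⟩, rfl⟩ := finSigmaFinEquiv.surjective y
    rw [blockPerm_lt, Equiv.symm_apply_apply, Equiv.symm_apply_apply, Sigma.lex_iff] at h
    simp only [Equiv.trans_apply, Fin.lt_def, finCongr_apply_coe] at h ⊢
    rw [← Fin.lt_def, blockPerm_lt, blockEquiv_split, blockEquiv_split, Sigma.lex_iff]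
    rcases h with h | ⟨h, h'⟩
    · exact Or.inl h
    · obtain rfl : i = i' := h
      exact Or.inr ⟨rfl, h'⟩
  · obtain ⟨⟨i, j⟩, rfl⟩ := finSigmaFinEquiv.surjective x
    rw [concatHom_eq _ (Equiv.symm_apply_apply _ _), concatHom_eq _ (blockEquiv_split _ _ _)]
    simp

theorem comp_act_right {n : ℕ} {k k' : Fin n → ℕ} {a : Fin n → C} {b : ∀ i, Fin (k i) → C}
    {b' : ∀ i, Fin (k' i) → C} {t : C} (e : ∀ i, Fin (k' i) ≃ Fin (k i))
    (h : ∀ i, b' i = b i ∘ e i) (p : OpSet P a t) (q : ∀ i, OpSet P (b i) (a i)) :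
    p.comp (fun i => (q i).act (e i) (h i) (a i)) =
      (p.comp q).act (sumEquiv e) (concat_sum e h) t := by
  induction p using opSet_ind with | h σ f =>
  obtain ⟨τ, g, rfl⟩ := exists_rep q
  simp only [act_mk]
  rw [comp_mk, comp_mk, act_mk]
  refine mk_congr (fun x y h => ?_) (fun x => ?_)
  · obtain ⟨⟨i, j⟩, rfl⟩ := finSigmaFinEquiv.surjective x
    obtain ⟨⟨i', j'⟩, rfl⟩ := finSigmaFinEquiv.surjective y
    rw [blockPerm_lt, Equiv.symm_apply_apply, Equiv.symm_apply_apply, Sigma.lex_iff] at h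
    simp only [Equiv.trans_apply, Fin.lt_def, finCongr_apply_coe] at h ⊢
    rw [← Fin.lt_def, blockPerm_lt, sumEquiv_split, sumEquiv_split, Sigma.lex_iff]
    rcases h with h | ⟨h, h'⟩
    · exact Or.inl h
    · obtain rfl : i = i' := h
      exact Or.inr ⟨rfl, h'⟩
  · obtain ⟨⟨i, j⟩, rfl⟩ := finSigmaFinEquiv.surjective x
    rw [concatHom_eq _ (Equiv.symm_apply_apply _ _), concatHom_eq _ (sumEquiv_split _ _)]
    simp

theorem unit_comp {n : ℕ} {c : Fin n → C} {t : C} (p : OpSet P c t) :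
    (OpSet.unit t).comp (fun _ => p) = p.act (oneBlock n) (concat_one c) t := by
  induction p using opSet_ind with | h σ f =>
  rw [OpSet.unit, comp_mk, act_mk]
  refine mk_congr (fun x y h => ?_) (fun x => ?_)
  · obtain ⟨⟨i, j⟩, rfl⟩ := finSigmaFinEquiv.surjective x
    obtain ⟨⟨i', j'⟩, rfl⟩ := finSigmaFinEquiv.surjective y
    rw [blockPerm_lt, Sigma.lex_iff, Equiv.symm_apply_apply, Equiv.symm_apply_apply] at h
    rcases h with h | ⟨h, h'⟩
    · exact absurd (Subsingleton.elim _ _) h.ne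
    · obtain rfl : i = i' := h
      simpa [oneBlock] using h'
  · exact (Category.comp_id _).trans (Category.id_comp _).symm

theorem comp_unit {n : ℕ} {c : Fin n → C} {t : C} (p : OpSet P c t) :
    p.comp (fun i => OpSet.unit (c i)) = p.act (unitBlocks n) (concat_unit c) t := by
  induction p using opSet_ind with | h σ f =>
  unfold OpSet.unit
  rw [comp_mk, act_mk]
  refine mk_congr (fun x y h => ?_) (fun x => rfl)
  rw [blockPerm_lt, Sigma.lex_iff] at h
  rcases h with h | ⟨h, h'⟩
  · exact h
  · exact absurd (Subsingleton.elim _ _) h'.ne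

theorem lex_assoc {n : ℕ} {k : Fin n → ℕ} {l : ∀ i, Fin (k i) → ℕ} (σ : Equiv.Perm (Fin n))
    (τ : ∀ i, Equiv.Perm (Fin (k i))) (θ : ∀ i j, Equiv.Perm (Fin (l i j)))
    (p q : (i : Fin n) × Fin (k i)) (z : Fin (l p.1 p.2)) (w : Fin (l q.1 q.2))
    (h : Sigma.Lex (fun i i' => σ i < σ i')
      (fun i y y' => blockPerm (τ i) (θ i) y < blockPerm (τ i) (θ i) y')
      ⟨p.1, finSigmaFinEquiv ⟨p.2, z⟩⟩ ⟨q.1, finSigmaFinEquiv ⟨q.2, w⟩⟩) :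
    Sigma.Lex (fun i i' => σ i < σ i') (fun i j j' => τ i j < τ i j') p q ∨
      ∃ h : p = q, θ q.1 q.2 (h ▸ z) < θ q.1 q.2 w := by
  obtain ⟨i, j⟩ := p
  obtain ⟨i', j'⟩ := q
  rw [Sigma.lex_iff] at h
  rcases h with h | ⟨h, h'⟩
  · exact Or.inl (Sigma.Lex.left _ _ h)
  · obtain rfl : i = i' := h
    simp only [blockPerm_lt, Equiv.symm_apply_apply] at h'
    rw [Sigma.lex_iff] at h'
    rcases h' with h' | ⟨h, h'⟩
    · exact Or.inl (Sigma.Lex.right _ _ h')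
    · obtain rfl : j = j' := h
      exact Or.inr ⟨rfl, h'⟩

theorem comp_assoc {n : ℕ} {k : Fin n → ℕ} {l : ∀ i, Fin (k i) → ℕ} {a : Fin n → C}
    {b : ∀ i, Fin (k i) → C} {c : ∀ i j, Fin (l i j) → C} {t : C}
    (p : OpSet P a t) (q : ∀ i, OpSet P (b i) (a i)) (r : ∀ i j, OpSet P (c i j) (b i j)) :
    p.comp (fun i => (q i).comp (r i)) =
      ((p.comp q).comp fun x => r (finSigmaFinEquiv.symm x).1 (finSigmaFinEquiv.symm x).2).act
        (assocEquiv l) (concat_assoc c) t := by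
  induction p using opSet_ind with | h σ f =>
  obtain ⟨τ, g, rfl⟩ := exists_rep q
  obtain ⟨θ, h, hr⟩ : ∃ (θ : ∀ i j, Equiv.Perm (Fin (l i j)))
      (h : ∀ i j z, c i j z ⟶ b i j), r = fun i j => .mk (θ i j) (h i j) :=
    ⟨fun i j => (Quot.out (r i j)).1, fun i j => (Quot.out (r i j)).2,
      funext fun i => funext fun j => (Quot.out_eq (r i j)).symm⟩
  subst hr
  simp only [comp_mk]
  rw [act_mk]
  refine mk_congr (fun x y hxy => ?_) (fun x => ?_)
  · obtain ⟨x, z, rfl⟩ := assocEquiv_surj l x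
    obtain ⟨y, w, rfl⟩ := assocEquiv_surj l y
    simp only [Equiv.trans_apply, Fin.lt_def, finCongr_apply_coe]
    rw [← Fin.lt_def, assocEquiv_merge, assocEquiv_merge, blockPerm_lt, Equiv.symm_apply_apply,
      Equiv.symm_apply_apply]
    rw [blockPerm_lt, Equiv.symm_apply_apply, Equiv.symm_apply_apply] at hxy
    rcases lex_assoc σ τ θ _ _ _ _ hxy with h1 | ⟨h1, h2⟩
    · exact Sigma.Lex.left _ _ ((blockPerm_lt _ _ _ _).2 h1)
    · obtain rfl := finSigmaFinEquiv.symm.injective h1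
      exact Sigma.Lex.right _ _ h2
  · obtain ⟨x, z, rfl⟩ := assocEquiv_surj l x
    rw [concatHom_eq _ (Equiv.symm_apply_apply _ _)]
    dsimp only
    rw [concatHom_eq (fun j z => h _ j z ≫ g _ j) (Equiv.symm_apply_apply _ _),
      concatHom_eq (k := concat l) _ (p := ⟨x, z⟩) (by rw [assocEquiv_merge, Equiv.symm_apply_apply])]
    simp only [concatHom, Category.assoc, eqToHom_trans_assoc]

theorem rev_mk {n : ℕ} {c : Fin n → C} {t : C} (σ : Equiv.Perm (Fin n)) (f : ∀ i, c i ⟶ t) :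
    (OpSet.mk σ f : OpSet P c t).rev = .mk (Fin.revPerm * σ) f := rfl

theorem rev_rev {n : ℕ} {c : Fin n → C} {t : C} (p : OpSet P c t) : p.rev.rev = p := by
  induction p using opSet_ind with | h σ f =>
  rw [rev_mk, rev_mk]
  congr 1
  ext x
  simp

theorem rev_unit (t : C) : (OpSet.unit t : OpSet P _ t).rev = .unit t := by
  rw [OpSet.unit, rev_mk, Subsingleton.elim (Fin.revPerm * 1) 1]

theorem rev_act {m n : ℕ} {c : Fin n → C} {d : Fin m → C} (e : Fin m ≃ Fin n) (h : d = c ∘ e)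
    (t : C) (p : OpSet P c t) : (p.act e h t).rev = p.rev.act e h t := by
  induction p using opSet_ind with | h σ f =>
  rw [act_mk, rev_mk, rev_mk, act_mk]
  refine mk_congr (fun x y h => ?_) (fun x => rfl)
  simpa using h

theorem rev_comp {n : ℕ} {k : Fin n → ℕ} {a : Fin n → C} {b : ∀ i, Fin (k i) → C} {t : C}
    (p : OpSet P a t) (q : ∀ i, OpSet P (b i) (a i)) :
    (p.comp q).rev = p.rev.comp fun i => (q i).rev := by
  induction p using opSet_ind with | h σ f =>
  obtain ⟨τ, g, rfl⟩ := exists_rep q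
  simp only [rev_mk, comp_mk]
  refine mk_congr (fun x y h => ?_) (fun x => rfl)
  have h : blockPerm σ τ y < blockPerm σ τ x := by simpa using h
  rw [blockPerm_lt] at h ⊢
  obtain ⟨⟨i, j⟩, rfl⟩ := finSigmaFinEquiv.surjective x
  obtain ⟨⟨i', j'⟩, rfl⟩ := finSigmaFinEquiv.surjective y
  rw [Equiv.symm_apply_apply, Equiv.symm_apply_apply, Sigma.lex_iff] at h ⊢
  rcases h with h | ⟨h, h'⟩
  · exact Or.inl (by simpa using h)
  · obtain rfl : i' = i := h
    exact Or.inr ⟨rfl, by simpa using h'⟩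

end SetLaws

section Points
variable {M : Type u} [Category.{v} M] [MonoidalCategory M] {I : Type w} {I' : Type*}

/-- The tensor product of two points. -/
def pointMul {X Y : M} (p : tensorUnit M ⟶ X) (q : tensorUnit M ⟶ Y) : tensorUnit M ⟶ X ⊗ Y :=
  (λ_ (tensorUnit M)).inv ≫ (p ⊗ₘ q)

theorem pointMul_tensorHom {X Y X' Y' : M} (p : tensorUnit M ⟶ X) (q : tensorUnit M ⟶ Y) (f : X ⟶ X')
    (g : Y ⟶ Y') : pointMul p q ≫ (f ⊗ₘ g) = pointMul (p ≫ f) (q ≫ g) := by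
  simp [pointMul]

theorem pointMul_tensorHom_assoc {X Y X' Y' : M} (p : tensorUnit M ⟶ X) (q : tensorUnit M ⟶ Y) (f : X ⟶ X')
    (g : Y ⟶ Y') {Z' : M} (h' : _ ⟶ Z') :
    pointMul p q ≫ (f ⊗ₘ g) ≫ h' =
      pointMul (p ≫ f) (q ≫ g) ≫ h' := by
  rw [← pointMul_tensorHom, Category.assoc]

theorem pointMul_whiskerLeft {X Y Y' : M} (p : tensorUnit M ⟶ X) (q : tensorUnit M ⟶ Y)
    (g : Y ⟶ Y') : pointMul p q ≫ X ◁ g = pointMul p (q ≫ g) := by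
  rw [← id_tensorHom, pointMul_tensorHom, Category.comp_id]

theorem pointMul_whiskerLeft_assoc {X Y Y' : M} (p : tensorUnit M ⟶ X) (q : tensorUnit M ⟶ Y)
    (g : Y ⟶ Y') {Z' : M} (h' : _ ⟶ Z') :
    pointMul p q ≫ X ◁ g ≫ h' =
      pointMul p (q ≫ g) ≫ h' := by
  rw [← pointMul_whiskerLeft, Category.assoc]

theorem pointMul_whiskerRight {X Y X' : M} (p : tensorUnit M ⟶ X) (q : tensorUnit M ⟶ Y)
    (f : X ⟶ X') : pointMul p q ≫ f ▷ Y = pointMul (p ≫ f) q := by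
  rw [← tensorHom_id, pointMul_tensorHom, Category.comp_id]

theorem pointMul_whiskerRight_assoc {X Y X' : M} (p : tensorUnit M ⟶ X) (q : tensorUnit M ⟶ Y)
    (f : X ⟶ X') {Z' : M} (h' : _ ⟶ Z') :
    pointMul p q ≫ f ▷ Y ≫ h' =
      pointMul (p ≫ f) q ≫ h' := by
  rw [← pointMul_whiskerRight, Category.assoc]

theorem pointMul_assoc {X Y Z : M} (p : tensorUnit M ⟶ X) (q : tensorUnit M ⟶ Y) (r : tensorUnit M ⟶ Z) :
    pointMul (pointMul p q) r ≫ (α_ X Y Z).hom = pointMul p (pointMul q r) := by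
  unfold pointMul
  monoidal

theorem pointMul_assoc_assoc {X Y Z : M} (p : tensorUnit M ⟶ X) (q : tensorUnit M ⟶ Y) (r : tensorUnit M ⟶ Z) {Z' : M} (h' : _ ⟶ Z') :
    pointMul (pointMul p q) r ≫ (α_ X Y Z).hom ≫ h' =
      pointMul p (pointMul q r) ≫ h' := by
  rw [← pointMul_assoc, Category.assoc]

theorem pointMul_assoc_inv {X Y Z : M} (p : tensorUnit M ⟶ X) (q : tensorUnit M ⟶ Y) (r : tensorUnit M ⟶ Z) :
    pointMul p (pointMul q r) ≫ (α_ X Y Z).inv = pointMul (pointMul p q) r := by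
  rw [Iso.comp_inv_eq, pointMul_assoc]

theorem pointMul_assoc_inv_assoc {X Y Z : M} (p : tensorUnit M ⟶ X) (q : tensorUnit M ⟶ Y) (r : tensorUnit M ⟶ Z) {Z' : M} (h' : _ ⟶ Z') :
    pointMul p (pointMul q r) ≫ (α_ X Y Z).inv ≫ h' =
      pointMul (pointMul p q) r ≫ h' := by
  rw [← pointMul_assoc_inv, Category.assoc]

theorem pointMul_leftUnitor {X : M} (q : tensorUnit M ⟶ X) :
    pointMul (𝟙 _) q ≫ (λ_ X).hom = q := by
  simp [pointMul, MonoidalCategory.tensorHom_def]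

theorem pointMul_one {X : M} (q : tensorUnit M ⟶ X) :
    pointMul q (𝟙 _) = q ≫ (ρ_ X).inv := by
  simp [pointMul, MonoidalCategory.tensorHom_def, unitors_inv_equal]

theorem pointMul_one_left {X : M} (q : tensorUnit M ⟶ X) :
    pointMul (𝟙 _) q = q ≫ (λ_ X).inv := by
  simp [pointMul, MonoidalCategory.tensorHom_def]

theorem point_unitors {X Y : M} (p : tensorUnit M ⟶ X) (q : tensorUnit M ⟶ Y) :
    p ≫ (λ_ X).inv ≫ (q ⊗ₘ (ρ_ X).inv) = pointMul q (pointMul p (𝟙 _)) := by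
  rw [← Category.assoc, ← pointMul_one_left, pointMul_tensorHom, Category.id_comp, pointMul_one]

theorem tensPoint_map (l : List I) {X Y : I → M} (p : ∀ i, tensorUnit M ⟶ X i) (f : ∀ i, X i ⟶ Y i) :
    tensPoint l p ≫ tensMap l f = tensPoint l (fun i => p i ≫ f i) := by
  induction l with
  | nil => exact Category.comp_id _
  | cons a l ih => exact (pointMul_tensorHom _ _ _ _).trans (by rw [ih]; rfl)

theorem tensPoint_append (l l' : List I) {X : I → M} (p : ∀ i, tensorUnit M ⟶ X i) :
    pointMul (tensPoint l p) (tensPoint l' p) ≫ tensAppend l l' X = tensPoint (l ++ l') p := by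
  induction l with
  | nil => exact pointMul_leftUnitor _
  | cons a l ih =>
    refine (pointMul_assoc_assoc _ _ _ _).trans ?_
    exact (pointMul_whiskerLeft _ _ _).trans (by rw [ih]; rfl)

theorem tensPoint_mapIndex (f : I → I') (l : List I) {X : I' → M} (p : ∀ i, tensorUnit M ⟶ X i) :
    tensPoint l (fun i => p (f i)) ≫ tensMapIndex f l X = tensPoint (l.map f) p := by
  induction l with
  | nil => exact Category.comp_id _
  | cons a l ih => exact (pointMul_whiskerLeft _ _ _).trans (by rw [ih]; rfl)

theorem tensPoint_unmapIndex (f : I → I') (l : List I) {X : I' → M} (p : ∀ i, tensorUnit M ⟶ X i) :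
    tensPoint (l.map f) p ≫ tensUnmapIndex f l X = tensPoint l (fun i => p (f i)) := by
  induction l with
  | nil => exact Category.comp_id _
  | cons a l ih => exact (pointMul_whiskerLeft _ _ _).trans (by rw [ih]; rfl)

theorem tensPoint_sigma {K : I → Type*} (l : List I) (k : ∀ i, List (K i))
    {X : (i : I) × K i → M} (p : ∀ i, tensorUnit M ⟶ X i) :
    tensPoint l (fun i => tensPoint (k i) fun j => p ⟨i, j⟩) ≫ tensSigma l k X =
      tensPoint (l.sigma k) p := by
  induction l with
  | nil => exact Category.comp_id _
  | cons a l ih =>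
    refine (pointMul_tensorHom_assoc _ _ _ _ _).trans ?_
    rw [ih, tensPoint_mapIndex]
    exact tensPoint_append _ _ _

theorem tensPoint_sigma_assoc {K : I → Type*} (l : List I) (k : ∀ i, List (K i))
    {X : (i : I) × K i → M} (p : ∀ i, tensorUnit M ⟶ X i) {Z' : M} (h' : _ ⟶ Z') :
    tensPoint l (fun i => tensPoint (k i) fun j => p ⟨i, j⟩) ≫ tensSigma l k X ≫ h' =
      tensPoint (l.sigma k) p ≫ h' := by
  rw [← tensPoint_sigma, Category.assoc]

theorem tensPoint_eqToHom {l l' : List I} (h : l = l') {X : I → M} (p : ∀ i, tensorUnit M ⟶ X i) :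
    tensPoint l p ≫ eqToHom (by rw [h]) = tensPoint l' p := by
  subst h; exact Category.comp_id _

theorem tensPoint_flatten {n : ℕ} {k : Fin n → ℕ} {X : ∀ i, Fin (k i) → M}
    (p : ∀ i j, tensorUnit M ⟶ X i j) :
    tensPoint (List.finRange n) (fun i => tensPoint (List.finRange (k i)) (p i)) ≫ tensFlatten X =
      tensPoint (List.finRange (∑ i, k i)) (X := concat X)
        fun x => p (finSigmaFinEquiv.symm x).1 (finSigmaFinEquiv.symm x).2 := by
  unfold tensFlatten
  refine (tensPoint_sigma_assoc _ _ (X := fun q : (i : Fin n) × Fin (k i) => X q.1 q.2)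
    (fun q => p q.1 q.2) _).trans ?_
  rw [← Category.assoc, tensPoint_eqToHom (finRange_sigma k), tensPoint_unmapIndex]

variable [SymmetricCategory M]

theorem pointMul_braiding {X Y : M} (p : tensorUnit M ⟶ X) (q : tensorUnit M ⟶ Y) :
    pointMul p q ≫ (β_ X Y).hom = pointMul q p := by
  simp [pointMul, unitors_inv_equal]

theorem pointMul_tensorμ {X Y Z W : M} (p : tensorUnit M ⟶ X) (q : tensorUnit M ⟶ Y) (r : tensorUnit M ⟶ Z)
    (s : tensorUnit M ⟶ W) : pointMul (pointMul p q) (pointMul r s) ≫ tensorμ X Y Z W =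
      pointMul (pointMul p r) (pointMul q s) := by
  unfold tensorμ
  rw [pointMul_assoc_assoc, pointMul_whiskerLeft_assoc, pointMul_assoc_inv,
    pointMul_whiskerLeft_assoc, pointMul_whiskerRight, pointMul_braiding,
    pointMul_whiskerLeft_assoc, pointMul_assoc, pointMul_assoc_inv]

theorem tensPoint_zip (l : List I) {X Y : I → M} (p : ∀ i, tensorUnit M ⟶ X i) (q : ∀ i, tensorUnit M ⟶ Y i) :
    tensPoint l (fun i => pointMul (p i) (q i)) ≫ tensZip l X Y =
      pointMul (tensPoint l p) (tensPoint l q) := by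
  induction l with
  | nil =>
    exact (Category.id_comp _).trans (((pointMul_one_left (𝟙 _)).trans (Category.id_comp _)).symm)
  | cons a l ih =>
    refine (pointMul_whiskerLeft_assoc _ _ _ _).trans ?_
    rw [ih]
    exact pointMul_tensorμ _ _ _ _

theorem tensPoint_pull [DecidableEq I] {X : I → M} (p : ∀ i, tensorUnit M ⟶ X i) (i : I) (l : List I)
    (h : i ∈ l) : tensPoint l p ≫ tensPull X i l h = pointMul (p i) (tensPoint (l.erase i) p) := by
  induction l with
  | nil => exact absurd h List.not_mem_nil
  | cons a l ih =>
    unfold tensPull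
    split_ifs with e
    · have : ∀ l' (hl : a :: l = i :: l'), tensPoint (a :: l) p ≫ eqToHom (by rw [hl]) =
          tensPoint (i :: l') p := fun l' hl => tensPoint_eqToHom hl p
      have h2 := this ((a :: l).erase i) (by subst e; simp)
      exact h2
    · refine (pointMul_whiskerLeft_assoc _ _ _ _).trans ?_
      rw [ih, pointMul_assoc_inv_assoc, pointMul_whiskerRight_assoc, pointMul_braiding,
        pointMul_assoc_assoc]
      have : ∀ l' (hl : a :: l.erase i = l'), pointMul (p i) (pointMul (p a) (tensPoint (l.erase i) p)) ≫
          eqToHom (by rw [← hl]; rfl) = pointMul (p i) (tensPoint l' p) := fun l' hl => by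
        subst hl; exact Category.comp_id _
      exact this _ (List.erase_cons_tail (by simpa using e)).symm

theorem tensPoint_pull_assoc [DecidableEq I] {X : I → M} (p : ∀ i, tensorUnit M ⟶ X i) (i : I) (l : List I)
    (h : i ∈ l) {Z' : M} (h' : _ ⟶ Z') :
    tensPoint l p ≫ tensPull X i l h ≫ h' =
      pointMul (p i) (tensPoint (l.erase i) p) ≫ h' := by
  rw [← tensPoint_pull, Category.assoc]

theorem tensPoint_reorder [DecidableEq I] {X : I → M} (p : ∀ i, tensorUnit M ⟶ X i) (l l' : List I)
    (h : l.Perm l') : tensPoint l p ≫ tensReorder X l l' h = tensPoint l' p := by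
  induction l' generalizing l with
  | nil => exact tensPoint_eqToHom h.eq_nil p
  | cons a l' ih =>
    unfold tensReorder
    refine (tensPoint_pull_assoc p a l _ _).trans ?_
    exact (pointMul_whiskerLeft _ _ _).trans (by rw [ih]; rfl)

theorem tensPoint_reorder_assoc [DecidableEq I] {X : I → M} (p : ∀ i, tensorUnit M ⟶ X i) (l l' : List I)
    (h : l.Perm l') {Z' : M} (h' : _ ⟶ Z') :
    tensPoint l p ≫ tensReorder X l l' h ≫ h' =
      tensPoint l' p ≫ h' := by
  rw [← tensPoint_reorder p l l' h, Category.assoc]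

theorem tensPoint_perm {m n : ℕ} (e : Fin m ≃ Fin n) {X : Fin n → M} (p : ∀ i, tensorUnit M ⟶ X i) :
    tensPoint (List.finRange n) p ≫ tensPerm e X =
      tensPoint (List.finRange m) fun i => p (e i) := by
  unfold tensPerm
  rw [tensPoint_reorder_assoc, tensPoint_unmapIndex]

end Points

section Copowers
variable {M : Type u} [Category.{v} M] [MonoidalCategory M] [HasColimits M]

/-- The `Set`-tensoring `S ⊗ 𝟙 = ∐_{s ∈ S} 𝟙` of the monoidal unit. -/
noncomputable def cop (M : Type u) [Category.{v} M] [MonoidalCategory M] [HasColimits M]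
    (S : Type v) : M := ∐ fun _ : S => tensorUnit M

/-- The coproduct inclusions. -/
noncomputable def copι {S : Type v} (s : S) : tensorUnit M ⟶ cop M S := Sigma.ι (fun _ : S => tensorUnit M) s

/-- The universal property of the coproduct. -/
noncomputable def copDesc {S : Type v} {Z : M} (g : S → (tensorUnit M ⟶ Z)) : cop M S ⟶ Z := Sigma.desc g

/-- Functoriality of the `Set`-tensoring. -/
noncomputable def copMap {S T : Type v} (g : S → T) : cop M S ⟶ cop M T :=
  copDesc fun s => copι (g s)

@[simp]
theorem copι_desc {S : Type v} {Z : M} (g : S → (tensorUnit M ⟶ Z)) (s : S) :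
    copι s ≫ copDesc g = g s := Sigma.ι_desc _ _

theorem copι_desc_assoc {S : Type v} {Z Z' : M} (g : S → (tensorUnit M ⟶ Z)) (s : S) (h' : Z ⟶ Z') :
    copι s ≫ copDesc g ≫ h' = g s ≫ h' := by
  rw [← Category.assoc, copι_desc]

@[simp]
theorem copι_map {S T : Type v} (g : S → T) (s : S) :
    (copι s : tensorUnit M ⟶ _) ≫ copMap g = copι (g s) := copι_desc _ _

theorem copι_map_assoc {S T : Type v} (g : S → T) (s : S) {Z' : M} (h' : _ ⟶ Z') :
    (copι s : tensorUnit M ⟶ _) ≫ copMap g ≫ h' =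
      copι (g s) ≫ h' := by
  rw [← copι_map, Category.assoc]

@[ext]
theorem cop_ext {S : Type v} {Z : M} {f g : cop M S ⟶ Z} (h : ∀ s, copι s ≫ f = copι s ≫ g) :
    f = g := Sigma.hom_ext _ _ h

variable [SymmetricCategory M] [MonoidalClosed M]

/-- Morphisms out of `(S ⊗ 𝟙) ⊗ Y`, by closedness. -/
noncomputable def copDescTensor {S : Type v} {Y Z : M} (g : S → (Y ⟶ Z)) : cop M S ⊗ Y ⟶ Z :=
  (β_ _ _).hom ≫ MonoidalClosed.uncurry (copDesc fun s => MonoidalClosed.curry ((ρ_ Y).hom ≫ g s))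

/-- The canonical isomorphism `(S ⊗ 𝟙) ⊗ (T ⊗ 𝟙) ≅ (S × T) ⊗ 𝟙`. -/
noncomputable def copPair (S T : Type v) : cop M S ⊗ cop M T ⟶ cop M (S × T) :=
  copDescTensor fun s => copMap fun t => (s, t)

theorem copι_descTensor {S : Type v} {Y Z : M} (g : S → (Y ⟶ Z)) (s : S) :
    copι s ▷ Y ≫ copDescTensor g = (λ_ Y).hom ≫ g s := by
  unfold copDescTensor
  rw [BraidedCategory.braiding_naturality_left_assoc, ← MonoidalClosed.uncurry_natural_left,
    copι_desc, MonoidalClosed.uncurry_curry]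
  simp

theorem copTensor_ext {S : Type v} {Y Z : M} {f g : cop M S ⊗ Y ⟶ Z}
    (h : ∀ s, copι s ▷ Y ≫ f = copι s ▷ Y ≫ g) : f = g := by
  rw [← cancel_epi (β_ (cop M S) Y).inv]
  apply MonoidalClosed.curry_injective
  apply cop_ext
  intro s
  rw [← MonoidalClosed.curry_natural_left, ← MonoidalClosed.curry_natural_left]
  congr 1
  have := h s
  rw [← cancel_epi (β_ (tensorUnit M) Y).inv] at this
  simpa using this

theorem pointMul_copPair {S T : Type v} (s : S) (t : T) :
    pointMul (copι s : tensorUnit M ⟶ _) (copι t) ≫ copPair S T = copι (s, t) := by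
  rw [pointMul, MonoidalCategory.tensorHom_def', Category.assoc, Category.assoc, copPair,
    copι_descTensor, leftUnitor_naturality_assoc, copι_map]
  simp

theorem pointMul_copPair_assoc {S T : Type v} (s : S) (t : T) {Z' : M} (h' : _ ⟶ Z') :
    pointMul (copι s : tensorUnit M ⟶ _) (copι t) ≫ copPair S T ≫ h' =
      copι (s, t) ≫ h' := by
  rw [← pointMul_copPair, Category.assoc]

/-- The canonical isomorphism `⨂_{i ∈ l} (Sᵢ ⊗ 𝟙) ≅ (∏_{i ∈ l} Sᵢ) ⊗ 𝟙`, for a list `l` without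
repetitions. -/
noncomputable def copCollect {I : Type} [DecidableEq I] (S : I → Type v) :
    (l : List I) → (tens l (fun i => cop M (S i)) ⟶ cop M (∀ i, i ∈ l → S i))
  | [] => copι fun _ h => absurd h List.not_mem_nil
  | a :: l => _ ◁ copCollect S l ≫ copPair _ _ ≫ copMap fun p i h =>
      if e : a = i then e ▸ p.1 else p.2 i ((List.mem_cons.1 h).resolve_left (Ne.symm e))

theorem tensPoint_collect {I : Type} [DecidableEq I] {S : I → Type v} (l : List I) (s : ∀ i, S i) :
    tensPoint l (fun i => (copι (s i) : tensorUnit M ⟶ _)) ≫ copCollect S l = copι fun i _ => s i := by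
  induction l with
  | nil =>
    refine (Category.id_comp _).trans (congrArg copι ?_)
    funext i h
    exact absurd h List.not_mem_nil
  | cons a l ih =>
    refine (pointMul_whiskerLeft_assoc _ _ _ _).trans ?_
    rw [ih, pointMul_copPair_assoc, copι_map]
    congr 1
    funext i h
    split_ifs with e
    · subst e; rfl
    · rfl

/-- A set of points of `X` is generating if morphisms out of all `X ⊗ Y` are determined by their
restrictions along these points. -/
def Generates {X : M} (A : (tensorUnit M ⟶ X) → Prop) : Prop :=
  ∀ ⦃Y Z : M⦄ (f g : X ⊗ Y ⟶ Z), (∀ p, A p → p ▷ Y ≫ f = p ▷ Y ≫ g) → f = g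

theorem Generates.ext {X Z : M} {A : (tensorUnit M ⟶ X) → Prop} (h : Generates A) {f g : X ⟶ Z}
    (hfg : ∀ p, A p → p ≫ f = p ≫ g) : f = g := by
  have := h (Y := tensorUnit M) ((ρ_ X).hom ≫ f) ((ρ_ X).hom ≫ g) fun p hp => by
    rw [rightUnitor_naturality_assoc, rightUnitor_naturality_assoc, hfg p hp]
  simpa using this

theorem generates_cop (S : Type v) : Generates (M := M) fun p => ∃ s : S, p = copι s :=
  fun _ _ _ _ h => copTensor_ext fun s => h _ ⟨s, rfl⟩

theorem Generates.tensor {X X' : M} {A : (tensorUnit M ⟶ X) → Prop} {B : (tensorUnit M ⟶ X') → Prop}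
    (hA : Generates A) (hB : Generates B) :
    Generates fun r => ∃ p q, A p ∧ B q ∧ r = pointMul p q := by
  intro Y Z f g h
  rw [← cancel_epi (α_ X X' Y).inv]
  apply hA
  intro p hp
  rw [← cancel_epi (λ_ (X' ⊗ Y)).inv]
  apply hB
  intro q hq
  have := h _ ⟨p, q, hp, hq, rfl⟩
  have key : q ▷ Y ≫ (λ_ (X' ⊗ Y)).inv ≫ p ▷ (X' ⊗ Y) ≫ (α_ X X' Y).inv = pointMul p q ▷ Y := by
    rw [pointMul, MonoidalCategory.tensorHom_def']
    monoidal
  rw [← key] at this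
  simpa only [Category.assoc] using this

theorem generates_tens {n : ℕ} {X : Fin n → M} {A : ∀ i, (tensorUnit M ⟶ X i) → Prop}
    (h : ∀ i, Generates (A i)) : Generates (X := tens (List.finRange n) X)
      fun r => ∃ p : ∀ i, tensorUnit M ⟶ X i, (∀ i, A i (p i)) ∧ r = tensPoint _ p := by
  have key : ∀ l : List (Fin n), l.Nodup → Generates (X := tens l X) fun r =>
      ∃ p : ∀ i, i ∈ l → (tensorUnit M ⟶ X i), (∀ i hi, A i (p i hi)) ∧
        ∀ p' : ∀ i, tensorUnit M ⟶ X i, (∀ i hi, p' i = p i hi) → r = tensPoint l p' := by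
    intro l hl
    induction l with
    | nil =>
      intro Y Z f g h
      have := h (𝟙 _) ⟨fun i hi => absurd hi List.not_mem_nil, fun i hi => absurd hi List.not_mem_nil,
        fun _ _ => rfl⟩
      rw [← Category.id_comp f, ← Category.id_comp g, ← id_whiskerRight]
      exact this
    | cons a l ih =>
      intro Y Z f g hfg
      refine (h a).tensor (ih hl.of_cons) f g ?_
      rintro _ ⟨p, q, hp, ⟨s, hs, hs'⟩, rfl⟩
      refine hfg _ ⟨fun i hi => if e : a = i then e ▸ p else
        s i ((List.mem_cons.1 hi).resolve_left (Ne.symm e)), fun i hi => ?_, fun p' hp' => ?_⟩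
      · dsimp only
        split_ifs with e
        · subst e; exact hp
        · exact hs _ _
      · have h1 := hp' a List.mem_cons_self
        dsimp only at h1
        rw [dif_pos rfl] at h1
        rw [hs' p' fun i hi => ?_]
        · change _ = pointMul _ _
          rw [h1]
        · refine (hp' i (List.mem_cons_of_mem _ hi)).trans (dif_neg ?_)
          rintro rfl
          exact (List.nodup_cons.1 hl).1 hi
  intro Y Z f g hfg
  refine key _ (List.nodup_finRange n) f g ?_
  rintro r ⟨p, hp, hr⟩
  exact hfg r ⟨fun i => p i (List.mem_finRange i), fun i => hp _ _, hr _ fun _ _ => rfl⟩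

end Copowers

section Involutive

/-- The structure of an involutive symmetric monoidal category `(M, J, j)`: a (lax) symmetric
monoidal endofunctor `J` and a monoidal natural isomorphism `j : Id ≅ J²` with `jJ = Jj`. -/
structure Involution (M : Type u) [Category.{v} M] [MonoidalCategory M] [SymmetricCategory M] where
  J : M ⥤ M
  laxBraided : J.LaxBraided
  j : 𝟭 M ≅ J ⋙ J
  monoidal : NatTrans.IsMonoidal j.hom
  j_J : ∀ X : M, j.hom.app (J.obj X) = J.map (j.hom.app X)

attribute [instance] Involution.laxBraided

open Functor.LaxMonoidal

variable {M : Type u} [Category.{v} M] [MonoidalCategory M] [SymmetricCategory M]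

/-- The `n`-fold iteration `⨂ᵢ J Xᵢ ⟶ J (⨂ᵢ Xᵢ)` of the monoidal structure of `J`. -/
def Involution.tensJ (𝒥 : Involution M) {I : Type w} : (l : List I) → (X : I → M) →
    (tens l (fun i => 𝒥.J.obj (X i)) ⟶ 𝒥.J.obj (tens l X))
  | [], _ => ε 𝒥.J
  | i :: l, X => 𝒥.J.obj (X i) ◁ tensJ 𝒥 l X ≫ μ 𝒥.J (X i) (tens l X)

theorem Involution.unit_j (𝒥 : Involution M) : ε 𝒥.J ≫ 𝒥.J.map (ε 𝒥.J) = 𝒥.j.hom.app (tensorUnit M) := by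
  have := 𝒥.monoidal.unit
  simpa using this.symm

theorem Involution.pointMul_ε (𝒥 : Involution M) {X Y : M} (p : tensorUnit M ⟶ X) (q : tensorUnit M ⟶ Y) :
    pointMul (ε 𝒥.J ≫ 𝒥.J.map p) (ε 𝒥.J ≫ 𝒥.J.map q) ≫ μ 𝒥.J X Y =
      ε 𝒥.J ≫ 𝒥.J.map (pointMul p q) := by
  rw [← pointMul_tensorHom, Category.assoc, μ_natural, pointMul, pointMul, Functor.map_comp,
    ← left_unitality_inv_assoc]
  simp [MonoidalCategory.tensorHom_def, unitors_inv_equal]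

theorem Involution.tensPoint_ε (𝒥 : Involution M) {I : Type w} (l : List I) {X : I → M}
    (p : ∀ i, tensorUnit M ⟶ X i) :
    tensPoint l (fun i => ε 𝒥.J ≫ 𝒥.J.map (p i)) ≫ 𝒥.tensJ l X =
      ε 𝒥.J ≫ 𝒥.J.map (tensPoint l p) := by
  induction l with
  | nil =>
    refine (Category.id_comp _).trans ?_
    exact ((congrArg (ε 𝒥.J ≫ ·) (𝒥.J.map_id _)).trans (Category.comp_id _)).symm
  | cons a l ih =>
    refine (pointMul_whiskerLeft_assoc _ _ _ _).trans ?_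
    rw [ih]
    exact 𝒥.pointMul_ε _ _

/-- A `*`-object in `(M, J, j)`. -/
structure StarObj (𝒥 : Involution M) where
  X : M
  star : X ⟶ 𝒥.J.obj X
  star_star : star ≫ 𝒥.J.map star = 𝒥.j.hom.app X

/-- A `*`-morphism. -/
@[ext]
structure StarObj.Hom {𝒥 : Involution M} (A B : StarObj 𝒥) where
  hom : A.X ⟶ B.X
  star_hom : A.star ≫ 𝒥.J.map hom = hom ≫ B.star

instance (𝒥 : Involution M) : Category (StarObj 𝒥) where
  Hom := StarObj.Hom
  id A := ⟨𝟙 _, by simp⟩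
  comp f g := ⟨f.hom ≫ g.hom, by
    rw [Functor.map_comp, ← Category.assoc, f.star_hom, Category.assoc, g.star_hom, Category.assoc]⟩

end Involutive

section Operads

/-- A colored operad with set of colors `𝔠` and values in `M`. A sequence of colors is a map
`c : Fin n → 𝔠`, and a permutation `e` acts by `c ↦ c ∘ e`; the formulation with bijections
`Fin m ≃ Fin n` (where `m = n` necessarily) absorbs the identifications of the lengths of
iterated concatenations. -/
structure ColoredOperad (𝔠 : Type w) (M : Type u) [Category.{v} M] [MonoidalCategory M]
    [SymmetricCategory M] where
  /-- The object of operations with inputs `c` and output `t`. -/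
  obj {n : ℕ} (c : Fin n → 𝔠) (t : 𝔠) : M
  /-- The action of permutations. -/
  act {m n : ℕ} {c : Fin n → 𝔠} {d : Fin m → 𝔠} (e : Fin m ≃ Fin n) (h : d = c ∘ e) (t : 𝔠) :
    obj c t ⟶ obj d t
  /-- The operadic unit. -/
  unit (t : 𝔠) : tensorUnit M ⟶ obj (fun _ : Fin 1 => t) t
  /-- The operadic composition. -/
  comp {n : ℕ} {k : Fin n → ℕ} (a : Fin n → 𝔠) (b : ∀ i, Fin (k i) → 𝔠) (t : 𝔠) :
    obj a t ⊗ tens (List.finRange n) (fun i => obj (b i) (a i)) ⟶ obj (concat b) t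
  act_refl {n : ℕ} (c : Fin n → 𝔠) (t : 𝔠) : act (Equiv.refl _) rfl t = 𝟙 (obj c t)
  act_act {m n l : ℕ} {c : Fin n → 𝔠} {d : Fin m → 𝔠} {d' : Fin l → 𝔠} (e : Fin m ≃ Fin n)
    (h : d = c ∘ e) (e' : Fin l ≃ Fin m) (h' : d' = d ∘ e') (t : 𝔠) :
    act e h t ≫ act e' h' t = act (e'.trans e) (by rw [h', h]; rfl) t
  comp_act_left {m n : ℕ} {k : Fin n → ℕ} (e : Fin m ≃ Fin n) (a : Fin n → 𝔠)
    (b : ∀ i, Fin (k i) → 𝔠) (t : 𝔠) :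
    (act (c := a) e rfl t ⊗ₘ tensPerm e fun i => obj (b i) (a i)) ≫
        comp (a ∘ e) (fun i => b (e i)) t =
      comp a b t ≫ act (blockEquiv e k) (concat_block e b) t
  comp_act_right {n : ℕ} {k k' : Fin n → ℕ} (a : Fin n → 𝔠) {b : ∀ i, Fin (k i) → 𝔠}
    {b' : ∀ i, Fin (k' i) → 𝔠} (e : ∀ i, Fin (k' i) ≃ Fin (k i)) (h : ∀ i, b' i = b i ∘ e i)
    (t : 𝔠) :
    obj a t ◁ tensMap _ (fun i => act (e i) (h i) (a i)) ≫ comp a b' t =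
      comp a b t ≫ act (sumEquiv e) (concat_sum e h) t
  unit_comp {n : ℕ} (c : Fin n → 𝔠) (t : 𝔠) :
    (λ_ (obj c t)).inv ≫ (unit t ⊗ₘ (ρ_ (obj c t)).inv) ≫ comp (fun _ : Fin 1 => t) (fun _ => c) t =
      act (oneBlock n) (concat_one c) t
  comp_unit {n : ℕ} (c : Fin n → 𝔠) (t : 𝔠) :
    (ρ_ (obj c t)).inv ≫ obj c t ◁ tensPoint _ (fun i => unit (c i)) ≫ comp c (fun i _ => c i) t =
      act (unitBlocks n) (concat_unit c) t
  comp_comp {n : ℕ} {k : Fin n → ℕ} {l : ∀ i, Fin (k i) → ℕ} (a : Fin n → 𝔠)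
    (b : ∀ i, Fin (k i) → 𝔠) (c : ∀ i j, Fin (l i j) → 𝔠) (t : 𝔠) :
    obj a t ◁ tensMap _ (fun i => comp (b i) (c i) (a i)) ≫ comp a (fun i => concat (c i)) t =
      obj a t ◁ tensZip _ _ (fun i => tens _ fun j => obj (c i j) (b i j)) ≫ (α_ _ _ _).inv ≫
        (comp a b t ⊗ₘ tensFlatten fun i j => obj (c i j) (b i j)) ≫
          comp (concat b)
            (fun x => c (finSigmaFinEquiv.symm x).1 (finSigmaFinEquiv.symm x).2) t ≫
            act (assocEquiv l) (concat_assoc c) t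

open Functor.LaxMonoidal

/-- A colored `*`-operad with values in `(M, J, j)`. -/
structure ColoredStarOperad (𝔠 : Type w) {M : Type u} [Category.{v} M] [MonoidalCategory M]
    [SymmetricCategory M] (𝒥 : Involution M) extends ColoredOperad 𝔠 M where
  /-- The `*`-involution. -/
  star {n : ℕ} (c : Fin n → 𝔠) (t : 𝔠) : obj c t ⟶ 𝒥.J.obj (obj c t)
  act_star {m n : ℕ} {c : Fin n → 𝔠} {d : Fin m → 𝔠} (e : Fin m ≃ Fin n) (h : d = c ∘ e) (t : 𝔠) :
    act e h t ≫ star d t = star c t ≫ 𝒥.J.map (act e h t)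
  star_star {n : ℕ} (c : Fin n → 𝔠) (t : 𝔠) :
    star c t ≫ 𝒥.J.map (star c t) = 𝒥.j.hom.app (obj c t)
  unit_star (t : 𝔠) : unit t ≫ star _ t = ε 𝒥.J ≫ 𝒥.J.map (unit t)
  comp_star {n : ℕ} {k : Fin n → ℕ} (a : Fin n → 𝔠) (b : ∀ i, Fin (k i) → 𝔠) (t : 𝔠) :
    comp a b t ≫ star (concat b) t =
      (star a t ⊗ₘ (tensMap _ (fun i => star (b i) (a i)) ≫ 𝒥.tensJ _ _)) ≫
        μ 𝒥.J _ _ ≫ 𝒥.J.map (comp a b t)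

variable {𝔠 : Type w} {M : Type u} [Category.{v} M] [MonoidalCategory M] [SymmetricCategory M]

/-- An algebra over a colored operad. -/
structure OperadAlgebra (O : ColoredOperad 𝔠 M) where
  X : 𝔠 → M
  /-- The structure maps. -/
  act {n : ℕ} (c : Fin n → 𝔠) (t : 𝔠) :
    O.obj c t ⊗ tens (List.finRange n) (fun i => X (c i)) ⟶ X t
  act_perm {m n : ℕ} (e : Fin m ≃ Fin n) (c : Fin n → 𝔠) (t : 𝔠) :
    (O.act (c := c) e rfl t ⊗ₘ tensPerm e fun i => X (c i)) ≫ act (c ∘ e) t = act c t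
  act_unit (t : 𝔠) :
    (λ_ (X t)).inv ≫ (O.unit t ⊗ₘ (ρ_ (X t)).inv) ≫ act (fun _ : Fin 1 => t) t = 𝟙 (X t)
  act_comp {n : ℕ} {k : Fin n → ℕ} (a : Fin n → 𝔠) (b : ∀ i, Fin (k i) → 𝔠) (t : 𝔠) :
    O.obj a t ◁ tensMap _ (fun i => act (b i) (a i)) ≫ act a t =
      O.obj a t ◁ tensZip _ _ (fun i => tens _ fun j => X (b i j)) ≫ (α_ _ _ _).inv ≫
        (O.comp a b t ⊗ₘ tensFlatten fun i j => X (b i j)) ≫ act (concat b) t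

/-- A `*`-algebra over a colored `*`-operad. -/
structure StarAlgebra {𝒥 : Involution M} (O : ColoredStarOperad 𝔠 𝒥) extends
    OperadAlgebra O.toColoredOperad where
  /-- The `*`-involution. -/
  star (t : 𝔠) : X t ⟶ 𝒥.J.obj (X t)
  star_star (t : 𝔠) : star t ≫ 𝒥.J.map (star t) = 𝒥.j.hom.app (X t)
  act_star {n : ℕ} (c : Fin n → 𝔠) (t : 𝔠) :
    act c t ≫ star t =
      (O.star c t ⊗ₘ (tensMap _ (fun i => star (c i)) ≫ 𝒥.tensJ _ _)) ≫
        μ 𝒥.J _ _ ≫ 𝒥.J.map (act c t)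

/-- A morphism of `*`-algebras. -/
@[ext]
structure StarAlgebra.Hom {𝒥 : Involution M} {O : ColoredStarOperad 𝔠 𝒥} (A B : StarAlgebra O) where
  hom (t : 𝔠) : A.X t ⟶ B.X t
  act_hom {n : ℕ} (c : Fin n → 𝔠) (t : 𝔠) :
    A.act c t ≫ hom t = O.obj c t ◁ tensMap _ (fun i => hom (c i)) ≫ B.act c t
  star_hom (t : 𝔠) : A.star t ≫ 𝒥.J.map (hom t) = hom t ≫ B.star t

theorem tensMap_id {I : Type*} (l : List I) (X : I → M) :
    tensMap l (fun i => 𝟙 (X i)) = 𝟙 (tens l X) := by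
  induction l with
  | nil => rfl
  | cons a l ih =>
    change 𝟙 _ ⊗ₘ tensMap l _ = _
    rw [ih, id_tensorHom_id]; rfl

theorem tensMap_comp {I : Type*} (l : List I) {X Y Z : I → M} (f : ∀ i, X i ⟶ Y i)
    (g : ∀ i, Y i ⟶ Z i) : tensMap l (fun i => f i ≫ g i) = tensMap l f ≫ tensMap l g := by
  induction l with
  | nil => exact (Category.comp_id _).symm
  | cons a l ih =>
    change _ ⊗ₘ tensMap l _ = (_ ⊗ₘ _) ≫ (_ ⊗ₘ _)
    rw [ih, tensorHom_comp_tensorHom]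

instance {𝒥 : Involution M} (O : ColoredStarOperad 𝔠 𝒥) : Category (StarAlgebra O) where
  Hom := StarAlgebra.Hom
  id A := ⟨fun t => 𝟙 (A.X t), fun c t => by simp [tensMap_id], fun t => by simp⟩
  comp f g := ⟨fun t => f.hom t ≫ g.hom t, fun c t => by
    rw [tensMap_comp, MonoidalCategory.whiskerLeft_comp, Category.assoc, ← g.act_hom,
      ← Category.assoc, f.act_hom, Category.assoc], fun t => by
    rw [Functor.map_comp, ← Category.assoc, f.star_hom, Category.assoc, g.star_hom, Category.assoc]⟩

/-- The family of `*`-objects underlying a `*`-algebra. -/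
def StarAlgebra.forget {𝒥 : Involution M} (O : ColoredStarOperad 𝔠 𝒥) :
    StarAlgebra O ⥤ (𝔠 → StarObj 𝒥) where
  obj A t := ⟨A.X t, A.star t, A.star_star t⟩
  map f t := ⟨f.hom t, f.star_hom t⟩

end Operads

section AQFTOperad
variable {C : Type v} [SmallCategory C] (P : Orthogonality C)
variable {M : Type u} [Category.{v} M] [MonoidalCategory M] [SymmetricCategory M] [MonoidalClosed M]
  [HasColimits M]

/-- The composition of the operad: the map `OpSet.comp` of sets, under the `Set`-tensoring. -/
noncomputable def aqftComp {n : ℕ} {k : Fin n → ℕ} (a : Fin n → C) (b : ∀ i, Fin (k i) → C) (t : C) :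
    cop M (OpSet P a t) ⊗ tens (List.finRange n) (fun i => cop M (OpSet P (b i) (a i))) ⟶
      cop M (OpSet P (concat b) t) :=
  _ ◁ copCollect (fun i => OpSet P (b i) (a i)) (List.finRange n) ≫ copPair _ _ ≫
    copMap fun p => p.1.comp fun i => p.2 i (List.mem_finRange i)

theorem point_aqftComp {n : ℕ} {k : Fin n → ℕ} {a : Fin n → C} {b : ∀ i, Fin (k i) → C} {t : C}
    (p : OpSet P a t) (q : ∀ i, OpSet P (b i) (a i)) :
    pointMul (copι p : tensorUnit M ⟶ _) (tensPoint _ fun i => copι (q i)) ≫ aqftComp P a b t =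
      copι (p.comp q) := by
  rw [aqftComp, pointMul_whiskerLeft_assoc, tensPoint_collect, pointMul_copPair_assoc, copι_map]

theorem point_aqftComp_assoc {n : ℕ} {k : Fin n → ℕ} {a : Fin n → C} {b : ∀ i, Fin (k i) → C} {t : C}
    (p : OpSet P a t) (q : ∀ i, OpSet P (b i) (a i)) {Z' : M} (h' : _ ⟶ Z') :
    pointMul (copι p : tensorUnit M ⟶ _) (tensPoint _ fun i => copι (q i)) ≫ aqftComp P a b t ≫ h' =
      copι (p.comp q) ≫ h' := by
  rw [← point_aqftComp, Category.assoc]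

variable (M) in
/-- The algebraic quantum field theory operad of type `(C, ⊥)`. -/
noncomputable def aqftColoredOperad : ColoredOperad C M where
  obj c t := cop M (OpSet P c t)
  act e h t := copMap (OpSet.act e h t)
  unit t := copι (OpSet.unit t)
  comp a b t := aqftComp P a b t
  act_refl c t := cop_ext fun s => by
    exact (copι_map _ s).trans ((congrArg copι (act_refl s)).trans (Category.comp_id _).symm)
  act_act e h e' h' t := cop_ext fun s => by
    rw [copι_map_assoc, copι_map, copι_map, act_act]
  comp_act_left e a b t := by
    refine ((generates_cop _).tensor (generates_tens fun i => generates_cop _)).ext ?_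
    rintro _ ⟨_, _, ⟨p, rfl⟩, ⟨q, hq, rfl⟩, rfl⟩
    choose q' hq' using hq
    obtain rfl := funext hq'
    rw [pointMul_tensorHom_assoc, copι_map, tensPoint_perm, point_aqftComp_assoc, copι_map]
    refine (point_aqftComp P _ fun i => q' (e i)).trans ?_
    rw [comp_act_left]
  comp_act_right a b b' e h t := by
    refine ((generates_cop _).tensor (generates_tens fun i => generates_cop _)).ext ?_
    rintro _ ⟨_, _, ⟨p, rfl⟩, ⟨q, hq, rfl⟩, rfl⟩
    choose q' hq' using hq
    obtain rfl := funext hq'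
    rw [pointMul_whiskerLeft_assoc, tensPoint_map, point_aqftComp_assoc, copι_map]
    simp only [copι_map]
    rw [point_aqftComp, comp_act_right]
  unit_comp c t := cop_ext fun s => by
    have h := point_aqftComp (M := M) P (OpSet.unit t) fun _ : Fin 1 => s
    rw [unit_comp] at h
    rw [copι_map, ← h]
    refine ((Category.assoc (copι s) _ _).trans (congrArg _ (Category.assoc _ _ _))).symm.trans ?_
    exact congrArg (· ≫ aqftComp P (fun _ : Fin 1 => t) (fun _ => c) t) (point_unitors _ _)
  comp_unit c t := cop_ext fun s => by
    have h := point_aqftComp (M := M) P s fun i => OpSet.unit (c i)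
    rw [comp_unit] at h
    rw [copι_map, ← h, ← Category.assoc, ← Category.assoc, ← pointMul_one,
      pointMul_whiskerLeft, Category.id_comp]
  comp_comp a b c t := by
    refine ((generates_cop _).tensor (generates_tens fun i => (generates_cop _).tensor
      (generates_tens fun j => generates_cop _))).ext ?_
    rintro _ ⟨_, _, ⟨p, rfl⟩, ⟨s, hs, rfl⟩, rfl⟩
    choose q r hq hr hs using hs
    choose q' hq using hq
    choose r' hr' hr using hr
    obtain rfl := funext hq
    choose r'' hr'' using hr'
    obtain rfl : r' = fun i j => copι (r'' i j) := funext fun i => funext (hr'' i)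
    obtain rfl : r = fun i => tensPoint _ fun j => copι (r'' i j) := funext hr
    obtain rfl : s = fun i => pointMul (copι (q' i)) (tensPoint _ fun j => copι (r'' i j)) :=
      funext hs
    have h1 : ∀ i, pointMul (copι (q' i)) (tensPoint _ fun j => copι (r'' i j)) ≫
        aqftComp P (b i) (c i) (a i) = (copι ((q' i).comp (r'' i)) : tensorUnit M ⟶ _) :=
      fun i => point_aqftComp P _ _
    have hL : pointMul (copι p) (tensPoint (List.finRange _) fun i => pointMul (copι (q' i))
          (tensPoint (List.finRange _) fun j => copι (r'' i j))) ≫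
        (_ ◁ tensMap (List.finRange _) fun i => aqftComp P (b i) (c i) (a i)) ≫
          aqftComp P a (fun i => concat (c i)) t =
        (copι (p.comp fun i => (q' i).comp (r'' i)) : tensorUnit M ⟶ _) := by
      rw [pointMul_whiskerLeft_assoc, tensPoint_map]
      simp only [h1]
      exact point_aqftComp P _ _
    refine hL.trans ?_
    rw [pointMul_whiskerLeft_assoc, tensPoint_zip, pointMul_assoc_inv_assoc,
      pointMul_tensorHom_assoc, point_aqftComp, tensPoint_flatten]
    have hR := point_aqftComp_assoc (M := M) P (p.comp q')
      (fun x => r'' (finSigmaFinEquiv.symm x).1 (finSigmaFinEquiv.symm x).2)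
      (copMap (OpSet.act (assocEquiv _) (concat_assoc c) t))
    refine Eq.trans ?_ hR.symm
    rw [copι_map, comp_assoc]

variable (𝒥 : Involution M)
open Functor.LaxMonoidal

/-- The `*`-involution of the operad: order reversal `[σ, f] ↦ [ρ σ, f]`, and `J₀ : 𝟙 ⟶ J 𝟙`. -/
noncomputable def aqftStar {n : ℕ} (c : Fin n → C) (t : C) :
    cop M (OpSet P c t) ⟶ 𝒥.J.obj (cop M (OpSet P c t)) :=
  copDesc fun s => ε 𝒥.J ≫ 𝒥.J.map (copι s.rev)

theorem copι_star {n : ℕ} {c : Fin n → C} {t : C} (s : OpSet P c t) :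
    copι s ≫ aqftStar P 𝒥 c t = ε 𝒥.J ≫ 𝒥.J.map (copι s.rev) := copι_desc _ _

theorem aqftStar_act {m n : ℕ} {c : Fin n → C} {d : Fin m → C} (e : Fin m ≃ Fin n)
    (h : d = c ∘ e) (t : C) :
    copMap (OpSet.act e h t) ≫ aqftStar P 𝒥 d t =
      aqftStar P 𝒥 c t ≫ 𝒥.J.map (copMap (OpSet.act e h t)) := cop_ext fun s => by
  rw [copι_map_assoc, copι_star, ← Category.assoc, copι_star, Category.assoc, ← Functor.map_comp,
    copι_map, rev_act]

theorem aqftStar_aqftStar {n : ℕ} (c : Fin n → C) (t : C) :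
    aqftStar P 𝒥 c t ≫ 𝒥.J.map (aqftStar P 𝒥 c t) = 𝒥.j.hom.app (cop M (OpSet P c t)) :=
  cop_ext fun s => by
    rw [← Category.assoc, copι_star, Category.assoc, ← Functor.map_comp, copι_star, rev_rev,
      Functor.map_comp, ← Category.assoc, 𝒥.unit_j]
    exact (𝒥.j.hom.naturality _).symm

theorem aqftStar_comp {n : ℕ} {k : Fin n → ℕ} (a : Fin n → C) (b : ∀ i, Fin (k i) → C) (t : C) :
    aqftComp P a b t ≫ aqftStar P 𝒥 (concat b) t =
      (aqftStar P 𝒥 a t ⊗ₘ (tensMap _ (fun i => aqftStar P 𝒥 (b i) (a i)) ≫ 𝒥.tensJ _ _)) ≫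
        μ 𝒥.J _ _ ≫ 𝒥.J.map (aqftComp P a b t) := by
  refine ((generates_cop _).tensor (generates_tens fun i => generates_cop _)).ext ?_
  rintro _ ⟨_, _, ⟨p, rfl⟩, ⟨q, hq, rfl⟩, rfl⟩
  choose q' hq' using hq
  obtain rfl := funext hq'
  rw [point_aqftComp_assoc, copι_star, pointMul_tensorHom_assoc, ← Category.assoc (tensPoint _ _),
    tensPoint_map]
  simp only [copι_star]
  rw [𝒥.tensPoint_ε, ← Category.assoc, 𝒥.pointMul_ε, Category.assoc, ← Functor.map_comp,
    point_aqftComp, rev_comp]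

/-- The algebraic quantum field theory operad with the `*`-involution given by order reversal,
`[σ, f] ↦ [ρ σ, f]`, and by `J₀ : 𝟙 ⟶ J 𝟙`. -/
noncomputable def aqftOperad : ColoredStarOperad C 𝒥 where
  toColoredOperad := aqftColoredOperad P M
  star := aqftStar P 𝒥
  act_star := aqftStar_act P 𝒥
  star_star := aqftStar_aqftStar P 𝒥
  unit_star t := (copι_star P 𝒥 _).trans (by rw [rev_unit]; rfl)
  comp_star := aqftStar_comp P 𝒥

end AQFTOperad

section StarMonoids

variable {M : Type u} [Category.{v} M] [MonoidalCategory M] [SymmetricCategory M]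
open Functor.LaxMonoidal

/-- An order-reversing `*`-monoid in `(M, J, j)`. -/
structure RevStarMon (𝒥 : Involution M) extends Mon M where
  star : X ⟶ 𝒥.J.obj X
  star_star : star ≫ 𝒥.J.map star = 𝒥.j.hom.app X
  mul_star : MonObj.mul ≫ star =
    (star ⊗ₘ star) ≫ μ 𝒥.J X X ≫ 𝒥.J.map ((β_ X X).hom ≫ MonObj.mul)
  one_star : MonObj.one ≫ star = ε 𝒥.J ≫ 𝒥.J.map MonObj.one

/-- A morphism of order-reversing `*`-monoids. -/
@[ext]
structure RevStarMon.Hom {𝒥 : Involution M} (A B : RevStarMon 𝒥) where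
  hom : A.toMon ⟶ B.toMon
  star_hom : A.star ≫ 𝒥.J.map hom.hom = hom.hom ≫ B.star

instance (𝒥 : Involution M) : Category (RevStarMon 𝒥) where
  Hom := RevStarMon.Hom
  id A := ⟨𝟙 _, by simp⟩
  comp f g := ⟨f.hom ≫ g.hom, by
    rw [Mon.comp_hom', Functor.map_comp, ← Category.assoc, f.star_hom, Category.assoc, g.star_hom,
      Category.assoc]⟩

/-- The `*`-object underlying an order-reversing `*`-monoid. -/
def RevStarMon.forget (𝒥 : Involution M) : RevStarMon 𝒥 ⥤ StarObj 𝒥 where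
  obj A := ⟨A.X, A.star, A.star_star⟩
  map f := ⟨f.hom.hom, f.star_hom⟩

variable {C : Type w} [Category.{v} C]

/-- `⊥`-commutativity of a functor to order-reversing `*`-monoids. -/
def IsPerpCommutative (P : Orthogonality C) (𝒥 : Involution M) :
    ObjectProperty (C ⥤ RevStarMon 𝒥) := fun A =>
  ∀ ⦃c₁ c₂ c : C⦄ (f₁ : c₁ ⟶ c) (f₂ : c₂ ⟶ c), P.rel f₁ f₂ →
    ((A.map f₁).hom.hom ⊗ₘ (A.map f₂).hom.hom) ≫ MonObj.mul =
      ((A.map f₁).hom.hom ⊗ₘ (A.map f₂).hom.hom) ≫ (β_ (A.obj c).X (A.obj c).X).hom ≫ MonObj.mul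

/-- The category of `⊥`-commutative functors from `C` to order-reversing `*`-monoids. -/
abbrev PerpFunctor (P : Orthogonality C) (𝒥 : Involution M) :=
  (IsPerpCommutative P 𝒥).FullSubcategory

/-- The family of `*`-objects underlying a functor to order-reversing `*`-monoids. -/
def PerpFunctor.forget (P : Orthogonality C) (𝒥 : Involution M) :
    PerpFunctor P 𝒥 ⥤ (C → StarObj 𝒥) where
  obj A c := (RevStarMon.forget 𝒥).obj (A.obj.obj c)
  map f c := (RevStarMon.forget 𝒥).map (f.hom.app c)

end StarMonoids

section ComplexVectorSpaces

/-- The complex conjugate of a complex vector space: the same abelian group, on which `z` acts as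
the complex conjugate of `z`. -/
def ConjSpace (V : Type) : Type := V

instance (V : Type) [AddCommGroup V] : AddCommGroup (ConjSpace V) := inferInstanceAs (AddCommGroup V)

instance (V : Type) [AddCommGroup V] [Module ℂ V] : Module ℂ (ConjSpace V) :=
  Module.compHom V (starRingEnd ℂ)

/-- The identity map, from `V` to its complex conjugate. -/
def toConj {V : Type} (v : V) : ConjSpace V := v

theorem smul_toConj {V : Type} [AddCommGroup V] [Module ℂ V] (z : ℂ) (v : V) :
    z • toConj v = toConj ((starRingEnd ℂ) z • v) := rfl

/-- The identity map, from `V` to the complex conjugate of its complex conjugate. -/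
def conjConj (V : Type) [AddCommGroup V] [Module ℂ V] : V ≃ₗ[ℂ] ConjSpace (ConjSpace V) where
  toFun v := toConj (toConj v)
  invFun v := v
  map_add' _ _ := rfl
  map_smul' z v := by
    rw [RingHom.id_apply, smul_toConj, smul_toConj, Complex.conj_conj]
  left_inv _ := rfl
  right_inv _ := rfl

/-- The endofunctor sending a complex vector space to its complex conjugate. -/
def conjFunctor : ModuleCat.{0} ℂ ⥤ ModuleCat.{0} ℂ where
  obj V := ModuleCat.of ℂ (ConjSpace V)
  map {V W} f := ModuleCat.ofHom (X := ConjSpace V) (Y := ConjSpace W)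
    { toFun := fun v => toConj (f.hom v)
      map_add' := fun v w => f.hom.map_add v w
      map_smul' := fun z v => f.hom.map_smul _ v }

/-- Complex conjugation, as a linear map from `ℂ` to its complex conjugate. -/
def conjUnit : ℂ →ₗ[ℂ] ConjSpace ℂ where
  toFun z := toConj (starRingEnd ℂ z)
  map_add' z w := congrArg toConj (map_add (starRingEnd ℂ) z w)
  map_smul' z w := by
    rw [RingHom.id_apply, smul_toConj, smul_eq_mul, smul_eq_mul, map_mul]

open TensorProduct in
/-- The linear map from `conj(V) ⊗ conj(W)` to the complex conjugate of `V ⊗ W`, with `v ⊗ w ↦ v ⊗ w`. -/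
def conjTensor (V W : Type) [AddCommGroup V] [Module ℂ V] [AddCommGroup W] [Module ℂ W] :
    ConjSpace V ⊗[ℂ] ConjSpace W →ₗ[ℂ] ConjSpace (V ⊗[ℂ] W) :=
  TensorProduct.lift (LinearMap.mk₂ ℂ (fun (v : V) (w : W) => toConj (v ⊗ₜ[ℂ] w))
    (fun v v' w => add_tmul (R := ℂ) (M := V) (N := W) v v' w)
    (fun z v w => (smul_tmul' (R := ℂ) (M := V) (N := W) (starRingEnd ℂ z) v w).symm)
    (fun v w w' => tmul_add (R := ℂ) (M := V) (N := W) v w w')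
    (fun z v w => tmul_smul (R := ℂ) (M := V) (N := W) (starRingEnd ℂ z) v w))

/-- The symmetric monoidal structure of complex conjugation. -/
noncomputable instance : conjFunctor.LaxBraided where
  ε := ModuleCat.ofHom (X := ℂ) (Y := ConjSpace ℂ) conjUnit
  μ V W := ModuleCat.ofHom (conjTensor V W)
  μ_natural_left f W := ModuleCat.MonoidalCategory.tensor_ext fun v w => rfl
  μ_natural_right V f := ModuleCat.MonoidalCategory.tensor_ext fun v w => rfl
  associativity V W Z := ModuleCat.MonoidalCategory.tensor_ext₃' fun v w z => rfl
  left_unitality V := ModuleCat.MonoidalCategory.tensor_ext fun z v =>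
    smul_toConj (V := V) (z : ℂ) v
  right_unitality V := ModuleCat.MonoidalCategory.tensor_ext fun v z =>
    smul_toConj (V := V) (z : ℂ) v
  braided V W := ModuleCat.MonoidalCategory.tensor_ext fun v w => rfl

/-- The involutive symmetric monoidal category of complex vector spaces, with complex conjugation
and `j` the identity. -/
noncomputable def vecInvolution : Involution (ModuleCat.{0} ℂ) where
  J := conjFunctor
  laxBraided := inferInstance
  j := NatIso.ofComponents (fun V => (conjConj V).toModuleIso) fun f => rfl
  monoidal :=
    { unit := ModuleCat.hom_ext (LinearMap.ext fun z => (star_star (R := ℂ) z).symm)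
      tensor := fun V W => ModuleCat.MonoidalCategory.tensor_ext fun v w => rfl }
  j_J V := rfl

/-- A (bundled) associative and unital `*`-algebra over `ℂ`; in particular `(a b)* = b* a*` and
`(z a)* = conj(z) a*`. -/
structure ComplexStarAlg where
  A : Type
  [ring : Ring A]
  [algebra : Algebra ℂ A]
  [starRing : StarRing A]
  [starModule : StarModule ℂ A]

attribute [instance] ComplexStarAlg.ring ComplexStarAlg.algebra ComplexStarAlg.starRing
  ComplexStarAlg.starModule

instance : Category ComplexStarAlg where
  Hom A B := A.A →⋆ₐ[ℂ] B.A
  id A := StarAlgHom.id ℂ A.A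
  comp f g := StarAlgHom.comp g f

open TensorProduct in
/-- The order-reversing `*`-monoid given by a `*`-algebra over `ℂ`: `μ(a ⊗ b) = a b`, `η(1) = 1`,
with the same involution. -/
noncomputable def ComplexStarAlg.toRevStarMon : ComplexStarAlg ⥤ RevStarMon vecInvolution where
  obj A :=
    { toMon := ModuleCat.MonModuleEquivalenceAlgebra.inverse.obj (AlgCat.of ℂ A.A)
      star := ModuleCat.ofHom (X := A.A) (Y := ConjSpace A.A)
        { toFun := fun a => toConj (star a)
          map_add' := fun a b => star_add a b
          map_smul' := fun z a => StarModule.star_smul z a }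
      star_star := ModuleCat.hom_ext (LinearMap.ext fun a => star_star (R := A.A) a)
      mul_star := ModuleCat.MonoidalCategory.tensor_ext fun a b => star_mul (R := A.A) a b
      one_star := ModuleCat.hom_ext (LinearMap.ext fun z => by
        change toConj (star (algebraMap ℂ A.A z)) = toConj (algebraMap ℂ A.A (star z))
        rw [algebraMap_star_comm]) }
  map {A B} f :=
    { hom := ModuleCat.MonModuleEquivalenceAlgebra.inverse.map
        (AlgCat.ofHom (StarAlgHom.toAlgHom f))
      star_hom := ModuleCat.hom_ext (LinearMap.ext fun a => (f : A.A →⋆ₐ[ℂ] B.A).map_star' a) }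

end ComplexVectorSpaces

section Statement

/-- A functor is an isomorphism of categories. -/
def IsIsoOfCategories {A : Type*} [Category A] {B : Type*} [Category B] (F : A ⥤ B) : Prop :=
  ∃ G : B ⥤ A, F ⋙ G = 𝟭 A ∧ G ⋙ F = 𝟭 B

/-- The empty orthogonality relation. -/
def Orthogonality.empty (C : Type u) [Category.{v} C] : Orthogonality C where
  rel _ _ := False
  symm h := h
  postcomp _ h := h
  precomp _ _ h := h

/-- The category with one object and only its identity morphism. -/
abbrev Point : Type v := Discrete PUnit.{v + 1}

end Statement

end AQFT

/-! An object of operations is a coproduct of copies of the unit, so by closedness a morphism from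
it, tensored with any `Y`, is a family of morphisms out of `Y` indexed by the set of operations.
Through `act_perm_iff`, `act_comp_iff` and `act_star_iff`, a `*`-algebra thus becomes a family of
objects with one operation `op [σ, f]` for each element of these sets, subject to equivariance,
unit, composition and star laws.

From functors to algebras: `[σ, f]` acts by applying the `𝔄(fᵢ)` and multiplying the results in the
order prescribed by `σ` (`orderedProd`). By `⊥`-commutativity this descends to the quotient
(`orderedProd_swap`). The composition law is general associativity together with the fact that the
`𝔄(f)` are monoid morphisms (`orderedProd_comp`), and the star law holds because an order-reversing
involution reverses products of any length (`orderedProd_star`). Each of these compares different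
composites of symmetries. The coherence theorem `IsSymmetry.unique` settles all such comparisons:
there is at most one symmetry between two given tensor words.

From algebras to functors: the operations `[1, f]` with zero, one and two inputs give the unit, the
maps `𝔄(f)` and the multiplication. The monoid laws and functoriality come from operadic
composition, mainly in the form `append_listOp`. The relation `[1, f] = [(0 1), f]` for orthogonal
pairs gives `⊥`-commutativity, and `ρ₂` being the transposition gives the order reversal of the
star. Finally `op_mk` shows that every `[σ, f]` has to act by an ordered product, so the two
constructions are mutually inverse.

For the second claim, a functor from the point is the same as its value. For the third, the functor
is fully faithful and bijective on objects: monoids in vector spaces are algebras, and linear maps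
to a conjugate space are antilinear maps. -/

namespace AQFT

/-! ### Reindexing of iterated tensor products -/

section TensorNaturality
variable {M : Type u} [Category.{v} M] [MonoidalCategory M] {I : Type w} {I' : Type*}

theorem tensMapIndex_unmapIndex (f : I → I') (l : List I) (X : I' → M) :
    tensMapIndex f l X ≫ tensUnmapIndex f l X = 𝟙 _ := by
  induction l with
  | nil => exact Category.comp_id _
  | cons a l ih =>
    refine (MonoidalCategory.whiskerLeft_comp _ _ _).symm.trans ?_
    rw [ih]
    exact MonoidalCategory.whiskerLeft_id _ _

theorem tensUnmapIndex_mapIndex (f : I → I') (l : List I) (X : I' → M) :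
    tensUnmapIndex f l X ≫ tensMapIndex f l X = 𝟙 _ := by
  induction l with
  | nil => exact Category.comp_id _
  | cons a l ih =>
    refine (MonoidalCategory.whiskerLeft_comp _ _ _).symm.trans ?_
    rw [ih]
    exact MonoidalCategory.whiskerLeft_id _ _

theorem tensAppend_mapIndex (f : I → I') (l r : List I) (X : I' → M) :
    tensAppend l r (fun i => X (f i)) ≫ tensMapIndex f (l ++ r) X =
      (tensMapIndex f l X ⊗ₘ tensMapIndex f r X) ≫ tensAppend (l.map f) (r.map f) X ≫
        eqToHom (by rw [List.map_append]) := by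
  induction l with
  | nil =>
    change (λ_ _).hom ≫ tensMapIndex f r X = (𝟙 _ ⊗ₘ _) ≫ (λ_ _).hom ≫ 𝟙 _
    simp
  | cons a l ih =>
    have h : ∀ (L L' : List I') (e : L = L'), (eqToHom (by rw [e]) :
        tens (f a :: L) X ⟶ tens (f a :: L') X) = X (f a) ◁ eqToHom (by rw [e]) := by
      rintro L _ rfl; exact (MonoidalCategory.whiskerLeft_id _ _).symm
    refine Eq.trans (b := ((_ ◁ tensMapIndex f l X) ⊗ₘ tensMapIndex f r X) ≫
      ((α_ _ _ _).hom ≫ _ ◁ tensAppend (l.map f) (r.map f) X) ≫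
        X (f a) ◁ eqToHom (congrArg (tens · X) List.map_append.symm)) ?_
      (congrArg (fun x => _ ≫ _ ≫ x) (h _ _ List.map_append.symm).symm)
    change ((α_ (X (f a)) _ _).hom ≫ _ ◁ tensAppend l r _) ≫ _ ◁ tensMapIndex f (l ++ r) X = _
    rw [Category.assoc, ← MonoidalCategory.whiskerLeft_comp, ih]
    simp [← id_tensorHom]

end TensorNaturality

/-! ### Exchange of two leading tensor factors -/

section FrontSwap
variable {M : Type u} [Category.{v} M] [MonoidalCategory M] [SymmetricCategory M]

/-- The symmetry `A ⊗ (B ⊗ T) ⟶ B ⊗ (A ⊗ T)`. -/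
def frontSwap (A B T : M) : A ⊗ B ⊗ T ⟶ B ⊗ A ⊗ T :=
  (α_ A B T).inv ≫ (β_ A B).hom ▷ T ≫ (α_ B A T).hom

/-- The braiding being a symmetry enters the coherence theorem through this identity. -/
theorem frontSwap_frontSwap (A B T : M) : frontSwap A B T ≫ frontSwap B A T = 𝟙 _ := by
  simp only [frontSwap, Category.assoc, Iso.hom_inv_id_assoc]
  rw [← comp_whiskerRight_assoc, SymmetricCategory.symmetry]
  simp

theorem frontSwap_naturality {A A' B B' T T' : M} (f : A ⟶ A') (g : B ⟶ B') (h : T ⟶ T') :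
    frontSwap A B T ≫ (g ⊗ₘ (f ⊗ₘ h)) = (f ⊗ₘ (g ⊗ₘ h)) ≫ frontSwap A' B' T' := by
  simp only [frontSwap, Category.assoc]
  rw [← associator_naturality, associator_inv_naturality_assoc]
  congr 1
  rw [← Category.assoc, ← Category.assoc, ← tensorHom_id, ← tensorHom_id,
    tensorHom_comp_tensorHom, tensorHom_comp_tensorHom, BraidedCategory.braiding_naturality]
  simp

theorem frontSwap_naturality_tail (A B : M) {T T' : M} (φ : T ⟶ T') :
    frontSwap A B T ≫ B ◁ A ◁ φ = A ◁ B ◁ φ ≫ frontSwap A B T' := by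
  simpa using frontSwap_naturality (𝟙 A) (𝟙 B) φ

/-- The Yang–Baxter equation of the braiding, tensored with `T`; the rest is rebracketing. -/
theorem frontSwap_yangBaxter (A B D T : M) :
    frontSwap A B (D ⊗ T) ≫ B ◁ frontSwap A D T ≫ frontSwap B D (A ⊗ T) =
      A ◁ frontSwap B D T ≫ frontSwap A D (B ⊗ T) ≫ D ◁ frontSwap A B T := by
  have h := congrArg (fun φ => A ◁ (α_ B D T).inv ≫ (α_ A (B ⊗ D) T).inv ≫
    φ ▷ T ≫ (α_ D (B ⊗ A) T).hom ≫ D ◁ (α_ B A T).hom) (BraidedCategory.yang_baxter A B D)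
  simp only [comp_whiskerRight, Category.assoc] at h
  unfold frontSwap
  calc _ = _ := ?_
    _ = _ := h
    _ = _ := ?_
  · monoidal
  · monoidal

theorem frontSwap_unit (A T : M) :
    frontSwap A (tensorUnit M) T = A ◁ (λ_ T).hom ≫ (λ_ (A ⊗ T)).inv := by
  simp [frontSwap, braiding_tensorUnit_right]

/-- The forward hexagon tensored with `T`: passing `B ⊗ D` means passing `B` and then `D`. The next
lemma is the reverse hexagon, where a product moves past `D`. -/
theorem frontSwap_tensor (A B D T : M) :
    A ◁ (α_ B D T).hom ≫ frontSwap A B (D ⊗ T) ≫ B ◁ frontSwap A D T =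
      frontSwap A (B ⊗ D) T ≫ (α_ B D (A ⊗ T)).hom := by
  unfold frontSwap
  have := BraidedCategory.hexagon_forward A B D
  have h := congrArg (fun φ => A ◁ (α_ B D T).hom ≫ (α_ A B (D ⊗ T)).inv ≫ (α_ (A ⊗ B) D T).inv ≫
    φ ▷ T ≫ (α_ B (D ⊗ A) T).hom ≫ B ◁ (α_ D A T).hom) this
  simp only [comp_whiskerRight, Category.assoc] at h
  calc _ = _ := ?_
    _ = _ := h.symm
    _ = _ := ?_
  · monoidal
  · monoidal

theorem frontSwap_tensor_left (A B D T : M) :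
    (α_ A B (D ⊗ T)).hom ≫ A ◁ frontSwap B D T ≫ frontSwap A D (B ⊗ T) =
      frontSwap (A ⊗ B) D T ≫ D ◁ (α_ A B T).hom := by
  unfold frontSwap
  have := BraidedCategory.hexagon_reverse A B D
  have h := congrArg (fun φ => (α_ (A ⊗ B) D T).inv ≫ (α_ A B D).hom ▷ T ≫
    φ ▷ T ≫ (α_ D A B).hom ▷ T ≫ (α_ D (A ⊗ B) T).hom ≫ D ◁ (α_ A B T).hom) this
  simp only [comp_whiskerRight, Category.assoc] at h
  calc _ = _ := ?_
    _ = _ := h.symm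
    _ = _ := ?_
  · monoidal
  · monoidal

end FrontSwap

/-! ### Coherence for symmetries of iterated tensor products -/

section Coherence
variable {M : Type u} [Category.{v} M] [MonoidalCategory M] [SymmetricCategory M] {I : Type w}

/-- The morphisms between iterated tensor products composed of adjacent transpositions of factors
with distinct indices. -/
inductive IsSymmetry (X : I → M) : ∀ l l' : List I, (tens l X ⟶ tens l' X) → Prop
  | nil : IsSymmetry X [] [] (𝟙 (tensorUnit M))
  | cons (a : I) {l l' : List I} {φ : tens l X ⟶ tens l' X} :
      IsSymmetry X l l' φ → IsSymmetry X (a :: l) (a :: l') (X a ◁ φ)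
  | swap {a b : I} (l : List I) (h : a ≠ b) :
      IsSymmetry X (a :: b :: l) (b :: a :: l) (frontSwap (X a) (X b) (tens l X))
  | trans {l l' l'' : List I} {φ : tens l X ⟶ tens l' X} {ψ : tens l' X ⟶ tens l'' X} :
      IsSymmetry X l l' φ → IsSymmetry X l' l'' ψ → IsSymmetry X l l'' (φ ≫ ψ)

/-- The morphisms moving the first factor with a given index to the front. -/
inductive IsPull (X : I → M) (i : I) : ∀ l m : List I, (tens l X ⟶ X i ⊗ tens m X) → Prop
  | head (l : List I) : IsPull X i (i :: l) l (𝟙 (X i ⊗ tens l X))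
  | tail {a : I} (h : a ≠ i) {l m : List I} {f : tens l X ⟶ X i ⊗ tens m X} :
      IsPull X i l m f →
        IsPull X i (a :: l) (a :: m) (X a ◁ f ≫ frontSwap (X a) (X i) (tens m X))

variable {X : I → M} {l l' l'' m m' : List I}

theorem IsSymmetry.id (l : List I) : IsSymmetry X l l (𝟙 (tens l X)) := by
  induction l with
  | nil => exact .nil
  | cons a l ih => exact (MonoidalCategory.whiskerLeft_id (X a) (tens l X)) ▸ ih.cons a

theorem isSymmetry_eqToHom (h : l = l') : IsSymmetry X l l' (eqToHom (by rw [h])) := by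
  subst h; exact .id l

theorem IsSymmetry.perm {φ : tens l X ⟶ tens l' X} (h : IsSymmetry X l l' φ) : l.Perm l' := by
  induction h with
  | nil => exact .nil
  | cons a _ ih => exact ih.cons a
  | swap l _ => exact .swap _ _ _
  | trans _ _ ih ih' => exact ih.trans ih'

theorem IsPull.isSymmetry {i : I} {f : tens l X ⟶ X i ⊗ tens m X} (h : IsPull X i l m f) :
    IsSymmetry X l (i :: m) f := by
  induction h with
  | head l => exact .id _
  | tail h _ ih => exact (ih.cons _).trans (.swap _ h)

/-- Replaces the recursive definition of `tensPull`, with its decidability tests and transports, by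
a relation suited to case analysis. -/
theorem isPull_tensPull [DecidableEq I] (i : I) (l : List I) (h : i ∈ l) :
    IsPull X i l (l.erase i) (tensPull X i l h) := by
  induction l with
  | nil => exact absurd h List.not_mem_nil
  | cons a l ih =>
    unfold tensPull
    split_ifs with e
    -- The list `(a :: l).erase i` is generalised to one that is only propositionally equal to it,
    -- so that the transport can be removed by substitution. The other case proceeds in the same
    -- way.
    · have : ∀ l' (hl : a :: l = i :: l'), IsPull X i (a :: l) l' (eqToHom (by rw [hl]; rfl)) := by
        rintro l' hl
        obtain ⟨rfl, rfl⟩ := List.cons.inj hl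
        exact .head _
      exact this _ (by subst e; simp)
    · have : ∀ l' (hl : a :: l.erase i = l'), IsPull X i (a :: l) l'
          (X a ◁ tensPull X i l ((List.mem_cons.1 h).resolve_left (Ne.symm e)) ≫
            (α_ _ _ _).inv ≫ (β_ (X a) (X i)).hom ▷ _ ≫ (α_ _ _ _).hom ≫
              eqToHom (by rw [← hl]; rfl)) := by
        rintro _ rfl
        have hφ := IsPull.tail e (ih ((List.mem_cons.1 h).resolve_left (Ne.symm e)))
        unfold frontSwap at hφ
        refine cast (congrArg (IsPull X i (a :: l) (a :: l.erase i)) ?_) hφ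
        have h' : ∀ {A B D E : M} (f : A ⟶ B) (g : B ⟶ D) (k : D ⟶ E) {F : M} (m : E ⟶ F),
            f ≫ g ≫ k ≫ m = f ≫ g ≫ k ≫ m ≫ 𝟙 F := fun _ _ _ _ => by simp
        exact h' _ _ _ _
      exact this _ (List.erase_cons_tail (by simpa using e)).symm

theorem IsPull.exists (i : I) (l : List I) (h : i ∈ l) : ∃ m f, IsPull X i l m f := by
  classical exact ⟨_, _, isPull_tensPull i l h⟩

/-- Compatibility of a morphism `φ` with two morphisms moving `A` to the front. -/
theorem frontSwap_square {A B T T' S S' : M} {φ : T ⟶ T'} {f : T ⟶ B ⊗ S} {f' : T' ⟶ B ⊗ S'}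
    {φ' : S ⟶ S'} (h : φ ≫ f' = f ≫ B ◁ φ') :
    A ◁ φ ≫ A ◁ f' ≫ frontSwap A B S' = (A ◁ f ≫ frontSwap A B S) ≫ B ◁ A ◁ φ' := by
  rw [Category.assoc, frontSwap_naturality_tail, ← MonoidalCategory.whiskerLeft_comp_assoc, h,
    MonoidalCategory.whiskerLeft_comp_assoc]

/-- The square for a transposition of `A` and `B` when the pulled factor `D` lies behind both:
Yang–Baxter, combined with naturality of `frontSwap` in its last argument. -/
theorem frontSwap_square_swap {A B D T S S' : M} {f : T ⟶ D ⊗ S} {f' : T ⟶ D ⊗ S'} {φ' : S ⟶ S'}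
    (h : f' = f ≫ D ◁ φ') :
    frontSwap A B T ≫ B ◁ (A ◁ f' ≫ frontSwap A D S') ≫ frontSwap B D (A ⊗ S') =
      (A ◁ (B ◁ f ≫ frontSwap B D S) ≫ frontSwap A D (B ⊗ S)) ≫
        D ◁ (frontSwap A B S ≫ B ◁ A ◁ φ') := by
  subst h
  simp only [MonoidalCategory.whiskerLeft_comp, Category.assoc]
  rw [← reassoc_of% frontSwap_yangBaxter A B D S, reassoc_of% frontSwap_naturality_tail A B,
    ← reassoc_of% frontSwap_naturality_tail A B]
  have h1 := congrArg (B ◁ ·) (frontSwap_naturality_tail A D φ')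
  simp only [MonoidalCategory.whiskerLeft_comp] at h1
  rw [← reassoc_of% h1, ← frontSwap_naturality_tail B D (A ◁ φ'),
    reassoc_of% frontSwap_naturality_tail A B]

/-- Only the first occurrence of the index is moved, so the list and the index determine both the
remaining list and the morphism. -/
theorem IsPull.self : ∀ {l m m' : List I} {i : I} {f : tens l X ⟶ X i ⊗ tens m X}
    {f' : tens l X ⟶ X i ⊗ tens m' X}, IsPull X i l m f → IsPull X i l m' f' →
      ∃ h : m = m', f' = f ≫ X i ◁ eqToHom (by rw [h]) := by
  intro l m m' i f f' h
  induction h generalizing m' with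
  | head =>
    intro h'
    cases h' with
    | head =>
      exact ⟨rfl, ((congrArg (_ ≫ ·) (MonoidalCategory.whiskerLeft_id _ _)).trans
        (Category.comp_id _)).symm⟩
    | tail h' => exact absurd rfl h'
  | tail h0 h ih =>
    intro h'
    cases h' with
    | head => exact absurd rfl h0
    | tail _ h' =>
      obtain ⟨rfl, h1⟩ := ih h'
      rw [eqToHom_refl, MonoidalCategory.whiskerLeft_id, Category.comp_id] at h1
      subst h1
      refine ⟨rfl, ?_⟩
      rw [eqToHom_refl, MonoidalCategory.whiskerLeft_id, Category.comp_id]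

/-- This is the inductive core of coherence: a symmetry restricts to the factors that remain after
pulling out the same index on both sides. For a transposition involving `i`, the square is either
trivial or an instance of `frontSwap_frontSwap`. -/
theorem IsSymmetry.pull {φ : tens l X ⟶ tens l' X} (hφ : IsSymmetry X l l' φ) :
    ∀ {i : I} {m m' : List I} {f : tens l X ⟶ X i ⊗ tens m X} {f' : tens l' X ⟶ X i ⊗ tens m' X},
      IsPull X i l m f → IsPull X i l' m' f' →
      ∃ φ' : tens m X ⟶ tens m' X, IsSymmetry X m m' φ' ∧ φ ≫ f' = f ≫ X i ◁ φ' := by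
  induction hφ with
  | nil => intro i m m' f f' h; cases h
  | cons a hφ ih =>
    rename_i l l' φ
    intro i m m' f f' h h'
    cases h with
    | head =>
      cases h' with
      | head => exact ⟨φ, hφ, (Category.comp_id _).trans (Category.id_comp _).symm⟩
      | tail h' => exact absurd rfl h'
    | tail h0 h =>
      cases h' with
      | head => exact absurd rfl h0
      | tail _ h' =>
        obtain ⟨φ', h1, h2⟩ := ih h h'
        exact ⟨_, h1.cons a, frontSwap_square h2⟩
  | swap l hab =>
    rename_i a b
    intro i m m' f f' h h'
    cases h with
    | head =>
      cases h' with
      | head => exact absurd rfl hab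
      | tail _ h' =>
        cases h' with
        | head =>
          refine ⟨_, .id _, ?_⟩
          refine Eq.trans ?_ ((frontSwap_frontSwap (X _) (X _) (tens l X)).trans ?_)
          · exact congrArg (_ ≫ ·) ((congrArg (· ≫ _) (MonoidalCategory.whiskerLeft_id _ _)).trans
              (Category.id_comp _))
          · exact ((Category.id_comp _).trans (MonoidalCategory.whiskerLeft_id _ _)).symm
        | tail h' => exact absurd rfl h'
    | tail h0 h =>
      cases h with
      | head =>
        cases h' with
        | head =>
          refine ⟨_, .id _, ?_⟩
          refine Eq.trans ?_ (congrArg₂ (· ≫ ·) (((congrArg (· ≫ _)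
            (MonoidalCategory.whiskerLeft_id _ _)).trans (Category.id_comp _)).symm)
            (MonoidalCategory.whiskerLeft_id _ _).symm)
          rfl
        | tail h1 => exact absurd rfl h1
      | tail h1 h =>
        cases h' with
        | head => exact absurd rfl h1
        | tail _ h' =>
          cases h' with
          | head => exact absurd rfl h0
          | tail _ h' =>
            -- Now `i` differs from both transposed indices, and both sides pull it out of the same
            -- tail.
            obtain ⟨rfl, h2⟩ := h.self h'
            exact ⟨_, (IsSymmetry.swap _ hab).trans (((isSymmetry_eqToHom rfl).cons _).cons _),
              frontSwap_square_swap h2⟩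
  | trans hφ hψ ih ih' =>
    rename_i l l' l'' φ ψ
    intro i m m' f f' h h'
    -- For a composite, a pull of `i` out of the middle list glues the two squares.
    have hi : i ∈ l' := (hψ.perm.symm.subset (h'.isSymmetry.perm.symm.subset List.mem_cons_self))
    obtain ⟨n, g, hg⟩ := IsPull.exists (X := X) i l' hi
    obtain ⟨φ', h1, h2⟩ := ih h hg
    obtain ⟨ψ', h3, h4⟩ := ih' hg h'
    refine ⟨_, h1.trans h3, ?_⟩
    rw [Category.assoc, h4, ← Category.assoc, h2, Category.assoc, MonoidalCategory.whiskerLeft_comp]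

theorem IsSymmetry.eq_id {φ : tens l X ⟶ tens l' X} (h : IsSymmetry X l l' φ) (hl : l = []) :
    ∃ h' : l' = [], φ = eqToHom (by rw [hl, h']) := by
  induction h with
  | nil => exact ⟨rfl, rfl⟩
  | cons a _ ih => cases hl
  | swap l _ => cases hl
  | trans _ _ ih ih' =>
    obtain ⟨h1, h2⟩ := ih hl
    obtain ⟨h3, h4⟩ := ih' h1
    exact ⟨h3, by rw [h2, h4, eqToHom_trans]⟩

/-- Coherence: there is at most one symmetry between two iterated tensor products. -/
theorem IsSymmetry.unique {φ ψ : tens l X ⟶ tens l' X} (hφ : IsSymmetry X l l' φ)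
    (hψ : IsSymmetry X l l' ψ) : φ = ψ := by
  induction l' generalizing l with
  | nil =>
    have := hφ.perm.eq_nil
    subst this
    obtain ⟨_, h⟩ := hφ.eq_id rfl
    obtain ⟨_, h'⟩ := hψ.eq_id rfl
    rw [h, h']
  | cons i l' ih =>
    obtain ⟨m, f, hf⟩ := IsPull.exists (X := X) i l (hφ.perm.symm.subset List.mem_cons_self)
    -- Pulling the head of the target is the identity, so both symmetries are `f` followed by a
    -- symmetry of the tails.
    obtain ⟨φ', h1, h2⟩ := hφ.pull hf (.head l')
    obtain ⟨ψ', h3, h4⟩ := hψ.pull hf (.head l')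
    obtain rfl := ih h1 h3
    exact ((Category.comp_id _).symm.trans (h2.trans h4.symm)).trans (Category.comp_id _)

/-- Together with uniqueness, this identifies every symmetry between the same two lists with
`tensReorder`. -/
theorem isSymmetry_tensReorder [DecidableEq I] (l l' : List I) (h : l.Perm l') :
    IsSymmetry X l l' (tensReorder X l l' h) := by
  induction l' generalizing l with
  | nil => exact isSymmetry_eqToHom h.eq_nil
  | cons i l' ih => exact (isPull_tensPull i l _).isSymmetry.trans ((ih _ _).cons i)

end Coherence
end AQFT

namespace AQFT

/-! ### Transport of symmetries along the structure maps of tensor products -/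

section Closure
variable {M : Type u} [Category.{v} M] [MonoidalCategory M] [SymmetricCategory M] {I : Type w}
  {I' : Type*} {X : I → M} {l l' : List I}

theorem IsSymmetry.exists_map {Y : I → M} (g : ∀ i, X i ⟶ Y i) {φ : tens l X ⟶ tens l' X}
    (h : IsSymmetry X l l' φ) :
    ∃ φ', IsSymmetry Y l l' φ' ∧ tensMap l g ≫ φ' = φ ≫ tensMap l' g := by
  induction h with
  | nil => exact ⟨_, .nil, rfl⟩
  | cons a h ih =>
    rename_i l l' φ
    obtain ⟨φ', h1, h2⟩ := ih
    refine ⟨_, h1.cons a, ?_⟩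
    change (g a ⊗ₘ tensMap l g) ≫ _ ◁ φ' = _ ◁ φ ≫ (g a ⊗ₘ tensMap l' g)
    rw [tensorHom_comp_whiskerLeft, whiskerLeft_comp_tensorHom, h2]
  | swap l hab => exact ⟨_, .swap l hab, (frontSwap_naturality _ _ _).symm⟩
  | trans _ _ ih ih' =>
    obtain ⟨φ', h1, h2⟩ := ih
    obtain ⟨ψ', h3, h4⟩ := ih'
    exact ⟨_, h1.trans h3, by rw [Category.assoc, ← h4, ← Category.assoc, h2, Category.assoc]⟩

/-- Injectivity keeps transposed indices distinct after reindexing. -/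
theorem IsSymmetry.exists_mapIndex {f : I → I'} (hf : Function.Injective f) {X : I' → M}
    {φ : tens l (fun i => X (f i)) ⟶ tens l' (fun i => X (f i))}
    (h : IsSymmetry (fun i => X (f i)) l l' φ) :
    ∃ φ', IsSymmetry X (l.map f) (l'.map f) φ' ∧
      tensMapIndex f l X ≫ φ' = φ ≫ tensMapIndex f l' X := by
  induction h with
  | nil => exact ⟨_, .nil, rfl⟩
  | cons a h ih =>
    rename_i l l' φ
    obtain ⟨φ', h1, h2⟩ := ih
    refine ⟨_, h1.cons _, ?_⟩
    change _ ◁ tensMapIndex f l X ≫ _ ◁ φ' = _ ◁ φ ≫ _ ◁ tensMapIndex f l' X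
    rw [← MonoidalCategory.whiskerLeft_comp, h2, MonoidalCategory.whiskerLeft_comp]
  | swap l hab =>
    exact ⟨_, .swap _ (hf.ne hab), (frontSwap_naturality_tail _ _ (tensMapIndex f l X)).symm⟩
  | trans _ _ ih ih' =>
    obtain ⟨φ', h1, h2⟩ := ih
    obtain ⟨ψ', h3, h4⟩ := ih'
    exact ⟨_, h1.trans h3, by rw [Category.assoc, ← h4, ← Category.assoc, h2, Category.assoc]⟩

theorem IsSymmetry.exists_unmapIndex {f : I → I'} (hf : Function.Injective f) {X : I' → M}
    {φ : tens l (fun i => X (f i)) ⟶ tens l' (fun i => X (f i))}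
    (h : IsSymmetry (fun i => X (f i)) l l' φ) :
    ∃ φ', IsSymmetry X (l.map f) (l'.map f) φ' ∧
      tensUnmapIndex f l X ≫ φ = φ' ≫ tensUnmapIndex f l' X := by
  obtain ⟨φ', h1, h2⟩ := h.exists_mapIndex hf
  refine ⟨φ', h1, ?_⟩
  have := congrArg (fun x => tensUnmapIndex f l X ≫ x ≫ tensUnmapIndex f l' X) h2
  simpa only [Category.assoc, tensMapIndex_unmapIndex, Category.comp_id,
    ← Category.assoc (tensUnmapIndex f l X), tensUnmapIndex_mapIndex, Category.id_comp] using
    this.symm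

theorem IsSymmetry.exists_appendLeft (u : List I) {φ : tens l X ⟶ tens l' X}
    (h : IsSymmetry X l l' φ) :
    ∃ ψ, IsSymmetry X (u ++ l) (u ++ l') ψ ∧
      tensAppend u l X ≫ ψ = tens u X ◁ φ ≫ tensAppend u l' X := by
  induction u with
  | nil => exact ⟨φ, h, (leftUnitor_naturality _).symm⟩
  | cons a u ih =>
    obtain ⟨ψ, h1, h2⟩ := ih
    refine ⟨_, h1.cons a, ?_⟩
    change ((α_ (X a) (tens u X) _).hom ≫ _ ◁ tensAppend u l X) ≫ _ ◁ ψ =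
      (X a ⊗ tens u X) ◁ φ ≫ (α_ _ _ _).hom ≫ _ ◁ tensAppend u l' X
    rw [Category.assoc, ← MonoidalCategory.whiskerLeft_comp, h2]
    simp

theorem IsSymmetry.exists_appendRight (s : List I) {φ : tens l X ⟶ tens l' X}
    (h : IsSymmetry X l l' φ) :
    ∃ ψ, IsSymmetry X (l ++ s) (l' ++ s) ψ ∧
      tensAppend l s X ≫ ψ = φ ▷ tens s X ≫ tensAppend l' s X := by
  induction h with
  | nil =>
    exact ⟨_, .id _, (Category.comp_id _).trans ((congrArg (· ≫ tensAppend [] s X)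
      (id_whiskerRight (tensorUnit M) (tens s X))).trans (Category.id_comp _)).symm⟩
  | cons a h ih =>
    rename_i l l' φ
    obtain ⟨ψ, h1, h2⟩ := ih
    refine ⟨_, h1.cons a, ?_⟩
    change ((α_ (X a) (tens l X) _).hom ≫ _ ◁ tensAppend l s X) ≫ _ ◁ ψ =
      (X a ◁ φ) ▷ tens s X ≫ (α_ _ _ _).hom ≫ _ ◁ tensAppend l' s X
    rw [Category.assoc, ← MonoidalCategory.whiskerLeft_comp, h2]
    simp
  | swap l hab =>
    rename_i a b
    refine ⟨_, .swap _ hab, ?_⟩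
    change ((α_ (X a) (X b ⊗ tens l X) (tens s X)).hom ≫ _ ◁ ((α_ _ _ _).hom ≫ _ ◁ tensAppend l s X)) ≫
        frontSwap (X a) (X b) (tens (l ++ s) X) =
      frontSwap (X a) (X b) (tens l X) ▷ tens s X ≫
        (α_ (X b) (X a ⊗ tens l X) (tens s X)).hom ≫ _ ◁ ((α_ _ _ _).hom ≫ _ ◁ tensAppend l s X)
    rw [MonoidalCategory.whiskerLeft_comp, MonoidalCategory.whiskerLeft_comp]
    simp only [Category.assoc]
    rw [← frontSwap_naturality_tail]
    simp only [← Category.assoc]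
    refine congrArg (· ≫ _ ◁ _ ◁ tensAppend l s X) ?_
    unfold frontSwap
    monoidal
  | trans _ _ ih ih' =>
    obtain ⟨φ', h1, h2⟩ := ih
    obtain ⟨ψ', h3, h4⟩ := ih'
    refine ⟨_, h1.trans h3, ?_⟩
    rw [comp_whiskerRight, Category.assoc, ← h4, ← Category.assoc, h2, Category.assoc]

/-- Inductive step of `exists_isSymmetry_front`, for arbitrary objects. `frontSwap_square_block`
plays the same role for `exists_isSymmetry_block`, with the reverse hexagon. -/
theorem frontSwap_square_front {A B V S Q R : M} {p : V ⊗ S ⟶ Q} {ψ : A ⊗ Q ⟶ R}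
    {r : V ⊗ A ⊗ S ⟶ R} (h : A ◁ p ≫ ψ = frontSwap A V S ≫ r) :
    A ◁ ((α_ B V S).hom ≫ B ◁ p) ≫ frontSwap A B Q ≫ B ◁ ψ =
      frontSwap A (B ⊗ V) S ≫ (α_ B V (A ⊗ S)).hom ≫ B ◁ r := by
  rw [MonoidalCategory.whiskerLeft_comp, Category.assoc,
    ← reassoc_of% frontSwap_naturality_tail A B, ← MonoidalCategory.whiskerLeft_comp, h,
    ← reassoc_of% frontSwap_tensor, MonoidalCategory.whiskerLeft_comp]

theorem frontSwap_square_block {A U V S Q₁ Q₂ Q₃ Q₄ R : M} {p : V ⊗ S ⟶ Q₁} {q : U ⊗ Q₁ ⟶ Q₂}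
    {ψ : Q₂ ⟶ Q₃} {r : U ⊗ S ⟶ Q₄} {t : V ⊗ Q₄ ⟶ Q₃} {χ : A ⊗ Q₃ ⟶ R} {w : V ⊗ A ⊗ Q₄ ⟶ R}
    (h : U ◁ p ≫ q ≫ ψ = frontSwap U V S ≫ V ◁ r ≫ t) (h' : A ◁ t ≫ χ = frontSwap A V Q₄ ≫ w) :
    (A ⊗ U) ◁ p ≫ ((α_ A U Q₁).hom ≫ A ◁ q) ≫ A ◁ ψ ≫ χ =
      frontSwap (A ⊗ U) V S ≫ V ◁ ((α_ A U S).hom ≫ A ◁ r) ≫ w := by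
  rw [MonoidalCategory.whiskerLeft_comp, Category.assoc, Category.assoc,
    associator_naturality_right_assoc, ← MonoidalCategory.whiskerLeft_comp_assoc,
    ← MonoidalCategory.whiskerLeft_comp_assoc, Category.assoc, h,
    ← reassoc_of% frontSwap_tensor_left, reassoc_of% frontSwap_naturality_tail A V,
    ← h', MonoidalCategory.whiskerLeft_comp, MonoidalCategory.whiskerLeft_comp]
  simp only [Category.assoc]

/-- One factor passes a block by one transposition for each entry; all of these are admissible
because `i` does not occur in the block. -/
theorem exists_isSymmetry_front {i : I} (v s : List I) (h : i ∉ v) :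
    ∃ ψ, IsSymmetry X (i :: (v ++ s)) (v ++ i :: s) ψ ∧
      X i ◁ tensAppend v s X ≫ ψ =
        frontSwap (X i) (tens v X) (tens s X) ≫ tensAppend v (i :: s) X := by
  induction v with
  | nil =>
    refine ⟨_, .id _, (Category.comp_id _).trans ?_⟩
    change _ = frontSwap (X i) (tensorUnit M) (tens s X) ≫ (λ_ (X i ⊗ tens s X)).hom
    rw [frontSwap_unit]
    simp
    rfl
  | cons a v ih =>
    obtain ⟨ψ, h1, h2⟩ := ih fun h' => h (List.mem_cons_of_mem _ h')
    exact ⟨_, (IsSymmetry.swap _ fun h' => h (List.mem_cons.2 (Or.inl h'))).trans (h1.cons a),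
      frontSwap_square_front h2⟩

/-- Disjoint blocks are exchanged one factor at a time: the tail of `u` passes `v` before its head
does. -/
theorem exists_isSymmetry_block (u v s : List I) (h : ∀ i ∈ u, i ∉ v) :
    ∃ ψ, IsSymmetry X (u ++ (v ++ s)) (v ++ (u ++ s)) ψ ∧
      tens u X ◁ tensAppend v s X ≫ tensAppend u (v ++ s) X ≫ ψ =
        frontSwap (tens u X) (tens v X) (tens s X) ≫
          tens v X ◁ tensAppend u s X ≫ tensAppend v (u ++ s) X := by
  induction u with
  | nil =>
    refine ⟨_, .id _, ?_⟩
    change tensorUnit M ◁ tensAppend v s X ≫ (λ_ (tens (v ++ s) X)).hom ≫ 𝟙 _ =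
      frontSwap (tensorUnit M) (tens v X) (tens s X) ≫ tens v X ◁ (λ_ (tens s X)).hom ≫
        tensAppend v s X
    simp [frontSwap, braiding_tensorUnit_left]
  | cons a u ih =>
    obtain ⟨ψ, h1, h2⟩ := ih fun i hi => h i (List.mem_cons_of_mem _ hi)
    obtain ⟨χ, h3, h4⟩ := exists_isSymmetry_front (X := X) v (u ++ s) (h a List.mem_cons_self)
    exact ⟨_, (h1.cons a).trans h3, frontSwap_square_block h2 h4⟩

theorem isSymmetry_append_nil (l : List I) :
    IsSymmetry X l (l ++ []) ((ρ_ (tens l X)).inv ≫ tensAppend l [] X) := by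
  induction l with
  | nil =>
    change IsSymmetry X [] [] ((ρ_ (tensorUnit M)).inv ≫ (λ_ (tensorUnit M)).hom)
    exact (by rw [unitors_equal, Iso.inv_hom_id] :
      (ρ_ (tensorUnit M)).inv ≫ (λ_ (tensorUnit M)).hom = 𝟙 _).symm ▸ .nil
  | cons a l ih =>
    refine cast (congrArg (IsSymmetry X (a :: l) (a :: (l ++ []))) ?_) (ih.cons a)
    have h : ∀ {A B D : M} (f : B ⊗ tensorUnit M ⟶ D), A ◁ ((ρ_ B).inv ≫ f) =
        (ρ_ (A ⊗ B)).inv ≫ (α_ A B (tensorUnit M)).hom ≫ A ◁ f := by simp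
    exact h _

theorem frontSwap_square_tensor {A A' B B' S S' Q Q' R R' : M} (f : A ⟶ A') (g : B ⟶ B')
    (h : S ⟶ S') {q : B' ⊗ S' ⟶ Q} {p : A' ⊗ Q ⟶ R} {q' : A' ⊗ S' ⟶ Q'} {p' : B' ⊗ Q' ⟶ R'}
    {ψ : R ⟶ R'} (hψ : A' ◁ q ≫ p ≫ ψ = frontSwap A' B' S' ≫ B' ◁ q' ≫ p') :
    ((f ⊗ₘ ((g ⊗ₘ h) ≫ q)) ≫ p) ≫ ψ = frontSwap A B S ≫ (g ⊗ₘ ((f ⊗ₘ h) ≫ q')) ≫ p' := by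
  rw [← tensorHom_comp_whiskerLeft, ← tensorHom_comp_whiskerLeft, Category.assoc, Category.assoc,
    Category.assoc, hψ, reassoc_of% frontSwap_naturality]

/-- A transposition of outer factors becomes an exchange of blocks, which are disjoint because their
pairs have different first components. -/
theorem IsSymmetry.exists_sigma {K : I → Type*} (k : ∀ i, List (K i)) {X : (i : I) × K i → M}
    {φ : tens l (fun i => tens (k i) fun j => X ⟨i, j⟩) ⟶ tens l' fun i => tens (k i) fun j => X ⟨i, j⟩}
    (h : IsSymmetry (fun i => tens (k i) fun j => X ⟨i, j⟩) l l' φ) :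
    ∃ ψ, IsSymmetry X (l.sigma k) (l'.sigma k) ψ ∧
      tensSigma l k X ≫ ψ = φ ≫ tensSigma l' k X := by
  induction h with
  | nil => exact ⟨_, .nil, rfl⟩
  | cons a h ih =>
    rename_i l l' φ
    obtain ⟨ψ, h1, h2⟩ := ih
    obtain ⟨χ, h3, h4⟩ := h1.exists_appendLeft ((k a).map (Sigma.mk a))
    refine ⟨χ, h3, ?_⟩
    change ((tensMapIndex (Sigma.mk a) (k a) X ⊗ₘ tensSigma l k X) ≫ tensAppend _ _ X) ≫ χ =
      _ ◁ φ ≫ (tensMapIndex (Sigma.mk a) (k a) X ⊗ₘ tensSigma l' k X) ≫ tensAppend _ _ X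
    rw [Category.assoc]
    refine (congrArg (_ ≫ ·) h4).trans ?_
    rw [whiskerLeft_comp_tensorHom_assoc, ← h2, ← tensorHom_comp_whiskerLeft_assoc]
  | swap l hab =>
    rename_i a b
    obtain ⟨ψ, h1, h2⟩ := exists_isSymmetry_block (X := X) ((k a).map (Sigma.mk a))
      ((k b).map (Sigma.mk b)) (l.sigma k) (by
        intro i hi hi'
        obtain ⟨j, _, rfl⟩ := List.mem_map.1 hi
        obtain ⟨j', _, h⟩ := List.mem_map.1 hi'
        exact hab (congrArg Sigma.fst h).symm)
    refine ⟨ψ, h1, ?_⟩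
    exact frontSwap_square_tensor _ _ _ h2
  | trans _ _ ih ih' =>
    obtain ⟨φ', h1, h2⟩ := ih
    obtain ⟨ψ', h3, h4⟩ := ih'
    exact ⟨_, h1.trans h3, by rw [Category.assoc, ← h4, ← Category.assoc, h2, Category.assoc]⟩

theorem tensorHom_square {A A' A₁ A₂ S S' S₁ S₂ Q Q' Q'' : M} {a : A ⟶ A₁} {a' : A' ⟶ A₂}
    {s : S ⟶ S₁} {s' : S' ⟶ S₂} {f : A ⟶ A'} {g : S ⟶ S'} {ψ : S₁ ⟶ S₂} {χ : A₁ ⟶ A₂}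
    {p : A₁ ⊗ S₁ ⟶ Q} {p' : A₁ ⊗ S₂ ⟶ Q'} {p'' : A₂ ⊗ S₂ ⟶ Q''} {ψ' : Q ⟶ Q'} {χ' : Q' ⟶ Q''}
    (h₁ : s ≫ ψ = g ≫ s') (h₂ : a ≫ χ = f ≫ a') (h₃ : p ≫ ψ' = A₁ ◁ ψ ≫ p')
    (h₄ : p' ≫ χ' = χ ▷ S₂ ≫ p'') :
    ((a ⊗ₘ s) ≫ p) ≫ ψ' ≫ χ' = (f ⊗ₘ g) ≫ (a' ⊗ₘ s') ≫ p'' := by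
  rw [Category.assoc, reassoc_of% h₃, h₄, tensorHom_comp_whiskerLeft_assoc, h₁,
    tensorHom_comp_whiskerRight_assoc, h₂, tensorHom_comp_tensorHom_assoc]

/-- Symmetries inside the single blocks combine: the one of the tail is extended to the left, the
one of the first block to the right. -/
theorem exists_isSymmetry_sigma_inner {K : I → Type*} (l : List I) {k k' : ∀ i, List (K i)}
    {X : (i : I) × K i → M}
    {φ : ∀ i, tens (k i) (fun j => X ⟨i, j⟩) ⟶ tens (k' i) fun j => X ⟨i, j⟩}
    (h : ∀ i, IsSymmetry (fun j => X ⟨i, j⟩) (k i) (k' i) (φ i)) :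
    ∃ ψ, IsSymmetry X (l.sigma k) (l.sigma k') ψ ∧
      tensSigma l k X ≫ ψ = tensMap l φ ≫ tensSigma l k' X := by
  induction l with
  | nil => exact ⟨_, .nil, rfl⟩
  | cons a l ih =>
    obtain ⟨ψ, h1, h2⟩ := ih
    obtain ⟨χ, h3, h4⟩ := (h a).exists_mapIndex (sigma_mk_injective (i := a))
    obtain ⟨ψ', h5, h6⟩ := h1.exists_appendLeft ((k a).map (Sigma.mk a))
    obtain ⟨χ', h7, h8⟩ := h3.exists_appendRight (l.sigma k')
    refine ⟨ψ' ≫ χ', h5.trans h7, ?_⟩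
    exact tensorHom_square h2 h4 h6 h8

open Functor.LaxMonoidal

/-- Compatibility of the monoidal structure of `J` with associators and braidings. It is the
transposition case of `IsSymmetry.exists_tensJ`. -/
theorem Involution.map_frontSwap (𝒥 : Involution M) (A B T : M) :
    (𝒥.J.obj A ◁ μ 𝒥.J B T ≫ μ 𝒥.J A (B ⊗ T)) ≫ 𝒥.J.map (frontSwap A B T) =
      frontSwap (𝒥.J.obj A) (𝒥.J.obj B) (𝒥.J.obj T) ≫ 𝒥.J.obj B ◁ μ 𝒥.J A T ≫
        μ 𝒥.J B (A ⊗ T) := by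
  unfold frontSwap
  simp only [Functor.map_comp, Category.assoc]
  rw [associativity_inv_assoc, ← μ_natural_left_assoc, ← comp_whiskerRight_assoc,
    Functor.LaxBraided.braided, comp_whiskerRight_assoc, associativity]

theorem IsSymmetry.exists_tensJ (𝒥 : Involution M) {φ : tens l X ⟶ tens l' X}
    (h : IsSymmetry X l l' φ) :
    ∃ φ', IsSymmetry (fun i => 𝒥.J.obj (X i)) l l' φ' ∧
      𝒥.tensJ l X ≫ 𝒥.J.map φ = φ' ≫ 𝒥.tensJ l' X := by
  induction h with
  | nil =>
    refine ⟨_, .nil, ?_⟩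
    exact (congrArg (_ ≫ ·) (𝒥.J.map_id _)).trans
      ((Category.comp_id _).trans (Category.id_comp _).symm)
  | cons a h ih =>
    rename_i l l' φ
    obtain ⟨φ', h1, h2⟩ := ih
    refine ⟨_, h1.cons a, ?_⟩
    change (_ ◁ 𝒥.tensJ l X ≫ μ 𝒥.J (X a) (tens l X)) ≫ 𝒥.J.map (X a ◁ φ) =
      _ ◁ φ' ≫ _ ◁ 𝒥.tensJ l' X ≫ μ 𝒥.J (X a) (tens l' X)
    rw [Category.assoc, ← μ_natural_right, ← MonoidalCategory.whiskerLeft_comp_assoc, h2,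
      MonoidalCategory.whiskerLeft_comp_assoc]
  | swap l hab =>
    rename_i a b
    refine ⟨_, .swap l hab, ?_⟩
    have h1 := frontSwap_naturality_tail (𝒥.J.obj (X a)) (𝒥.J.obj (X b)) (𝒥.tensJ l X)
    have h2 := 𝒥.map_frontSwap (X a) (X b) (tens l X)
    change (_ ◁ (_ ◁ 𝒥.tensJ l X ≫ μ 𝒥.J (X b) (tens l X)) ≫ μ 𝒥.J (X a) (X b ⊗ tens l X)) ≫
        𝒥.J.map (frontSwap (X a) (X b) (tens l X)) =
      frontSwap (𝒥.J.obj (X a)) (𝒥.J.obj (X b)) (tens l fun i => 𝒥.J.obj (X i)) ≫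
        _ ◁ (_ ◁ 𝒥.tensJ l X ≫ μ 𝒥.J (X a) (tens l X)) ≫ μ 𝒥.J (X b) (X a ⊗ tens l X)
    rw [MonoidalCategory.whiskerLeft_comp, MonoidalCategory.whiskerLeft_comp, Category.assoc,
      Category.assoc, Category.assoc, reassoc_of% h1, ← h2]
    simp only [Category.assoc]
  | trans _ _ ih ih' =>
    obtain ⟨φ', h1, h2⟩ := ih
    obtain ⟨ψ', h3, h4⟩ := ih'
    refine ⟨_, h1.trans h3, ?_⟩
    rw [Functor.map_comp, ← Category.assoc, h2, Category.assoc, h4, Category.assoc]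

end Closure
end AQFT

namespace AQFT

/-! ### Restriction along points of a tensor factor -/

section PointInsertion
variable {M : Type u} [Category.{v} M] [MonoidalCategory M]

/-- Tensoring with a point. -/
def insertPoint {S : M} (p : tensorUnit M ⟶ S) (Y : M) : Y ⟶ S ⊗ Y := (λ_ Y).inv ≫ p ▷ Y

theorem insertPoint_tensorHom {S S' Y Y' : M} (p : tensorUnit M ⟶ S) (f : S ⟶ S') (g : Y ⟶ Y') :
    insertPoint p Y ≫ (f ⊗ₘ g) = g ≫ insertPoint (p ≫ f) Y' := by
  simp [insertPoint, MonoidalCategory.tensorHom_def, ← whisker_exchange, ← whisker_exchange_assoc]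

theorem insertPoint_whiskerLeft {S Y Y' : M} (p : tensorUnit M ⟶ S) (g : Y ⟶ Y') :
    insertPoint p Y ≫ S ◁ g = g ≫ insertPoint p Y' := by
  simp [insertPoint, ← whisker_exchange]

theorem insertPoint_assoc {S T Y : M} (p : tensorUnit M ⟶ S) (q : tensorUnit M ⟶ T) :
    insertPoint q Y ≫ insertPoint p (T ⊗ Y) ≫ (α_ S T Y).inv = insertPoint (pointMul p q) Y := by
  simp [insertPoint, pointMul, MonoidalCategory.tensorHom_def']

variable [SymmetricCategory M]

/-- Rests on `leftUnitor_monoidal`, the compatibility of left unitors with the shuffle. -/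
theorem insertPoint_tensorμ {S S' Y Y' : M} (p : tensorUnit M ⟶ S) (q : tensorUnit M ⟶ S') :
    (insertPoint p Y ⊗ₘ insertPoint q Y') ≫ tensorμ S Y S' Y' =
      insertPoint (pointMul p q) (Y ⊗ Y') := by
  have h := leftUnitor_monoidal Y Y'
  have h' : ((λ_ Y).inv ⊗ₘ (λ_ Y').inv) ≫ tensorμ (tensorUnit M) Y (tensorUnit M) Y' =
      (λ_ (Y ⊗ Y')).inv ≫ (λ_ (tensorUnit M)).inv ▷ (Y ⊗ Y') := by
    rw [← cancel_mono ((λ_ (tensorUnit M)).hom ▷ (Y ⊗ Y') ≫ (λ_ (Y ⊗ Y')).hom), Category.assoc, ← h]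
    simp
  unfold insertPoint
  rw [← tensorHom_comp_tensorHom, Category.assoc, ← tensorHom_id, ← tensorHom_id,
    tensorμ_natural, reassoc_of% h', pointMul, comp_whiskerRight]
  simp

theorem tensMap_insertPoint_zip {I : Type*} (l : List I) {S Y : I → M}
    (p : ∀ i, tensorUnit M ⟶ S i) :
    tensMap l (fun i => insertPoint (p i) (Y i)) ≫ tensZip l S Y =
      insertPoint (tensPoint l p) (tens l Y) := by
  induction l with
  | nil =>
    change 𝟙 (tensorUnit M) ≫ (λ_ _).inv = (λ_ (tensorUnit M)).inv ≫ 𝟙 (tensorUnit M) ▷ _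
    simp
  | cons a l ih =>
    change (insertPoint (p a) (Y a) ⊗ₘ tensMap l _) ≫ _ ◁ tensZip l S Y ≫ tensorμ _ _ _ _ =
      insertPoint (pointMul (p a) (tensPoint l p)) (Y a ⊗ tens l Y)
    rw [tensorHom_comp_whiskerLeft_assoc, ih, insertPoint_tensorμ]

open Functor.LaxMonoidal in
theorem Involution.insertPoint_μ (𝒥 : Involution M) {S : M} (p : tensorUnit M ⟶ S) (Y : M) :
    insertPoint (ε 𝒥.J ≫ 𝒥.J.map p) (𝒥.J.obj Y) ≫ μ 𝒥.J S Y = 𝒥.J.map (insertPoint p Y) := by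
  rw [insertPoint, insertPoint, comp_whiskerRight, Category.assoc, Category.assoc, μ_natural_left,
    Functor.map_comp, ← left_unitality_inv_assoc]

end PointInsertion

/-! ### Morphisms out of tensor products of copowers -/

section CopowerExt
variable {M : Type u} [Category.{v} M] [MonoidalCategory M] [HasColimits M] [SymmetricCategory M]
  [MonoidalClosed M]

theorem insertPoint_ext {S : Type v} {Y Z : M} {f g : cop M S ⊗ Y ⟶ Z}
    (h : ∀ s, insertPoint (copι s) Y ≫ f = insertPoint (copι s) Y ≫ g) : f = g :=
  copTensor_ext fun s => by
    have := h s
    simpa only [insertPoint, Category.assoc, cancel_epi] using this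

/-- The empty copower is initial, and closedness makes a tensor product with such a factor initial
as well. Currying removes the factors in front of it. -/
theorem tens_ext_of_isEmpty {I : Type} {S : I → Type v} {Y : I → M} {i : I} [IsEmpty (S i)]
    (l : List I) (h : i ∈ l) {Z : M} (f g : tens l (fun i => cop M (S i) ⊗ Y i) ⟶ Z) : f = g := by
  induction l generalizing Z with
  | nil => exact absurd h List.not_mem_nil
  | cons a l ih =>
    by_cases e : a = i
    · subst e
      change (cop M (S a) ⊗ Y a) ⊗ _ ⟶ Z at f g
      refine (cancel_epi (α_ _ _ _).inv).1 ?_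
      exact copTensor_ext fun s => isEmptyElim s
    · have := ih ((List.mem_cons.1 h).resolve_left (Ne.symm e))
        (MonoidalClosed.curry f) (MonoidalClosed.curry g)
      exact MonoidalClosed.curry_injective this

/-- The head copower is tested on its own elements, and the remaining ones by induction after
currying the head away. -/
theorem tens_ext_of_nonempty {I : Type} [DecidableEq I] {S : I → Type v} {Y : I → M} [∀ i, Nonempty (S i)]
    (l : List I) (hl : l.Nodup) {Z : M} {f g : tens l (fun i => cop M (S i) ⊗ Y i) ⟶ Z}
    (h : ∀ q : ∀ i, S i, tensMap l (fun i => insertPoint (copι (q i)) (Y i)) ≫ f =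
      tensMap l (fun i => insertPoint (copι (q i)) (Y i)) ≫ g) : f = g := by
  induction l generalizing Z with
  | nil =>
    -- The hypothesis needs a choice for every index, even when no factor is left; nonemptiness
    -- supplies it.
    have := h fun i => Classical.arbitrary _
    exact (Category.id_comp f).symm.trans (this.trans (Category.id_comp g))
  | cons a l ih =>
    change (cop M (S a) ⊗ Y a) ⊗ _ ⟶ Z at f g
    refine (cancel_epi (α_ _ _ _).inv).1 ?_
    refine insertPoint_ext fun s => ?_
    apply MonoidalClosed.curry_injective
    refine ih hl.of_cons fun q => ?_
    rw [← MonoidalClosed.curry_natural_left, ← MonoidalClosed.curry_natural_left]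
    congr 1
    -- The value at `a` can be varied alone: the list has no repetitions, so the tail does not see
    -- the change.
    have h1 := h (Function.update q a s)
    change (insertPoint (copι (Function.update q a s a)) (Y a) ⊗ₘ tensMap l _) ≫ f =
      (insertPoint (copι (Function.update q a s a)) (Y a) ⊗ₘ tensMap l _) ≫ g at h1
    have h2 : ∀ l' : List I, a ∉ l' → tensMap l' (fun i => insertPoint (copι (Function.update q a s i)) (Y i)) =
        tensMap (M := M) l' (fun i => insertPoint (copι (q i)) (Y i)) := by
      intro l' hl'
      induction l' with
      | nil => rfl
      | cons b l' ih' =>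
        change (insertPoint (copι (Function.update q a s b)) (Y b) ⊗ₘ tensMap l' _) =
          (insertPoint (copι (q b)) (Y b) ⊗ₘ tensMap l' _)
        rw [ih' fun h => hl' (List.mem_cons_of_mem _ h), Function.update_of_ne]
        rintro rfl
        exact hl' List.mem_cons_self
    rw [h2 l (List.nodup_cons.1 hl).1, Function.update_self] at h1
    have h3 : ∀ {T T' : M} (r : T ⟶ T'), Y a ◁ r ≫ insertPoint (copι s : tensorUnit M ⟶ _) (Y a ⊗ T') ≫
        (α_ (cop M (S a)) (Y a) T').inv = insertPoint (copι s) (Y a) ⊗ₘ r := by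
      intro T T' r
      rw [insertPoint, insertPoint, MonoidalCategory.tensorHom_def']
      simp
    rw [← h3] at h1
    simpa only [Category.assoc] using h1

theorem tens_ext {n : ℕ} {S : Fin n → Type v} {Y : Fin n → M} {Z : M}
    {f g : tens (List.finRange n) (fun i => cop M (S i) ⊗ Y i) ⟶ Z}
    (h : ∀ q : ∀ i, S i, tensMap _ (fun i => insertPoint (copι (q i)) (Y i)) ≫ f =
      tensMap _ (fun i => insertPoint (copι (q i)) (Y i)) ≫ g) : f = g := by
  by_cases hS : ∀ i, Nonempty (S i)
  · exact tens_ext_of_nonempty _ (List.nodup_finRange n) h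
  -- With one `S i` empty there is no family `q` and the hypothesis is vacuous, but then the source
  -- is initial.
  · push Not at hS
    obtain ⟨i, hi⟩ := hS
    have : IsEmpty (S i) := by simpa using hi
    exact tens_ext_of_isEmpty _ (List.mem_finRange i) f g

end CopowerExt

/-! ### The algebra axioms, tested on elements of the sets of operations -/

section Operations
variable {C : Type v} [SmallCategory C] (P : Orthogonality C)
variable {M : Type u} [Category.{v} M] [MonoidalCategory M] [SymmetricCategory M] [MonoidalClosed M]
  [HasColimits M]

theorem act_perm_iff {S S' : Type v} (g : S → S') {Y Y' Z : M} (r : Y ⟶ Y')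
    (α : cop M S ⊗ Y ⟶ Z) (α' : cop M S' ⊗ Y' ⟶ Z) :
    (copMap g ⊗ₘ r) ≫ α' = α ↔
      ∀ s, r ≫ insertPoint (copι (g s)) Y' ≫ α' = insertPoint (copι s) Y ≫ α := by
  constructor
  · rintro rfl s
    rw [← Category.assoc, ← Category.assoc, insertPoint_tensorHom, copι_map]
  · intro h
    refine insertPoint_ext fun s => ?_
    rw [← h, ← Category.assoc, insertPoint_tensorHom, copι_map, Category.assoc]

/-- Both sides are restricted to a point for `p` and one for each `q i`. The shuffle collects the
inserted points, and the composition sends them to the point of `p.comp q`. -/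
theorem act_comp_iff {n : ℕ} {k : Fin n → ℕ} {a : Fin n → C} {b : ∀ i, Fin (k i) → C} {t : C}
    {X : Fin n → M} {Y : ∀ i, Fin (k i) → M} {Z : M}
    (α : ∀ i, cop M (OpSet P (b i) (a i)) ⊗ tens (List.finRange (k i)) (Y i) ⟶ X i)
    (β : cop M (OpSet P a t) ⊗ tens (List.finRange n) X ⟶ Z)
    (γ : cop M (OpSet P (concat b) t) ⊗ tens (List.finRange (∑ i, k i)) (concat Y) ⟶ Z) :
    cop M (OpSet P a t) ◁ tensMap _ α ≫ β =
      cop M (OpSet P a t) ◁ tensZip _ _ (fun i => tens _ (Y i)) ≫ (α_ _ _ _).inv ≫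
        (aqftComp P a b t ⊗ₘ tensFlatten Y) ≫ γ ↔
    ∀ (p : OpSet P a t) (q : ∀ i, OpSet P (b i) (a i)),
      tensMap _ (fun i => insertPoint (copι (q i)) _ ≫ α i) ≫ insertPoint (copι p) _ ≫ β =
        tensFlatten Y ≫ insertPoint (copι (p.comp q)) _ ≫ γ := by
  have hL : ∀ (p : OpSet P a t) (q : ∀ i, OpSet P (b i) (a i)),
      tensMap _ (fun i => insertPoint (copι (q i)) _) ≫ insertPoint (copι p) _ ≫
        cop M (OpSet P a t) ◁ tensMap _ α ≫ β =
      tensMap _ (fun i => insertPoint (copι (q i)) _ ≫ α i) ≫ insertPoint (copι p) _ ≫ β := by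
    intro p q
    rw [reassoc_of% insertPoint_whiskerLeft, tensMap_comp, Category.assoc]
  have hR : ∀ (p : OpSet P a t) (q : ∀ i, OpSet P (b i) (a i)),
      tensMap _ (fun i => insertPoint (copι (q i)) _) ≫ insertPoint (copι p) _ ≫
        cop M (OpSet P a t) ◁ tensZip _ _ (fun i => tens _ (Y i)) ≫ (α_ _ _ _).inv ≫
        (aqftComp P a b t ⊗ₘ tensFlatten Y) ≫ γ =
      tensFlatten Y ≫ insertPoint (copι (p.comp q)) _ ≫ γ := by
    intro p q
    rw [reassoc_of% insertPoint_whiskerLeft, reassoc_of% tensMap_insertPoint_zip,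
      reassoc_of% insertPoint_assoc, reassoc_of% insertPoint_tensorHom, point_aqftComp]
  constructor
  · intro h p q
    rw [← hL, h, hR]
  · intro h
    refine insertPoint_ext fun p => tens_ext fun q => ?_
    rw [hL, hR, h]

open Functor.LaxMonoidal in
-- On points the star of the operad is `OpSet.rev` followed by `J₀`, and `J₀` is absorbed by the
-- unitality of `J`.
theorem act_star_iff (𝒥 : Involution M) {n : ℕ} (c : Fin n → C) (t : C) {Y Z : M}
    (α : cop M (OpSet P c t) ⊗ Y ⟶ Z) (r : Y ⟶ 𝒥.J.obj Y) (r' : Z ⟶ 𝒥.J.obj Z) :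
    α ≫ r' = (aqftStar P 𝒥 c t ⊗ₘ r) ≫ μ 𝒥.J _ _ ≫ 𝒥.J.map α ↔
      ∀ s : OpSet P c t, (insertPoint (copι s) Y ≫ α) ≫ r' =
        r ≫ 𝒥.J.map (insertPoint (copι s.rev) Y ≫ α) := by
  have h : ∀ s : OpSet P c t, insertPoint (copι s) Y ≫ (aqftStar P 𝒥 c t ⊗ₘ r) ≫ μ 𝒥.J _ _ ≫
      𝒥.J.map α = r ≫ 𝒥.J.map (insertPoint (copι s.rev) Y ≫ α) := by
    intro s
    rw [reassoc_of% insertPoint_tensorHom, copι_star, reassoc_of% 𝒥.insertPoint_μ,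
      Functor.map_comp]
  constructor
  · intro h' s
    rw [Category.assoc, h', h]
  · intro h'
    refine insertPoint_ext fun s => ?_
    rw [h, ← h', Category.assoc]

end Operations
end AQFT

namespace AQFT

/-! ### Products of finite families in a monoid -/

section Fold
variable {M : Type u} [Category.{v} M] [MonoidalCategory M] {I : Type w} {I' : Type*}
  {A : M} [MonObj A]

/-- The product in a monoid of a family of morphisms, in the order given by a list of indices. -/
def fold {X : I → M} (g : ∀ i, X i ⟶ A) : (l : List I) → (tens l X ⟶ A)
  | [] => MonObj.one
  | i :: l => (g i ⊗ₘ fold g l) ≫ MonObj.mul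

theorem fold_cons {X : I → M} (g : ∀ i, X i ⟶ A) (a : I) (l : List I) :
    fold g (a :: l) = (g a ⊗ₘ fold g l) ≫ MonObj.mul := rfl

theorem mul_tensorHom_assoc {B D E : M} (f : B ⟶ A) (g : D ⟶ A) (h : E ⟶ A) :
    (α_ B D E).hom ≫ (f ⊗ₘ ((g ⊗ₘ h) ≫ MonObj.mul)) ≫ MonObj.mul =
      (((f ⊗ₘ g) ≫ MonObj.mul) ⊗ₘ h) ≫ MonObj.mul := by
  rw [← tensorHom_comp_whiskerLeft, ← tensorHom_comp_whiskerRight, Category.assoc, Category.assoc,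
    MonObj.mul_assoc, associator_naturality_assoc]

theorem tensAppend_fold {X : I → M} (g : ∀ i, X i ⟶ A) (l r : List I) :
    tensAppend l r X ≫ fold g (l ++ r) = (fold g l ⊗ₘ fold g r) ≫ MonObj.mul := by
  induction l with
  | nil =>
    change (λ_ _).hom ≫ fold g r = (MonObj.one ⊗ₘ fold g r) ≫ MonObj.mul
    rw [MonoidalCategory.tensorHom_def', Category.assoc, MonObj.one_mul, leftUnitor_naturality]
  | cons a l ih =>
    change ((α_ _ _ _).hom ≫ X a ◁ tensAppend l r X) ≫ (g a ⊗ₘ fold g (l ++ r)) ≫ MonObj.mul =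
      (((g a ⊗ₘ fold g l) ≫ MonObj.mul) ⊗ₘ fold g r) ≫ MonObj.mul
    rw [Category.assoc, whiskerLeft_comp_tensorHom_assoc, ih, mul_tensorHom_assoc]

theorem tensMap_fold {X Y : I → M} (r : ∀ i, X i ⟶ Y i) (g : ∀ i, Y i ⟶ A) (l : List I) :
    tensMap l r ≫ fold g l = fold (fun i => r i ≫ g i) l := by
  induction l with
  | nil => exact Category.id_comp _
  | cons a l ih =>
    change (r a ⊗ₘ tensMap l r) ≫ (g a ⊗ₘ fold g l) ≫ MonObj.mul = _
    rw [tensorHom_comp_tensorHom_assoc, ih, fold_cons]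

theorem fold_mapIndex (f : I → I') {X : I' → M} (g : ∀ i, X i ⟶ A) (l : List I) :
    tensMapIndex f l X ≫ fold g (l.map f) = fold (fun i => g (f i)) l := by
  induction l with
  | nil => exact Category.id_comp _
  | cons a l ih =>
    change X (f a) ◁ tensMapIndex f l X ≫ (g (f a) ⊗ₘ fold g (l.map f)) ≫ MonObj.mul = _
    rw [whiskerLeft_comp_tensorHom_assoc, ih, fold_cons]

theorem fold_unmapIndex (f : I → I') {X : I' → M} (g : ∀ i, X i ⟶ A) (l : List I) :
    tensUnmapIndex f l X ≫ fold (fun i => g (f i)) l = fold g (l.map f) := by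
  rw [← fold_mapIndex, ← Category.assoc, tensUnmapIndex_mapIndex, Category.id_comp]

theorem fold_comp {B : M} [MonObj B] (F : A ⟶ B) [IsMonHom F] {X : I → M} (g : ∀ i, X i ⟶ A)
    (l : List I) : fold g l ≫ F = fold (fun i => g i ≫ F) l := by
  induction l with
  | nil => exact IsMonHom.one_hom F
  | cons a l ih =>
    change ((g a ⊗ₘ fold g l) ≫ MonObj.mul) ≫ F = _
    rw [Category.assoc, IsMonHom.mul_hom, tensorHom_comp_tensorHom_assoc, ih, fold_cons]

/-- General associativity: a product of products over blocks is the product over the concatenated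
list. -/
theorem tensSigma_fold {K : I → Type*} (l : List I) (k : ∀ i, List (K i))
    {X : (i : I) × K i → M} (g : ∀ p, X p ⟶ A) :
    tensSigma l k X ≫ fold g (l.sigma k) = fold (fun i => fold (fun j => g ⟨i, j⟩) (k i)) l := by
  induction l with
  | nil => exact Category.id_comp _
  | cons a l ih =>
    refine (Category.assoc _ _ _).trans ?_
    rw [fold_cons]
    refine (congrArg (_ ≫ ·) (tensAppend_fold g ((k a).map (Sigma.mk a)) (l.sigma k))).trans ?_
    refine (tensorHom_comp_tensorHom_assoc _ _ _ _ _).trans ?_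
    rw [ih, fold_mapIndex]

theorem fold_singleton {X : I → M} (g : ∀ i, X i ⟶ A) (a : I) :
    fold g [a] = (ρ_ (X a)).hom ≫ g a := by
  change (g a ⊗ₘ MonObj.one) ≫ MonObj.mul = _
  rw [MonoidalCategory.tensorHom_def, Category.assoc, MonObj.mul_one, rightUnitor_naturality]

variable [SymmetricCategory M]

theorem frontSwap_mul {B D E : M} (f : B ⟶ A) (g : D ⟶ A) (h : E ⟶ A)
    (hfg : (f ⊗ₘ g) ≫ MonObj.mul = (f ⊗ₘ g) ≫ (β_ A A).hom ≫ MonObj.mul) :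
    frontSwap B D E ≫ (g ⊗ₘ ((f ⊗ₘ h) ≫ MonObj.mul)) ≫ MonObj.mul =
      (f ⊗ₘ ((g ⊗ₘ h) ≫ MonObj.mul)) ≫ MonObj.mul := by
  rw [← cancel_epi (α_ B D E).hom, mul_tensorHom_assoc f g h, hfg,
    BraidedCategory.braiding_naturality_assoc, frontSwap]
  simp only [Category.assoc, Iso.hom_inv_id_assoc]
  rw [mul_tensorHom_assoc, whiskerRight_comp_tensorHom_assoc]

/-- Two adjacent commuting factors may be exchanged in the middle of a product; this is where
`⊥`-commutativity will be used. -/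
theorem exists_isSymmetry_fold_swap {X : I → M} (g : ∀ i, X i ⟶ A) {a b : I} (hab : a ≠ b)
    (h : (g a ⊗ₘ g b) ≫ MonObj.mul = (g a ⊗ₘ g b) ≫ (β_ A A).hom ≫ MonObj.mul) (l r : List I) :
    ∃ φ, IsSymmetry X (l ++ a :: b :: r) (l ++ b :: a :: r) φ ∧
      φ ≫ fold g (l ++ b :: a :: r) = fold g (l ++ a :: b :: r) := by
  induction l with
  | nil => exact ⟨_, .swap r hab, frontSwap_mul _ _ _ h⟩
  | cons i l ih =>
    obtain ⟨φ, h1, h2⟩ := ih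
    refine ⟨_, h1.cons i, ?_⟩
    change X i ◁ φ ≫ (g i ⊗ₘ fold g (l ++ b :: a :: r)) ≫ MonObj.mul =
      (g i ⊗ₘ fold g (l ++ a :: b :: r)) ≫ MonObj.mul
    rw [whiskerLeft_comp_tensorHom_assoc, h2]

/-- Moving the first factor to the end expresses the opposite product with the remaining factors. It
serves the star and binary operations. -/
theorem exists_isSymmetry_rotate {X : I → M} (g : ∀ i, X i ⟶ A) {a : I} (l : List I) (h : a ∉ l) :
    ∃ φ, IsSymmetry X (a :: l) (l ++ [a]) φ ∧
      φ ≫ fold g (l ++ [a]) = (g a ⊗ₘ fold g l) ≫ (β_ A A).hom ≫ MonObj.mul := by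
  obtain ⟨φ, h1, h2⟩ := exists_isSymmetry_front (X := X) l [] h
  refine ⟨_, ((isSymmetry_append_nil l).cons a).trans h1, ?_⟩
  have h3 := tensAppend_fold g l [a]
  rw [fold_singleton] at h3
  -- Stated for arbitrary objects, so that the trailing unit in the one-element list `[a]` is
  -- visible to the unitors.
  have key : ∀ {B Q R : M} {p : Q ⊗ tensorUnit M ⟶ R} {φ : B ⊗ R ⟶ tens (l ++ [a]) X}
      {r : Q ⊗ (B ⊗ tensorUnit M) ⟶ tens (l ++ [a]) X} {f : B ⟶ A} {k : Q ⟶ A}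
      (h2 : B ◁ p ≫ φ = frontSwap B Q (tensorUnit M) ≫ r)
      (h3 : r ≫ fold g (l ++ [a]) = (k ⊗ₘ ((ρ_ B).hom ≫ f)) ≫ MonObj.mul),
      (B ◁ ((ρ_ Q).inv ≫ p) ≫ φ) ≫ fold g (l ++ [a]) =
        (f ⊗ₘ k) ≫ (β_ A A).hom ≫ MonObj.mul := by
    intro B Q R p φ r f k h2 h3
    rw [MonoidalCategory.whiskerLeft_comp, Category.assoc, Category.assoc, reassoc_of% h2, h3,
      BraidedCategory.braiding_naturality_assoc, frontSwap, ← whiskerLeft_comp_tensorHom]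
    simp
  exact key h2 h3

open Functor.LaxMonoidal in
-- Each multiplication contributes one opposite multiplication, so by induction the first factor
-- ends up behind the reversal of the others.
theorem exists_isSymmetry_fold_star {𝒥 : Involution M} (A : RevStarMon 𝒥) {X : I → M}
    (g : ∀ i, X i ⟶ A.X) (s : ∀ i, X i ⟶ 𝒥.J.obj (X i))
    (h : ∀ i, g i ≫ A.star = s i ≫ 𝒥.J.map (g i)) (l : List I) (hl : l.Nodup) :
    ∃ φ, IsSymmetry X l l.reverse φ ∧
      fold g l ≫ A.star = tensMap l s ≫ 𝒥.tensJ l X ≫ 𝒥.J.map (φ ≫ fold g l.reverse) := by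
  induction l with
  | nil =>
    refine ⟨_, .nil, ?_⟩
    refine A.one_star.trans ?_
    refine Eq.trans ?_ (Category.id_comp _).symm
    exact congrArg (ε 𝒥.J ≫ 𝒥.J.map ·) (Category.id_comp MonObj.one).symm
  | cons a l ih =>
    obtain ⟨φ, h1, h2⟩ := ih hl.of_cons
    obtain ⟨ψ, h3, h4⟩ := exists_isSymmetry_rotate g (a := a) l.reverse
      (fun h => (List.nodup_cons.1 hl).1 (List.mem_reverse.1 h))
    change X a ⊗ tens l.reverse X ⟶ _ at ψ
    change ψ ≫ _ = _ at h4
    rw [List.reverse_cons]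
    refine ⟨_, (h1.cons a).trans h3, ?_⟩
    change ((g a ⊗ₘ fold g l) ≫ MonObj.mul) ≫ A.star = (s a ⊗ₘ tensMap l s) ≫
      (_ ◁ 𝒥.tensJ l X ≫ μ 𝒥.J (X a) (tens l X)) ≫ 𝒥.J.map ((X a ◁ φ ≫ ψ) ≫ fold g (l.reverse ++ [a]))
    rw [Category.assoc, A.mul_star, Category.assoc, Category.assoc, h4, tensorHom_comp_tensorHom_assoc, h, h2]
    rw [whiskerLeft_comp_tensorHom_assoc, Functor.map_comp 𝒥.J (g a ⊗ₘ φ ≫ fold g l.reverse),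
      ← μ_natural_assoc, ← id_tensorHom, tensorHom_comp_tensorHom_assoc,
      tensorHom_comp_tensorHom_assoc, Category.comp_id, Category.assoc]

end Fold
end AQFT

namespace AQFT

/-! ### Permutations as enumerations of indices -/

section OrderLists

theorem map_symm_trans_cast {m n : ℕ} (e : Fin m ≃ Fin n) (σ : Equiv.Perm (Fin n)) (h : n = m) :
    ((List.finRange m).map ((e.trans σ).trans (finCongr h)).symm).map e =
      (List.finRange n).map σ.symm := by
  subst h
  rw [List.map_map]
  exact List.map_congr_left fun i _ => by simp

theorem map_symm_revPerm {n : ℕ} (σ : Equiv.Perm (Fin n)) :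
    (List.finRange n).map (Fin.revPerm * σ).symm = ((List.finRange n).map σ.symm).reverse := by
  rw [← List.map_reverse, List.finRange_reverse, List.map_map]
  exact List.map_congr_left fun i _ => by
    rw [Equiv.symm_apply_eq]; simp

theorem exists_finRange_eq_append {n : ℕ} (k k' : Fin n) (hk : k'.val = k.val + 1) :
    ∃ u v, List.finRange n = u ++ k :: k' :: v := by
  refine ⟨(List.finRange n).take k, (List.finRange n).drop (k + 2), ?_⟩
  have h1 : (List.finRange n).drop k = k :: (List.finRange n).drop (k + 1) := by
    rw [List.drop_eq_getElem_cons (by simp)]; simp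
  have h2 : (List.finRange n).drop (k + 1) = k' :: (List.finRange n).drop (k + 2) := by
    rw [List.drop_eq_getElem_cons (by rw [List.length_finRange]; omega), List.getElem_finRange]
    exact congrArg (· :: _) (Fin.ext hk.symm)
  rw [← h2, ← h1, List.take_append_drop]

/-- The list `(List.finRange n).map σ.symm` names the index at each position, so a transposition of
neighbouring positions exchanges neighbouring entries. -/
theorem map_symm_swap {n : ℕ} (σ : Equiv.Perm (Fin n)) (k k' : Fin n) (hk : k'.val = k.val + 1) :
    ∃ u v, (List.finRange n).map σ.symm = u ++ σ.symm k :: σ.symm k' :: v ∧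
      (List.finRange n).map (Equiv.swap k k' * σ).symm = u ++ σ.symm k' :: σ.symm k :: v := by
  obtain ⟨u, v, h⟩ := exists_finRange_eq_append k k' hk
  have hn := List.nodup_finRange n
  rw [h] at hn
  have hu : ∀ x ∈ u ++ v, (Equiv.swap k k' * σ).symm x = σ.symm x := by
    intro x hx
    have hx' : x ≠ k ∧ x ≠ k' := by
      constructor
      · rintro rfl
        simp only [List.nodup_append, List.nodup_cons, List.mem_cons, List.mem_append] at hn hx
        rcases hx with hx | hx
        · exact hn.2.2 _ hx _ (Or.inl rfl) rfl
        · exact hn.2.1.1 (Or.inr hx)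
      · rintro rfl
        simp only [List.nodup_append, List.nodup_cons, List.mem_cons, List.mem_append] at hn hx
        rcases hx with hx | hx
        · exact hn.2.2 _ hx _ (Or.inr (Or.inl rfl)) rfl
        · exact hn.2.1.2.1 hx
    rw [Equiv.symm_apply_eq]
    simp [Equiv.swap_apply_of_ne_of_ne hx'.1 hx'.2]
  refine ⟨u.map σ.symm, v.map σ.symm, by rw [h]; simp, ?_⟩
  rw [h, List.map_append, List.map_cons, List.map_cons,
    List.map_congr_left fun x hx => hu x (List.mem_append_left v hx),
    List.map_congr_left fun x hx => hu x (List.mem_append_right u hx)]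
  have h1 : (Equiv.swap k k' * σ).symm k = σ.symm k' := by rw [Equiv.symm_apply_eq]; simp
  have h2 : (Equiv.swap k k' * σ).symm k' = σ.symm k := by rw [Equiv.symm_apply_eq]; simp
  rw [h1, h2]

/-- Both lists enumerate all pairs and both are sorted for the same lexicographic order, the one
described by `blockPerm_lt`; such an enumeration is unique. -/
theorem map_symm_blockPerm {n : ℕ} {k : Fin n → ℕ} (σ : Equiv.Perm (Fin n))
    (τ : ∀ i, Equiv.Perm (Fin (k i))) :
    ((List.finRange _).map (blockPerm σ τ).symm).map finSigmaFinEquiv.symm =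
      ((List.finRange n).map σ.symm).sigma fun i => (List.finRange (k i)).map (τ i).symm := by
  have hL : (((List.finRange _).map (blockPerm σ τ).symm).map finSigmaFinEquiv.symm).Pairwise
      fun p q => Sigma.Lex (fun i i' => σ i < σ i') (fun i j j' => τ i j < τ i j') p q := by
    rw [List.pairwise_map, List.pairwise_map]
    refine (List.pairwise_lt_finRange _).imp fun {x y} h => ?_
    rw [← blockPerm_lt]
    simpa using h
  have hR : (((List.finRange n).map σ.symm).sigma fun i => (List.finRange (k i)).map (τ i).symm).Pairwise
      fun p q => Sigma.Lex (fun i i' => σ i < σ i') (fun i j j' => τ i j < τ i j') p q := by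
    rw [List.sigma, List.pairwise_flatMap]
    refine ⟨fun i _ => ?_, ?_⟩
    · rw [List.pairwise_map, List.pairwise_map]
      exact (List.pairwise_lt_finRange _).imp fun h => Sigma.Lex.right _ _ (by simpa using h)
    · rw [List.pairwise_map]
      refine (List.pairwise_lt_finRange n).imp fun {i i'} h p hp q hq => ?_
      obtain ⟨j, _, rfl⟩ := List.mem_map.1 hp
      obtain ⟨j', _, rfl⟩ := List.mem_map.1 hq
      exact Sigma.Lex.left _ _ (by simpa using h)
  have hasymm : ∀ p q : (i : Fin n) × Fin (k i),
      Sigma.Lex (fun i i' => σ i < σ i') (fun i j j' => τ i j < τ i j') p q →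
      Sigma.Lex (fun i i' => σ i < σ i') (fun i j j' => τ i j < τ i j') q p → False := by
    intro p q h h'
    obtain ⟨x, rfl⟩ := finSigmaFinEquiv.symm.surjective p
    obtain ⟨y, rfl⟩ := finSigmaFinEquiv.symm.surjective q
    rw [← blockPerm_lt] at h h'
    exact absurd h h'.not_gt
  refine List.Perm.eq_of_pairwise (fun a b _ _ h h' => (hasymm a b h h').elim) hL hR ?_
  have hne : ∀ p q : (i : Fin n) × Fin (k i),
      Sigma.Lex (fun i i' => σ i < σ i') (fun i j j' => τ i j < τ i j') p q → p ≠ q := by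
    rintro p _ h rfl
    exact hasymm p p h h
  refine (List.perm_ext_iff_of_nodup (hL.imp fun h => hne _ _ h)
    (hR.imp fun h => hne _ _ h)).2 fun p => ?_
  have h1 : p ∈ ((List.finRange _).map (blockPerm σ τ).symm).map finSigmaFinEquiv.symm :=
    List.mem_map.2 ⟨finSigmaFinEquiv p, List.mem_map.2 ⟨_, List.mem_finRange _,
      Equiv.symm_apply_apply _ _⟩, Equiv.symm_apply_apply _ _⟩
  have h2 : p ∈ ((List.finRange n).map σ.symm).sigma fun i => (List.finRange (k i)).map (τ i).symm := by
    rw [List.mem_sigma]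
    exact ⟨List.mem_map.2 ⟨σ p.1, List.mem_finRange _, Equiv.symm_apply_apply _ _⟩,
      List.mem_map.2 ⟨τ p.1 p.2, List.mem_finRange _, Equiv.symm_apply_apply _ _⟩⟩
  exact iff_of_true h1 h2

end OrderLists

/-! ### Products in the order given by a permutation -/

section OrderedProducts
variable {M : Type u} [Category.{v} M] [MonoidalCategory M] [SymmetricCategory M]
  {A : M} [MonObj A] {n : ℕ} {X : Fin n → M}

/-- The product of a finite family of morphisms to a monoid, the `i`-th morphism being placed at
the `σ(i)`-th position. -/
def orderedProd (σ : Equiv.Perm (Fin n)) (g : ∀ i, X i ⟶ A) : tens (List.finRange n) X ⟶ A :=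
  tensReorder X (List.finRange n) ((List.finRange n).map σ.symm) (finRange_perm σ.symm) ≫
    fold g ((List.finRange n).map σ.symm)

theorem IsSymmetry.comp_fold_congr {I : Type*} {X : I → M} {l L L' : List I}
    {φ : tens l X ⟶ tens L X} {ψ : tens l X ⟶ tens L' X} (h : IsSymmetry X l L φ)
    (h' : IsSymmetry X l L' ψ) (g : ∀ i, X i ⟶ A) (hL : L = L') :
    φ ≫ fold g L = ψ ≫ fold g L' := by
  subst hL
  rw [h.unique h']

/-- By coherence, an ordered product may be computed with any symmetry to the right list. -/
theorem IsSymmetry.comp_fold {σ : Equiv.Perm (Fin n)} {g : ∀ i, X i ⟶ A} {L : List (Fin n)}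
    {φ : tens (List.finRange n) X ⟶ tens L X} (h : IsSymmetry X (List.finRange n) L φ)
    (hL : L = (List.finRange n).map σ.symm) : φ ≫ fold g L = orderedProd σ g := by
  subst hL
  rw [orderedProd, h.unique (isSymmetry_tensReorder _ _ (finRange_perm σ.symm))]

theorem orderedProd_one (g : ∀ i, X i ⟶ A) : orderedProd 1 g = fold g (List.finRange n) := by
  rw [← (IsSymmetry.id (X := X) (List.finRange n)).comp_fold, Category.id_comp]
  exact (List.map_id _).symm

theorem tensPerm_orderedProd {m : ℕ} (e : Fin m ≃ Fin n) (σ : Equiv.Perm (Fin n)) (h : n = m)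
    (g : ∀ i, X i ⟶ A) :
    tensPerm e X ≫ orderedProd ((e.trans σ).trans (finCongr h)) (fun i => g (e i)) =
      orderedProd σ g := by
  obtain ⟨φ, h1, h2⟩ := (isSymmetry_tensReorder (X := fun i => X (e i)) _ _
    (finRange_perm ((e.trans σ).trans (finCongr h)).symm)).exists_unmapIndex e.injective (X := X)
  rw [tensPerm, orderedProd, Category.assoc, reassoc_of% h2, fold_unmapIndex, ← Category.assoc]
  exact ((isSymmetry_tensReorder _ _ _).trans h1).comp_fold (map_symm_trans_cast e σ h)

theorem orderedProd_swap (σ : Equiv.Perm (Fin n)) (k k' : Fin n) (hk : k'.val = k.val + 1)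
    (g : ∀ i, X i ⟶ A) (h : (g (σ.symm k) ⊗ₘ g (σ.symm k')) ≫ MonObj.mul =
      (g (σ.symm k) ⊗ₘ g (σ.symm k')) ≫ (β_ A A).hom ≫ MonObj.mul) :
    orderedProd (Equiv.swap k k' * σ) g = orderedProd σ g := by
  obtain ⟨u, v, h1, h2⟩ := map_symm_swap σ k k' hk
  have hne : σ.symm k ≠ σ.symm k' := σ.symm.injective.ne fun h => by rw [h] at hk; omega
  obtain ⟨φ, h3, h4⟩ := exists_isSymmetry_fold_swap g hne h u v
  have h5 := isSymmetry_tensReorder (X := X) (List.finRange n) _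
    (h1 ▸ finRange_perm σ.symm : (List.finRange n).Perm (u ++ σ.symm k :: σ.symm k' :: v))
  rw [← (h5.trans h3).comp_fold h2.symm, Category.assoc, h4, h5.comp_fold h1.symm]

/-- Each `f i` is a monoid morphism and can be moved inside the product of its block. General
associativity then turns both sides into a symmetry followed by one product over all pairs; the
lists agree by `map_symm_blockPerm` and the symmetries by coherence. -/
theorem orderedProd_comp {k : Fin n → ℕ} {A : Fin n → M} [∀ i, MonObj (A i)] {B : M} [MonObj B]
    {X : ∀ i, Fin (k i) → M} (σ : Equiv.Perm (Fin n)) (f : ∀ i, A i ⟶ B) [∀ i, IsMonHom (f i)]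
    (τ : ∀ i, Equiv.Perm (Fin (k i))) (g : ∀ i j, X i j ⟶ A i) :
    tensMap _ (fun i => orderedProd (τ i) (g i)) ≫ orderedProd σ f =
      tensFlatten X ≫ orderedProd (X := concat X) (blockPerm σ τ) fun x =>
        g (finSigmaFinEquiv.symm x).1 (finSigmaFinEquiv.symm x).2 ≫ f (finSigmaFinEquiv.symm x).1 := by
  let Y : (i : Fin n) × Fin (k i) → M := fun p => X p.1 p.2
  let h : ∀ p, Y p ⟶ B := fun p => g p.1 p.2 ≫ f p.1
  let K : ∀ i, List (Fin (k i)) := fun i => (List.finRange (k i)).map (τ i).symm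
  let L : List (Fin n) := (List.finRange n).map σ.symm
  have hR : orderedProd (X := concat X) (blockPerm σ τ) (fun x => h (finSigmaFinEquiv.symm x)) =
      tensReorder _ _ _ (finRange_perm (blockPerm σ τ).symm) ≫ fold _ _ := rfl
  -- On the flattened product, `φ` reorders inside the blocks, `ψ` permutes the blocks, and `χ` is
  -- the reordering by the block permutation. The morphism `ω` is the outer reordering after
  -- multiplication inside the blocks.
  obtain ⟨φ, h1, h2⟩ := exists_isSymmetry_sigma_inner (X := Y) (List.finRange n)
    fun i => isSymmetry_tensReorder (X := X i) (List.finRange (k i)) (K i) (finRange_perm (τ i).symm)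
  obtain ⟨ψ, h3, h4⟩ := (isSymmetry_tensReorder (X := fun i => tens (K i) (X i)) (List.finRange n) L
    (finRange_perm σ.symm)).exists_sigma K (X := Y)
  obtain ⟨χ, h5, h6⟩ := (isSymmetry_tensReorder (X := concat X) _ _
    (finRange_perm (blockPerm σ τ).symm)).exists_unmapIndex finSigmaFinEquiv.symm.injective (X := Y)
  obtain ⟨ω, h7, h8⟩ := (isSymmetry_tensReorder (X := fun i => tens (K i) (X i)) (List.finRange n) L
    (finRange_perm σ.symm)).exists_map (Y := A) (fun i => fold (g i) (K i))
  have hω := h7.comp_fold (σ := σ) (g := f) rfl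
  calc _ = tensMap _ (fun i => tensReorder (X i) (List.finRange (k i)) (K i) (finRange_perm (τ i).symm)) ≫
        tensMap _ (fun i => fold (g i) (K i)) ≫ orderedProd σ f := by
        rw [← Category.assoc, ← tensMap_comp]; rfl
    _ = tensSigma _ _ Y ≫ φ ≫ ψ ≫ fold h (L.sigma K) := by
        rw [← hω, reassoc_of% h8, tensMap_fold, reassoc_of% h2, reassoc_of% h4, tensSigma_fold]
        simp only [fold_comp]
        rfl
    _ = _ := by
        refine Eq.trans ?_ (congrArg (tensFlatten X ≫ ·) hR).symm
        rw [tensFlatten]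
        simp only [Category.assoc]
        rw [reassoc_of% h6]
        refine congrArg (tensSigma _ _ Y ≫ ·) ?_
        have h9 := fold_unmapIndex finSigmaFinEquiv.symm h
          ((List.finRange _).map (blockPerm σ τ).symm)
        refine Eq.trans ?_ (congrArg (fun x => eqToHom _ ≫ χ ≫ x) h9).symm
        -- Coherence: reordering by the block permutation agrees with `φ` followed by `ψ`.
        have h10 := ((isSymmetry_eqToHom (X := Y) (finRange_sigma k)).trans h5).comp_fold_congr
          (h1.trans h3) h (map_symm_blockPerm σ τ)
        simpa only [Category.assoc] using h10.symm

open Functor.LaxMonoidal in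
-- The reordering by `σ` is transported along the stars and along the monoidal structure of `J`; by
-- coherence the two results coincide.
theorem orderedProd_star {𝒥 : Involution M} (A : RevStarMon 𝒥) (σ : Equiv.Perm (Fin n))
    (g : ∀ i, X i ⟶ A.X) (s : ∀ i, X i ⟶ 𝒥.J.obj (X i))
    (h : ∀ i, g i ≫ A.star = s i ≫ 𝒥.J.map (g i)) :
    orderedProd σ g ≫ A.star = (tensMap _ s ≫ 𝒥.tensJ _ X) ≫
      𝒥.J.map (orderedProd (Fin.revPerm * σ) g) := by
  obtain ⟨φ, h1, h2⟩ := exists_isSymmetry_fold_star A g s h ((List.finRange n).map σ.symm)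
    ((List.nodup_finRange n).map σ.symm.injective)
  have h0 := isSymmetry_tensReorder (X := X) _ _ (finRange_perm σ.symm)
  obtain ⟨ψ, h3, h4⟩ := h0.exists_map s
  obtain ⟨χ, h5, h6⟩ := h0.exists_tensJ 𝒥
  rw [← (h0.trans h1).comp_fold (map_symm_revPerm σ).symm, orderedProd, Category.assoc, h2,
    Category.assoc, Category.assoc, Functor.map_comp 𝒥.J (tensReorder _ _ _ _),
    reassoc_of% h6, ← reassoc_of% h4, h3.unique h5]

end OrderedProducts
end AQFT

namespace AQFT

/-! ### From `⊥`-commutative functors to `*`-algebras -/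

section OfFunctor
variable {C : Type v} [SmallCategory C] {P : Orthogonality C}
variable {M : Type u} [Category.{v} M] [MonoidalCategory M] [SymmetricCategory M] [MonoidalClosed M]
  [HasColimits M] {𝒥 : Involution M}

/-- The operations on the values of a `⊥`-commutative functor. -/
def PerpFunctor.op (A : PerpFunctor P 𝒥) {n : ℕ} {c : Fin n → C} {t : C} (s : OpSet P c t) :
    tens (List.finRange n) (fun i => (A.obj.obj (c i)).X) ⟶ (A.obj.obj t).X :=
  Quot.lift (fun a => orderedProd a.1 fun i => (A.obj.map (a.2 i)).hom.hom) (by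
    rintro _ _ ⟨σ, f, k, k', hk, h⟩
    exact (orderedProd_swap σ k k' hk _ (A.property _ _ h)).symm) s

theorem PerpFunctor.op_mk (A : PerpFunctor P 𝒥) {n : ℕ} {c : Fin n → C} {t : C}
    (σ : Equiv.Perm (Fin n)) (f : ∀ i, c i ⟶ t) :
    A.op (.mk σ f : OpSet P c t) = orderedProd σ fun i => (A.obj.map (f i)).hom.hom := rfl

theorem PerpFunctor.op_perm (A : PerpFunctor P 𝒥) {m n : ℕ} (e : Fin m ≃ Fin n) {c : Fin n → C}
    {t : C} (s : OpSet P c t) :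
    tensPerm e (fun i => (A.obj.obj (c i)).X) ≫ A.op (s.act e rfl t) = A.op s := by
  induction s using opSet_ind with | h σ f =>
  rw [act_mk, op_mk, op_mk]
  refine Eq.trans ?_ (tensPerm_orderedProd e σ (Fin.equiv_iff_eq.1 ⟨e⟩).symm _)
  congr 2
  funext i
  rw [eqToHom_refl, Category.id_comp]

theorem PerpFunctor.op_unit (A : PerpFunctor P 𝒥) (t : C) :
    A.op (OpSet.unit t : OpSet P _ t) = (ρ_ (A.obj.obj t).X).hom := by
  rw [OpSet.unit, op_mk, orderedProd_one]
  refine (fold_singleton _ 0).trans ?_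
  rw [A.obj.map_id]
  exact Category.comp_id _

/-- On representatives this is `orderedProd_comp`, with functoriality giving the composite
morphisms. -/
theorem PerpFunctor.op_comp (A : PerpFunctor P 𝒥) {n : ℕ} {k : Fin n → ℕ} {a : Fin n → C}
    {b : ∀ i, Fin (k i) → C} {t : C} (p : OpSet P a t) (q : ∀ i, OpSet P (b i) (a i)) :
    tensMap _ (fun i => A.op (q i)) ≫ A.op p =
      tensFlatten (fun i j => (A.obj.obj (b i j)).X) ≫ A.op (p.comp q) := by
  induction p using opSet_ind with | h σ f =>
  obtain ⟨τ, g, rfl⟩ := exists_rep q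
  rw [comp_mk]
  simp only [op_mk]
  refine (orderedProd_comp (A := fun i => (A.obj.obj (a i)).X) σ _ τ _).trans ?_
  refine congrArg (tensFlatten _ ≫ ·) ?_
  refine congrArg (orderedProd (blockPerm σ τ)) (funext fun x => ?_)
  rw [concatHom, A.obj.map_comp]
  rfl

theorem PerpFunctor.op_star (A : PerpFunctor P 𝒥) {n : ℕ} {c : Fin n → C} {t : C}
    (s : OpSet P c t) :
    A.op s ≫ (A.obj.obj t).star =
      (tensMap _ (fun i => (A.obj.obj (c i)).star) ≫ 𝒥.tensJ _ _) ≫ 𝒥.J.map (A.op s.rev) := by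
  induction s using opSet_ind with | h σ f =>
  rw [rev_mk, op_mk, op_mk]
  exact orderedProd_star _ σ _ _ fun i => (A.obj.map (f i)).star_hom.symm

theorem PerpFunctor.op_naturality {A B : PerpFunctor P 𝒥} (φ : A ⟶ B) {n : ℕ} {c : Fin n → C}
    {t : C} (s : OpSet P c t) :
    A.op s ≫ (φ.hom.app t).hom.hom = tensMap _ (fun i => (φ.hom.app (c i)).hom.hom) ≫ B.op s := by
  induction s using opSet_ind with | h σ f =>
  rw [op_mk, op_mk, orderedProd, orderedProd, Category.assoc, fold_comp]
  obtain ⟨ψ, h1, h2⟩ := (isSymmetry_tensReorder (X := fun i => (A.obj.obj (c i)).X) _ _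
    (finRange_perm σ.symm)).exists_map (fun i => (φ.hom.app (c i)).hom.hom)
  rw [h1.unique (isSymmetry_tensReorder _ _ (finRange_perm σ.symm))] at h2
  rw [reassoc_of% h2, tensMap_fold]
  congr 2
  funext i
  exact congrArg (fun f => f.hom.hom) (φ.hom.naturality (f i))

theorem leftUnitor_inv_tensorHom {S Y Y' : M} (p : tensorUnit M ⟶ S) (r : Y ⟶ Y') :
    (λ_ Y).inv ≫ (p ⊗ₘ r) = r ≫ insertPoint p Y' := by
  rw [insertPoint, MonoidalCategory.tensorHom_def']
  simp

theorem insertPoint_copDescTensor {S : Type v} {Y Z : M} (g : S → (Y ⟶ Z)) (s : S) :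
    insertPoint (copι s) Y ≫ copDescTensor g = g s := by
  rw [insertPoint, Category.assoc, copι_descTensor, Iso.inv_hom_id_assoc]

variable (P 𝒥) in
/-- The `*`-algebra over the operad given by a `⊥`-commutative functor. -/
noncomputable def PerpFunctor.toStarAlgebra : PerpFunctor P 𝒥 ⥤ StarAlgebra (aqftOperad P 𝒥) where
  obj A :=
    { X := fun c => (A.obj.obj c).X
      act := fun c t => copDescTensor fun s : OpSet P c t => A.op s
      act_perm := fun e c t => (act_perm_iff _ _ _ _).2 fun s => by
        rw [insertPoint_copDescTensor, insertPoint_copDescTensor, op_perm]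
      act_unit := fun t => by
        refine (Category.assoc _ _ _).symm.trans ?_
        refine (congrArg (· ≫ _) (leftUnitor_inv_tensorHom _ _)).trans ?_
        refine (Category.assoc _ _ _).trans ?_
        refine (congrArg (_ ≫ ·) (insertPoint_copDescTensor _ (OpSet.unit t))).trans ?_
        rw [op_unit]
        exact Iso.inv_hom_id _
      act_comp := fun a b t => (act_comp_iff P _ _ _).2 fun p q => by
        simp only [insertPoint_copDescTensor]
        exact A.op_comp p q
      star := fun c => (A.obj.obj c).star
      star_star := fun c => (A.obj.obj c).star_star
      act_star := fun c t => (act_star_iff P 𝒥 c t _ _ _).2 fun s => by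
        rw [insertPoint_copDescTensor, insertPoint_copDescTensor, op_star] }
  map φ :=
    { hom := fun c => (φ.hom.app c).hom.hom
      act_hom := fun c t => insertPoint_ext fun s => by
        refine (Category.assoc _ _ _).symm.trans ?_
        refine (congrArg (· ≫ _) (insertPoint_copDescTensor _ s)).trans ?_
        refine (op_naturality φ s).trans ?_
        refine Eq.trans ?_ (Category.assoc _ _ _)
        refine Eq.trans ?_ (congrArg (· ≫ _) (insertPoint_whiskerLeft _ _)).symm
        refine Eq.trans ?_ (Category.assoc _ _ _).symm
        exact congrArg (_ ≫ ·) (insertPoint_copDescTensor _ s).symm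
      star_hom := fun c => (φ.hom.app c).star_hom }

end OfFunctor
end AQFT

namespace AQFT

/-! ### Lists as images of standard enumerations, and trailing units -/

section Reindexing
variable {M : Type u} [Category.{v} M] [MonoidalCategory M] {I : Type w} {I' I'' : Type*}

theorem eqToHom_cons {X : I → M} (a : I) {l l' : List I} (h : l = l') :
    (eqToHom (by rw [h]) : tens (a :: l) X ⟶ tens (a :: l') X) = X a ◁ eqToHom (by rw [h]) := by
  subst h; exact (MonoidalCategory.whiskerLeft_id _ _).symm

theorem tensMapIndex_comp (f : I → I') (g : I' → I'') (l : List I) (X : I'' → M) :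
    tensMapIndex f l (fun i => X (g i)) ≫ tensMapIndex g (l.map f) X =
      tensMapIndex (fun i => g (f i)) l X ≫ eqToHom (by rw [List.map_map]; rfl) := by
  induction l with
  | nil => rfl
  | cons a l ih =>
    refine (MonoidalCategory.whiskerLeft_comp _ _ _).symm.trans ?_
    rw [ih]
    refine (MonoidalCategory.whiskerLeft_comp _ _ _).trans ?_
    exact congrArg (_ ≫ ·) (eqToHom_cons (X := X) (g (f a))
      (by rw [List.map_map]; rfl : l.map (fun i => g (f i)) = (l.map f).map g)).symm

theorem tensMapIndex_id (l : List I) (X : I → M) :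
    tensMapIndex (fun i => i) l X = eqToHom (by rw [List.map_id']) := by
  induction l with
  | nil => rfl
  | cons a l ih =>
    exact (congrArg (X a ◁ ·) ih).trans (eqToHom_cons a (List.map_id' l).symm).symm

instance (f : I → I') (l : List I) (X : I' → M) : IsIso (tensMapIndex f l X) :=
  ⟨_, tensMapIndex_unmapIndex f l X, tensUnmapIndex_mapIndex f l X⟩

/-- Reduces statements about arbitrary lists to the index sets `Fin n` on which the operad acts. -/
theorem exists_map_finRange (L : List I) : ∃ (n : ℕ) (e : Fin n → I), L = (List.finRange n).map e :=
  ⟨L.length, L.get, by simp⟩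

/-- Both sides are symmetries between the same lists, hence equal by coherence. -/
theorem append_nil_eqToHom [SymmetricCategory M] {X : I → M} (l : List I) :
    (ρ_ (tens l X)).inv ≫ tensAppend l [] X = eqToHom (by rw [List.append_nil]) :=
  (isSymmetry_append_nil l).unique (isSymmetry_eqToHom (List.append_nil l).symm)

end Reindexing

section Unitors
variable {M : Type u} [Category.{v} M] [MonoidalCategory M]

theorem comp_rightUnitor_inv_comp {X Y Z : M} (f : X ⟶ Y) (g : Y ⊗ tensorUnit M ⟶ Z) :
    f ≫ (ρ_ Y).inv ≫ g = (ρ_ X).inv ≫ (f ⊗ₘ 𝟙 _) ≫ g := by simp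

theorem rightUnitor_inv_tensorHom_comp {X Y Z W : M} (f : X ⟶ Y) (g : Y ⊗ tensorUnit M ⟶ Z)
    (h : Z ⟶ W) : (ρ_ X).inv ≫ ((f ⊗ₘ 𝟙 _) ≫ g) ≫ h = f ≫ ((ρ_ Y).inv ≫ g) ≫ h := by simp

theorem tensorHom_comp_whiskerLeft_rightUnitor_inv_comp {X X' Y Y' Z : M} (f : X ⟶ X') (g : Y ⟶ Y')
    (h : X' ⊗ Y' ⊗ tensorUnit M ⟶ Z) :
    (f ⊗ₘ g) ≫ X' ◁ (ρ_ Y').inv ≫ h = X ◁ (ρ_ Y).inv ≫ (f ⊗ₘ g ⊗ₘ 𝟙 _) ≫ h := by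
  simp [MonoidalCategory.tensorHom_def]

theorem whiskerLeft_rightUnitor_inv_tensorHom_comp {X X' Y Y' Z W U : M} (f : X ⟶ X') (g : Y ⟶ Y')
    (h : Y' ⊗ tensorUnit M ⟶ Z) (w : X' ⊗ Z ⟶ W) (r : W ⟶ U) :
    X ◁ (ρ_ Y).inv ≫ ((f ⊗ₘ ((g ⊗ₘ 𝟙 _) ≫ h)) ≫ w) ≫ r =
      (f ⊗ₘ g) ≫ (𝟙 _ ⊗ₘ (ρ_ Y').inv ≫ h) ≫ w ≫ r := by
  simp [MonoidalCategory.tensorHom_def]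

end Unitors

/-! ### Operations of an algebra indexed by lists -/

section OfAlgebra
variable {C : Type v} [SmallCategory C] {P : Orthogonality C}
variable {M : Type u} [Category.{v} M] [MonoidalCategory M] [SymmetricCategory M] [MonoidalClosed M]
  [HasColimits M] {𝒥 : Involution M}

namespace StarAlgebra
variable (A : StarAlgebra (aqftOperad P 𝒥))

/-- The operation on an algebra given by an element of the set of operations. -/
noncomputable def op {n : ℕ} {c : Fin n → C} {t : C} (s : OpSet P c t) :
    tens (List.finRange n) (fun i => A.X (c i)) ⟶ A.X t :=
  insertPoint (copι s) _ ≫ A.act c t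

theorem op_perm {m n : ℕ} (e : Fin m ≃ Fin n) {c : Fin n → C} {t : C} (s : OpSet P c t) :
    tensPerm e (fun i => A.X (c i)) ≫ A.op (s.act e rfl t) = A.op s :=
  (act_perm_iff _ _ _ _).1 (A.act_perm e c t) s

theorem op_unit (t : C) : A.op (OpSet.unit t : OpSet P _ t) = (ρ_ (A.X t)).hom := by
  have h : (ρ_ (A.X t)).inv ≫ A.op (OpSet.unit t : OpSet P _ t) = 𝟙 _ := by
    refine Eq.trans ?_ (A.act_unit t)
    refine (Category.assoc _ _ _).symm.trans ?_
    refine Eq.trans ?_ (Category.assoc _ _ _)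
    exact congrArg (· ≫ _) (leftUnitor_inv_tensorHom _ _).symm
  exact ((Iso.inv_comp_eq _).1 h).trans (Category.comp_id _)

theorem op_comp {n : ℕ} {k : Fin n → ℕ} {a : Fin n → C} {b : ∀ i, Fin (k i) → C} {t : C}
    (p : OpSet P a t) (q : ∀ i, OpSet P (b i) (a i)) :
    tensMap _ (fun i => A.op (q i)) ≫ A.op p =
      tensFlatten (fun i j => A.X (b i j)) ≫ A.op (p.comp q) :=
  (act_comp_iff P _ _ _).1 (A.act_comp a b t) p q

theorem op_star {n : ℕ} {c : Fin n → C} {t : C} (s : OpSet P c t) :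
    A.op s ≫ A.star t = (tensMap _ (fun i => A.star (c i)) ≫ 𝒥.tensJ _ _) ≫ 𝒥.J.map (A.op s.rev) :=
  (act_star_iff P 𝒥 c t _ _ _).1 (A.act_star c t) s

theorem op_hom {A B : StarAlgebra (aqftOperad P 𝒥)} (φ : A ⟶ B) {n : ℕ} {c : Fin n → C} {t : C}
    (s : OpSet P c t) : A.op s ≫ φ.hom t = tensMap _ (fun i => φ.hom (c i)) ≫ B.op s := by
  refine (Category.assoc _ _ _).trans ?_
  refine (congrArg (_ ≫ ·) (StarAlgebra.Hom.act_hom φ c t)).trans ?_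
  refine (Category.assoc _ _ _).symm.trans ?_
  refine (congrArg (· ≫ B.act c t) (insertPoint_whiskerLeft _ _)).trans ?_
  exact Category.assoc _ _ _

/-- The operation multiplying the images under a family of morphisms, in the given order. -/
noncomputable def simpleOp {n : ℕ} {c : Fin n → C} {t : C} (g : ∀ i, c i ⟶ t) :
    tens (List.finRange n) (fun i => A.X (c i)) ⟶ A.X t :=
  A.op (.mk 1 g : OpSet P c t)

/-- The operation multiplying the images under a family of morphisms, in the order of a list. -/
noncomputable def listOp {I : Type w} {c : I → C} {t : C} (g : ∀ i, c i ⟶ t) (L : List I) :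
    tens L (fun i => A.X (c i)) ⟶ A.X t :=
  eqToHom (by simp) ≫ tensUnmapIndex L.get (List.finRange L.length) (fun i => A.X (c i)) ≫
    A.simpleOp fun i => g (L.get i)

variable {I : Type w} {I' : Type*} {c : I → C} {t : C} (g : ∀ i, c i ⟶ t)

theorem listOp_congr {L L' : List I} (h : L = L') :
    eqToHom (by rw [h]) ≫ A.listOp g L' = A.listOp g L := by
  subst h; exact Category.id_comp _

/-- Shows that `listOp` does not depend on the chosen enumeration of the list. -/
theorem mapIndex_listOp_finRange {n : ℕ} (e : Fin n → I) :
    tensMapIndex e (List.finRange n) (fun i => A.X (c i)) ≫ A.listOp g ((List.finRange n).map e) =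
      A.simpleOp fun i => g (e i) := by
  -- With the list as a variable, its length can replace `n` and its entries can replace `e`.
  suffices ∀ L (h : (List.finRange n).map e = L),
      tensMapIndex e (List.finRange n) (fun i => A.X (c i)) ≫ eqToHom (by rw [h]) ≫ A.listOp g L =
        A.simpleOp fun i => g (e i) by
    have := this _ rfl
    rwa [eqToHom_refl, Category.id_comp] at this
  intro L h
  obtain rfl : n = L.length := by rw [← h]; simp
  obtain rfl : e = L.get := by
    funext i
    have h1 : ((List.finRange L.length).map e)[i.val]? = some (e i) := by simp
    rw [h] at h1
    simpa using h1.symm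
  rw [listOp, eqToHom_trans_assoc, eqToHom_refl, Category.id_comp, ← Category.assoc,
    tensMapIndex_unmapIndex, Category.id_comp]

theorem listOp_finRange {n : ℕ} {c : Fin n → C} (g : ∀ i, c i ⟶ t) :
    A.listOp g (List.finRange n) = A.simpleOp g := by
  rw [← A.mapIndex_listOp_finRange g fun i => i, tensMapIndex_id, A.listOp_congr g]
  rw [List.map_id']

theorem mapIndex_listOp {c : I' → C} (g : ∀ i, c i ⟶ t) (e : I → I') (L : List I) :
    tensMapIndex e L (fun i => A.X (c i)) ≫ A.listOp g (L.map e) =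
      A.listOp (fun i => g (e i)) L := by
  obtain ⟨n, e', rfl⟩ := exists_map_finRange L
  rw [← cancel_epi (tensMapIndex e' (List.finRange n) fun i => A.X (c (e i))),
    A.mapIndex_listOp_finRange (fun i => g (e i)), ← Category.assoc,
    tensMapIndex_comp e' e (List.finRange n) fun i => A.X (c i), Category.assoc,
    A.listOp_congr g (by rw [List.map_map]; rfl), A.mapIndex_listOp_finRange]

/-- A composite of operations with trivial permutation again has trivial permutation, with inputs in
lexicographic order. -/
theorem simpleOp_comp {n : ℕ} {k : Fin n → ℕ} {a : Fin n → C} {b : ∀ i, Fin (k i) → C} {t : C}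
    (f : ∀ i, a i ⟶ t) (g : ∀ i j, b i j ⟶ a i) :
    tensMap _ (fun i => A.simpleOp (g i)) ≫ A.simpleOp f =
      tensSigma (List.finRange n) (fun i => List.finRange (k i)) (fun p => A.X (b p.1 p.2)) ≫
        A.listOp (c := fun p : (i : Fin n) × Fin (k i) => b p.1 p.2) (fun p => g p.1 p.2 ≫ f p.1)
          ((List.finRange n).sigma fun i => List.finRange (k i)) := by
  refine (A.op_comp _ _).trans ?_
  rw [comp_mk, tensFlatten, Category.assoc]
  refine congrArg (tensSigma _ _ _ ≫ ·) ?_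
  rw [Category.assoc, ← A.listOp_congr (c := fun p : (i : Fin n) × Fin (k i) => b p.1 p.2) _ (finRange_sigma k)]
  refine congrArg (eqToHom _ ≫ ·) ?_
  have h := A.mapIndex_listOp_finRange (c := fun p : (i : Fin n) × Fin (k i) => b p.1 p.2)
    (fun p => g p.1 p.2 ≫ f p.1) finSigmaFinEquiv.symm
  -- The block permutation built from identities preserves order, hence is the identity.
  have h' : (OpSet.mk (blockPerm 1 fun _ => 1) (concatHom fun i j => g i j ≫ f i) :
      OpSet P (concat b) t) = .mk 1 (fun x => g _ _ ≫ f (finSigmaFinEquiv.symm x).1) := by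
    refine mk_congr (fun x y h => ?_) fun x => rfl
    rw [blockPerm_lt] at h
    obtain ⟨p, rfl⟩ := finSigmaFinEquiv.surjective x
    obtain ⟨q, rfl⟩ := finSigmaFinEquiv.surjective y
    rw [Equiv.symm_apply_apply, Equiv.symm_apply_apply] at h
    exact (merge_lt p q).2 h
  rw [h']
  refine (congrArg (tensUnmapIndex finSigmaFinEquiv.symm (List.finRange _)
    (fun p : (i : Fin n) × Fin (k i) => A.X (b p.1 p.2)) ≫ ·) h.symm).trans ?_
  rw [← Category.assoc, tensUnmapIndex_mapIndex, Category.id_comp]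

theorem append_listOp_congr {L L' R R' : List I} (h : L = L') (h' : R = R') :
    ((eqToHom (by rw [h]) : tens L (fun i => A.X (c i)) ⟶ tens L' _) ⊗ₘ
      (eqToHom (by rw [h']) : tens R (fun i => A.X (c i)) ⟶ tens R' _)) ≫
      tensAppend L' R' _ ≫ A.listOp g (L' ++ R') = tensAppend L R _ ≫ A.listOp g (L ++ R) := by
  subst h h'; simp

theorem append_mapIndex_listOp {c : I' → C} (g : ∀ i, c i ⟶ t) (e : I → I') (L R : List I) :
    tensAppend L R _ ≫ A.listOp (fun i => g (e i)) (L ++ R) =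
      (tensMapIndex e L (fun i => A.X (c i)) ⊗ₘ tensMapIndex e R (fun i => A.X (c i))) ≫
        tensAppend (L.map e) (R.map e) _ ≫ A.listOp g (L.map e ++ R.map e) := by
  rw [← A.mapIndex_listOp g e, ← Category.assoc,
    tensAppend_mapIndex e L R fun i => A.X (c i), Category.assoc, Category.assoc,
    A.listOp_congr g List.map_append.symm]

/-- The multiplication on the values of an algebra. -/
noncomputable def mul (t : C) : A.X t ⊗ A.X t ⟶ A.X t :=
  A.X t ◁ (ρ_ (A.X t)).inv ≫ A.simpleOp fun _ : Fin 2 => 𝟙 t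

/-- The unit of the values of an algebra. -/
noncomputable def one (t : C) : tensorUnit M ⟶ A.X t :=
  A.simpleOp (c := Fin.elim0) fun i => i.elim0

/-- The functoriality of the values of an algebra. -/
noncomputable def map {c d : C} (f : c ⟶ d) : A.X c ⟶ A.X d :=
  (ρ_ (A.X c)).inv ≫ A.simpleOp fun _ : Fin 1 => f

theorem simpleOp_map {n : ℕ} {c : Fin n → C} {t d : C} (g : ∀ i, c i ⟶ t) (f : t ⟶ d) :
    A.simpleOp g ≫ A.map f = A.simpleOp fun i => g i ≫ f := by
  have h := A.simpleOp_comp (k := fun _ : Fin 1 => n) (b := fun _ i => c i) (fun _ => f)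
    fun _ i => g i
  have h1 : A.simpleOp g ≫ A.map f = (ρ_ _).inv ≫
      (A.simpleOp g ⊗ₘ 𝟙 (tensorUnit M)) ≫ A.simpleOp fun _ : Fin 1 => f :=
    comp_rightUnitor_inv_comp _ _
  refine h1.trans ((congrArg ((ρ_ _).inv ≫ ·) h).trans ?_)
  refine (rightUnitor_inv_tensorHom_comp (tensMapIndex (Sigma.mk (0 : Fin 1)) (List.finRange n)
    fun p : (_ : Fin 1) × Fin n => A.X (c p.2)) _ _).trans ?_
  refine (congrArg (_ ≫ · ≫ _) (append_nil_eqToHom _)).trans ?_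
  refine (congrArg (_ ≫ ·) (A.listOp_congr (c := fun p : (_ : Fin 1) × Fin n => c p.2) _
    (List.append_nil _).symm)).trans ?_
  exact (A.mapIndex_listOp (c := fun p : (_ : Fin 1) × Fin n => c p.2) (fun p => g p.2 ≫ f)
    (Sigma.mk 0) _).trans (A.listOp_finRange _)

theorem listOp_map {d : C} (f : t ⟶ d) (L : List I) :
    A.listOp g L ≫ A.map f = A.listOp (fun i => g i ≫ f) L := by
  obtain ⟨n, e, rfl⟩ := exists_map_finRange L
  rw [← cancel_epi (tensMapIndex e (List.finRange n) fun i => A.X (c i)),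
    A.mapIndex_listOp_finRange (fun i => g i ≫ f), ← Category.assoc, A.mapIndex_listOp_finRange g,
    simpleOp_map]

/-- Operadic composition of the binary product with two operations; unitors remove the trailing unit
objects. -/
theorem simpleOp_mul {k : Fin 2 → ℕ} {c : ∀ i, Fin (k i) → C} {t : C} (g : ∀ i j, c i j ⟶ t) :
    (A.simpleOp (g 0) ⊗ₘ A.simpleOp (g 1)) ≫ A.mul t =
      (tensMapIndex (Sigma.mk 0) (List.finRange (k 0))
          (fun p : (i : Fin 2) × Fin (k i) => A.X (c p.1 p.2)) ⊗ₘ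
        tensMapIndex (Sigma.mk 1) (List.finRange (k 1))
          (fun p : (i : Fin 2) × Fin (k i) => A.X (c p.1 p.2))) ≫
        tensAppend _ _ (fun p : (i : Fin 2) × Fin (k i) => A.X (c p.1 p.2)) ≫ A.listOp (c := fun p : (i : Fin 2) × Fin (k i) => c p.1 p.2)
          (fun p => g p.1 p.2)
          ((List.finRange (k 0)).map (Sigma.mk 0) ++ (List.finRange (k 1)).map (Sigma.mk 1)) := by
  have h := A.simpleOp_comp (fun _ : Fin 2 => 𝟙 t) g
  simp only [Category.comp_id] at h
  refine (tensorHom_comp_whiskerLeft_rightUnitor_inv_comp _ _ _).trans ?_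
  refine (congrArg (_ ≫ ·) h).trans ?_
  refine (whiskerLeft_rightUnitor_inv_tensorHom_comp (tensMapIndex (Sigma.mk (0 : Fin 2)) (List.finRange (k 0))
    fun p : (i : Fin 2) × Fin (k i) => A.X (c p.1 p.2)) (tensMapIndex (Sigma.mk (1 : Fin 2)) (List.finRange (k 1))
    fun p : (i : Fin 2) × Fin (k i) => A.X (c p.1 p.2)) _ _ _).trans ?_
  refine congrArg (_ ≫ ·) ?_
  refine Eq.trans ?_ (A.append_listOp_congr (c := fun p : (i : Fin 2) × Fin (k i) => c p.1 p.2)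
    (fun p => g p.1 p.2) rfl (List.append_nil ((List.finRange (k 1)).map (Sigma.mk 1))).symm)
  rw [eqToHom_refl]
  exact congrArg (fun x => (𝟙 _ ⊗ₘ x) ≫ _) (append_nil_eqToHom _)

theorem append_listOp_fin_two (L : Fin 2 → List I) :
    (A.listOp g (L 0) ⊗ₘ A.listOp g (L 1)) ≫ A.mul t =
      tensAppend (L 0) (L 1) _ ≫ A.listOp g (L 0 ++ L 1) := by
  choose k e h using fun i => exists_map_finRange (L i)
  obtain rfl : L = fun i => (List.finRange (k i)).map (e i) := funext h
  dsimp only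
  rw [← cancel_epi (tensMapIndex (e 0) (List.finRange (k 0)) (fun i => A.X (c i)) ⊗ₘ
    tensMapIndex (e 1) (List.finRange (k 1)) (fun i => A.X (c i)))]
  rw [tensorHom_comp_tensorHom_assoc, mapIndex_listOp_finRange, mapIndex_listOp_finRange,
    A.simpleOp_mul fun i j => g (e i j)]
  refine (congrArg (_ ≫ ·) (A.append_mapIndex_listOp g (fun p : (i : Fin 2) × Fin (k i) => e p.1 p.2)
    ((List.finRange (k 0)).map (Sigma.mk 0)) ((List.finRange (k 1)).map (Sigma.mk 1)))).trans ?_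
  rw [tensorHom_comp_tensorHom_assoc]
  refine (congrArg (· ≫ _) (congrArg₂ (· ⊗ₘ ·)
    (tensMapIndex_comp (Sigma.mk 0) (fun p : (i : Fin 2) × Fin (k i) => e p.1 p.2) _ fun i => A.X (c i))
    (tensMapIndex_comp (Sigma.mk 1) (fun p : (i : Fin 2) × Fin (k i) => e p.1 p.2) _ fun i => A.X (c i)))).trans ?_
  rw [← tensorHom_comp_tensorHom_assoc]
  exact congrArg (_ ≫ ·) (A.append_listOp_congr g (by rw [List.map_map]; rfl)
    (by rw [List.map_map]; rfl))

/-- The multiplication concatenates. Associativity, the left unit law and the recursion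
`listOp_cons` are instances. -/
theorem append_listOp (L R : List I) :
    (A.listOp g L ⊗ₘ A.listOp g R) ≫ A.mul t = tensAppend L R _ ≫ A.listOp g (L ++ R) :=
  A.append_listOp_fin_two g ![L, R]

end StarAlgebra

end OfAlgebra
end AQFT

namespace AQFT

/-! ### Removal of trailing units in words with few factors -/

section OneTwoFactors
variable {M : Type u} [Category.{v} M] [MonoidalCategory M]

theorem rightUnitor_tensorHom_rightUnitor_comp {X Y Z : M} (f : X ⟶ Z) (k : tensorUnit M ⟶ Z)
    (m : Z ⊗ Z ⟶ Z) {T : M} (h : T ⟶ Z) (r : X ⊗ T ⟶ Z)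
    (hr : ((ρ_ X).hom ≫ f ⊗ₘ h) ≫ m = ((α_ X (tensorUnit M) T).hom ≫ X ◁ (λ_ T).hom) ≫ r) :
    r = (f ⊗ₘ h) ≫ m := by
  rw [triangle, ← whiskerRight_comp_tensorHom, Category.assoc] at hr
  exact ((cancel_epi _).1 hr).symm

theorem one_mul_of_append {X : M} (e : tensorUnit M ⟶ X) (m : X ⊗ X ⟶ X)
    (h : (e ⊗ₘ (ρ_ X).hom) ≫ m = (λ_ (X ⊗ tensorUnit M)).hom ≫ (ρ_ X).hom) :
    e ▷ X ≫ m = (λ_ X).hom := by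
  rw [← cancel_epi (tensorUnit M ◁ (ρ_ X).hom), leftUnitor_naturality, ← h,
    MonoidalCategory.tensorHom_def', Category.assoc]

theorem mul_assoc_of_append {X : M} (m : X ⊗ X ⟶ X)
    (h : ((X ◁ (ρ_ X).hom ≫ m) ⊗ₘ (ρ_ X).hom) ≫ m =
      ((α_ X (X ⊗ tensorUnit M) (X ⊗ tensorUnit M)).hom ≫
        X ◁ ((α_ X (tensorUnit M) (X ⊗ tensorUnit M)).hom ≫ X ◁ (λ_ (X ⊗ tensorUnit M)).hom)) ≫
        X ◁ (X ◁ (ρ_ X).hom ≫ m) ≫ m) :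
    m ▷ X ≫ m = (α_ X X X).hom ≫ X ◁ m ≫ m := by
  rw [← cancel_epi (X ◁ (ρ_ X).hom ⊗ₘ (ρ_ X).hom)]
  rw [tensorHom_comp_whiskerRight_assoc, h, triangle, ← id_tensorHom X (ρ_ X).hom,
    associator_naturality_assoc, id_tensorHom, id_tensorHom, MonoidalCategory.tensorHom_def]
  simp only [MonoidalCategory.whiskerLeft_comp, Category.assoc]

theorem whiskerLeft_rightUnitor_inv_tensorHom {X Y Z W U : M} (f : X ⟶ Z) (g : Y ⟶ W)
    (h : Z ⊗ W ⟶ U) :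
    X ◁ (ρ_ Y).inv ≫ (f ⊗ₘ (ρ_ Y).hom ≫ g) ≫ h = (f ⊗ₘ g) ≫ h := by
  rw [whiskerLeft_comp_tensorHom_assoc, Iso.inv_hom_id_assoc]

end OneTwoFactors

/-! ### Monoid structure, functoriality and star on the values of an algebra -/

section OfAlgebra
variable {C : Type v} [SmallCategory C] {P : Orthogonality C}
variable {M : Type u} [Category.{v} M] [MonoidalCategory M] [SymmetricCategory M] [MonoidalClosed M]
  [HasColimits M] {𝒥 : Involution M}

namespace StarAlgebra
variable (A : StarAlgebra (aqftOperad P 𝒥))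

variable {I : Type w} {I' : Type*} {c : I → C} {t : C} (g : ∀ i, c i ⟶ t)

theorem simpleOp_zero {c : Fin 0 → C} (g : ∀ i, c i ⟶ t) : A.simpleOp g = A.one t := by
  obtain rfl : c = Fin.elim0 := funext fun i => i.elim0
  obtain rfl : g = fun i => i.elim0 := funext fun i => i.elim0
  rfl

theorem listOp_nil : A.listOp g [] = A.one t := by
  refine Eq.trans ?_ (A.simpleOp_zero fun i : Fin 0 => g i.elim0)
  exact (Category.id_comp _).symm.trans (A.mapIndex_listOp_finRange g fun i : Fin 0 => i.elim0)

theorem listOp_singleton (i : I) : A.listOp g [i] = (ρ_ (A.X (c i))).hom ≫ A.map (g i) := by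
  have h := A.mapIndex_listOp_finRange g fun _ : Fin 1 => i
  replace h : A.X (c i) ◁ 𝟙 _ ≫ A.listOp g [i] = A.simpleOp fun _ : Fin 1 => g i := h
  rw [MonoidalCategory.whiskerLeft_id] at h
  refine (Category.id_comp _).symm.trans (h.trans ?_)
  exact (Iso.hom_inv_id_assoc (ρ_ (A.X (c i))) _).symm

/-- Concatenation with a one-element list, after cancelling the trailing unit of that list. -/
theorem listOp_cons (i : I) (L : List I) :
    A.listOp g (i :: L) = (A.map (g i) ⊗ₘ A.listOp g L) ≫ A.mul t := by
  have h := A.append_listOp g [i] L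
  rw [listOp_singleton] at h
  exact rightUnitor_tensorHom_rightUnitor_comp (Y := A.X t) _ (A.one t) _ _ _ h

theorem map_id : A.map (𝟙 t) = 𝟙 (A.X t) := by
  refine (congrArg (_ ≫ ·) (A.op_unit t)).trans ?_
  exact Iso.inv_hom_id _

theorem map_comp {a b d : C} (f : a ⟶ b) (h : b ⟶ d) : A.map (f ≫ h) = A.map f ≫ A.map h := by
  refine Eq.trans ?_ (Category.assoc _ _ _).symm
  exact congrArg (_ ≫ ·) (A.simpleOp_map (fun _ : Fin 1 => f) h).symm

theorem listOp_id_singleton :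
    A.listOp (c := fun _ : Unit => t) (fun _ => 𝟙 t) [()] = (ρ_ (A.X t)).hom := by
  rw [listOp_singleton, map_id]
  exact Category.comp_id _

theorem one_mul : A.one t ▷ A.X t ≫ A.mul t = (λ_ (A.X t)).hom := by
  have h := A.append_listOp (c := fun _ : Unit => t) (fun _ => 𝟙 t) [] [()]
  rw [listOp_nil, listOp_id_singleton] at h
  exact one_mul_of_append _ _ (h.trans (congrArg (_ ≫ ·) A.listOp_id_singleton))

theorem mul_one : A.X t ◁ A.one t ≫ A.mul t = (ρ_ (A.X t)).hom := by
  have h := A.listOp_cons (c := fun _ : Unit => t) (fun _ => 𝟙 t) () []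
  rw [listOp_nil, listOp_id_singleton, map_id] at h
  rw [← id_tensorHom]
  exact h.symm

theorem listOp_id_pair : A.listOp (c := fun _ : Unit => t) (fun _ => 𝟙 t) [(), ()] =
    A.X t ◁ (ρ_ (A.X t)).hom ≫ A.mul t := by
  rw [listOp_cons, listOp_id_singleton, map_id]
  exact congrArg (· ≫ A.mul t) (id_tensorHom _ _)

/-- The ternary product is computed in two ways, by appending `[()]` to `[(), ()]` and by
`listOp_cons`. Lists over `Unit` only count factors. -/
theorem mul_assoc : A.mul t ▷ A.X t ≫ A.mul t =
    (α_ (A.X t) (A.X t) (A.X t)).hom ≫ A.X t ◁ A.mul t ≫ A.mul t := by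
  have h := A.append_listOp (c := fun _ : Unit => t) (fun _ => 𝟙 t) [(), ()] [()]
  rw [listOp_id_pair, listOp_id_singleton] at h
  refine mul_assoc_of_append _ (h.trans (congrArg (_ ≫ ·) ?_))
  refine (A.listOp_cons _ () [(), ()]).trans ?_
  rw [listOp_id_pair, map_id]
  exact congrArg (· ≫ A.mul t) (id_tensorHom _ _)

/-- The monoid structure on the values of an algebra. -/
noncomputable instance monObj (t : C) : MonObj (A.X t) where
  one := A.one t
  mul := A.mul t
  one_mul := A.one_mul
  mul_one := A.mul_one
  mul_assoc := A.mul_assoc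

theorem listOp_eq_fold (L : List I) : A.listOp g L = fold (fun i => A.map (g i)) L := by
  induction L with
  | nil => exact A.listOp_nil g
  | cons i L ih =>
    rw [listOp_cons, ih]
    rfl

theorem op_mk_one {n : ℕ} {c : Fin n → C} (g : ∀ i, c i ⟶ t) :
    A.op (.mk 1 g : OpSet P c t) = orderedProd 1 fun i => A.map (g i) := by
  rw [orderedProd_one, ← listOp_eq_fold, listOp_finRange, simpleOp]

/-- Equivariance under `σ⁻¹` reduces `[σ, g]` to the trivial permutation, where the operation is an
iterated product. Hence the action is determined by the functor extracted from it. -/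
theorem op_mk {n : ℕ} {c : Fin n → C} (σ : Equiv.Perm (Fin n)) (g : ∀ i, c i ⟶ t) :
    A.op (.mk σ g : OpSet P c t) = orderedProd σ fun i => A.map (g i) := by
  have hσ : (Equiv.trans σ.symm σ).trans (finCongr (rfl : n = n)) = 1 := by
    ext i; simp
  rw [← A.op_perm σ.symm, ← tensPerm_orderedProd σ.symm σ rfl, act_mk, hσ, op_mk_one]
  simp only [eqToHom_refl, Category.id_comp]

theorem op_one (g : ∀ i : Fin 0, (Fin.elim0 i : C) ⟶ t) (σ) :
    A.op (.mk σ g : OpSet P Fin.elim0 t) = MonObj.one := by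
  rw [Subsingleton.elim σ 1]
  exact A.simpleOp_zero g

theorem rightUnitor_inv_op (c : Fin 1 → C) (g : ∀ i, c i ⟶ t) (σ) :
    (ρ_ (A.X (c 0))).inv ≫ A.op (.mk σ g : OpSet P c t) = A.map (g 0) := by
  rw [Subsingleton.elim σ 1, op_mk_one, orderedProd_one]
  refine (congrArg ((ρ_ (A.X (c 0))).inv ≫ ·) (fold_singleton _ 0)).trans ?_
  exact Iso.inv_hom_id_assoc _ _

theorem rightUnitor_inv_op_pair (c : Fin 2 → C) (g : ∀ i, c i ⟶ t) :
    A.X (c 0) ◁ (ρ_ (A.X (c 1))).inv ≫ A.op (.mk 1 g : OpSet P c t) =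
      (A.map (g 0) ⊗ₘ A.map (g 1)) ≫ MonObj.mul := by
  rw [op_mk_one, orderedProd_one]
  refine (congrArg (fun x => A.X (c 0) ◁ (ρ_ (A.X (c 1))).inv ≫ (A.map (g 0) ⊗ₘ x) ≫ MonObj.mul)
    (fold_singleton (fun i => A.map (g i)) 1)).trans ?_
  exact whiskerLeft_rightUnitor_inv_tensorHom _ _ _

theorem rightUnitor_inv_op_swap (c : Fin 2 → C) (g : ∀ i, c i ⟶ t) :
    A.X (c 0) ◁ (ρ_ (A.X (c 1))).inv ≫ A.op (.mk (Equiv.swap 0 1) g : OpSet P c t) =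
      (A.map (g 0) ⊗ₘ A.map (g 1)) ≫ (β_ _ _).hom ≫ MonObj.mul := by
  obtain ⟨φ, h1, h2⟩ := exists_isSymmetry_rotate (X := fun i => A.X (c i)) (fun i => A.map (g i))
    (a := 0) [1] (by decide)
  rw [op_mk, ← IsSymmetry.comp_fold (L := [1, 0]) h1 (by decide)]
  refine (congrArg (_ ≫ ·) h2).trans ?_
  rw [fold_singleton]
  exact whiskerLeft_rightUnitor_inv_tensorHom _ _ _

theorem perpCommutative {c : Fin 2 → C} (g : ∀ i, c i ⟶ t) (h : P.rel (g 0) (g 1)) :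
    (A.map (g 0) ⊗ₘ A.map (g 1)) ≫ MonObj.mul =
      (A.map (g 0) ⊗ₘ A.map (g 1)) ≫ (β_ (A.X t) (A.X t)).hom ≫ MonObj.mul := by
  rw [← rightUnitor_inv_op_pair, ← rightUnitor_inv_op_swap]
  refine congrArg (fun s : OpSet P c t => _ ≫ A.op s) ?_
  -- Orthogonality identifies the two orderings already in the set of operations.
  exact Quot.sound (Step.swap 1 g 0 1 rfl h)

instance map_isMonHom {s : C} (f : s ⟶ t) : IsMonHom (A.map f) where
  one_hom := by
    refine (congrArg (· ≫ _) (A.listOp_nil (c := fun _ : Unit => s) fun _ => 𝟙 s).symm).trans ?_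
    exact (A.listOp_map _ f []).trans (A.listOp_nil _)
  mul_hom := by
    refine (Category.assoc _ _ _).trans ?_
    refine (congrArg (_ ≫ ·) (A.simpleOp_map (fun _ : Fin 2 => 𝟙 s) f)).trans ?_
    refine (A.rightUnitor_inv_op_pair (fun _ => s) _).trans ?_
    rw [Category.id_comp]

section Star
open Functor.LaxMonoidal

/-- The trailing `ε` contributed by the empty word cancels by right unitality of `J`. -/
theorem rightUnitor_inv_tensJ {X X' Y : M} (s : X ⟶ 𝒥.J.obj X') (w : X' ⊗ tensorUnit M ⟶ Y) :
    (ρ_ X).inv ≫ ((s ⊗ₘ 𝟙 (tensorUnit M)) ≫ 𝒥.J.obj X' ◁ ε 𝒥.J ≫ μ 𝒥.J X' (tensorUnit M)) ≫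
      𝒥.J.map w = s ≫ 𝒥.J.map ((ρ_ X').inv ≫ w) := by
  rw [tensorHom_id, Category.assoc, ← rightUnitor_inv_naturality_assoc, Functor.map_comp,
    ← Functor.LaxMonoidal.right_unitality_inv]
  simp only [Category.assoc]

theorem whiskerLeft_rightUnitor_inv_tensJ {X X' Z Z' Y : M} (s : X ⟶ 𝒥.J.obj X')
    (r : Z ⟶ 𝒥.J.obj Z') (w : X' ⊗ Z' ⊗ tensorUnit M ⟶ Y) :
    X ◁ (ρ_ Z).inv ≫ ((s ⊗ₘ (r ⊗ₘ 𝟙 (tensorUnit M))) ≫ 𝒥.J.obj X' ◁ (𝒥.J.obj Z' ◁ ε 𝒥.J ≫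
      μ 𝒥.J Z' (tensorUnit M)) ≫ μ 𝒥.J X' (Z' ⊗ tensorUnit M)) ≫ 𝒥.J.map w =
    (s ⊗ₘ r) ≫ μ 𝒥.J X' Z' ≫ 𝒥.J.map (X' ◁ (ρ_ Z').inv ≫ w) := by
  have h := rightUnitor_inv_tensJ r (𝟙 _)
  rw [CategoryTheory.Functor.map_id, Category.comp_id, Category.comp_id] at h
  rw [Category.assoc, Category.assoc, tensorHom_comp_whiskerLeft_assoc,
    whiskerLeft_comp_tensorHom_assoc, h, Functor.map_comp 𝒥.J, ← μ_natural_right_assoc,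
    tensorHom_comp_whiskerLeft_assoc]

theorem map_star {s : C} (f : s ⟶ t) : A.star s ≫ 𝒥.J.map (A.map f) = A.map f ≫ A.star t := by
  have h : A.map f ≫ A.star t = (ρ_ (A.X s)).inv ≫ ((A.star s ⊗ₘ 𝟙 (tensorUnit M)) ≫
      𝒥.J.obj (A.X s) ◁ ε 𝒥.J ≫ μ 𝒥.J (A.X s) (tensorUnit M)) ≫
        𝒥.J.map (A.op (.mk (Fin.revPerm * 1) fun _ => f : OpSet P (fun _ : Fin 1 => s) t)) :=
    (Category.assoc _ _ _).trans
      (congrArg (_ ≫ ·) (A.op_star (.mk 1 fun _ => f : OpSet P (fun _ : Fin 1 => s) t)))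
  refine Eq.trans ?_ (h.trans (rightUnitor_inv_tensJ _ _)).symm
  exact congrArg (fun x => A.star s ≫ 𝒥.J.map x)
    (A.rightUnitor_inv_op (fun _ => s) (fun _ => f) (Fin.revPerm * 1)).symm

theorem one_star : MonObj.one ≫ A.star t = ε 𝒥.J ≫ 𝒥.J.map MonObj.one := by
  rw [← A.op_one (fun i => i.elim0) 1]
  refine (A.op_star (.mk 1 fun i => i.elim0 : OpSet P Fin.elim0 t)).trans ?_
  rw [rev_mk, A.op_one]
  exact congrArg (· ≫ _) (Category.id_comp _)

/-- The star law for the binary operation `[1, (id, id)]`; reversal of two places is the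
transposition, which gives the opposite multiplication. -/
theorem mul_star : MonObj.mul ≫ A.star t =
    (A.star t ⊗ₘ A.star t) ≫ μ 𝒥.J (A.X t) (A.X t) ≫
      𝒥.J.map ((β_ (A.X t) (A.X t)).hom ≫ MonObj.mul) := by
  have h2 := A.rightUnitor_inv_op_swap (fun _ => t) fun _ => 𝟙 t
  rw [map_id, id_tensorHom_id, Category.id_comp] at h2
  rw [← h2]
  have h3 : (Fin.revPerm * 1 : Equiv.Perm (Fin 2)) = Equiv.swap 0 1 := by decide
  have h4 := A.op_star (.mk 1 fun _ => 𝟙 t : OpSet P (fun _ : Fin 2 => t) t)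
  rw [rev_mk, h3] at h4
  refine (Category.assoc _ _ _).trans ((congrArg (_ ≫ ·) h4).trans ?_)
  exact whiskerLeft_rightUnitor_inv_tensJ _ _ _

end Star

end StarAlgebra

end OfAlgebra
end AQFT

namespace AQFT

/-! ### Equality of functors and isomorphisms of categories -/

section Isomorphisms

/-- Morphisms are compared after a faithful functor. For the forgetful functors used below, the two
composites agree definitionally, so only objects need an argument. -/
theorem functor_ext_of_faithful {A : Type*} [Category A] {B : Type*} [Category B] {D : Type*}
    [Category D] {F F' : A ⥤ B} (U : B ⥤ D) [U.Faithful] (h : ∀ a, F.obj a = F'.obj a)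
    (hU : F ⋙ U = F' ⋙ U) : F = F' :=
  CategoryTheory.Functor.ext h fun X Y f => U.map_injective (by
    have := Functor.congr_hom hU f
    simpa [eqToHom_map] using this)

theorem isIsoOfCategories_comp {A : Type*} [Category A] {B : Type*} [Category B] {D : Type*}
    [Category D] {F : A ⥤ B} {F' : B ⥤ D} (h : IsIsoOfCategories F) (h' : IsIsoOfCategories F') :
    IsIsoOfCategories (F ⋙ F') := by
  obtain ⟨G, h1, h2⟩ := h
  obtain ⟨G', h3, h4⟩ := h'
  refine ⟨G' ⋙ G, ?_, ?_⟩
  · change F ⋙ (F' ⋙ G') ⋙ G = _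
    rw [h3]; exact h1
  · change G' ⋙ (G ⋙ F) ⋙ F' = _
    rw [h2]; exact h4

theorem isIsoOfCategories_of_fullyFaithful {A : Type*} [Category A] {B : Type*} [Category B]
    (F : A ⥤ B) [F.Full] [F.Faithful] (g : B → A) (h1 : ∀ a, g (F.obj a) = a)
    (h2 : ∀ b, F.obj (g b) = b) : IsIsoOfCategories F := by
  let G : B ⥤ A :=
    { obj := g
      map := fun {X Y} f => F.preimage (eqToHom (h2 X) ≫ f ≫ eqToHom (h2 Y).symm)
      map_id := fun X => F.map_injective (by simp)
      map_comp := fun f f' => F.map_injective (by simp) }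
  refine ⟨G, CategoryTheory.Functor.ext h1 fun X Y f => F.map_injective ?_,
    CategoryTheory.Functor.ext h2 fun X Y f => ?_⟩
  · simp [G, eqToHom_map]
  · simp [G]

end Isomorphisms

/-! ### Equality of bundled structures and faithfulness of forgetful functors -/

section Equalities
variable {M : Type u} [Category.{v} M] [MonoidalCategory M] [SymmetricCategory M]

theorem StarAlgebra.eq_of_heq {𝔠 : Type w} {𝒥 : Involution M} {O : ColoredStarOperad 𝔠 𝒥}
    {A B : StarAlgebra O} (hX : A.X = B.X) (ha : HEq @A.act @B.act) (hs : HEq A.star B.star) :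
    A = B := by
  obtain ⟨⟨X, act, _, _, _⟩, star, _, _⟩ := A
  obtain ⟨⟨X', act', _, _, _⟩, star', _, _⟩ := B
  dsimp only at hX ha hs
  subst hX
  obtain rfl := _root_.eq_of_heq ha
  obtain rfl := _root_.eq_of_heq hs
  rfl

theorem RevStarMon.eq_of_heq {𝒥 : Involution M} {A B : RevStarMon 𝒥} (hX : A.X = B.X)
    (hm : HEq A.mon B.mon) (hs : HEq A.star B.star) : A = B := by
  obtain ⟨⟨X⟩, star, _, _, _⟩ := A
  obtain ⟨⟨X'⟩, star', _, _, _⟩ := B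
  dsimp only at hX hm hs
  subst hX
  obtain rfl := _root_.eq_of_heq hm
  obtain rfl := _root_.eq_of_heq hs
  rfl

instance {𝔠 : Type w} {𝒥 : Involution M} (O : ColoredStarOperad 𝔠 𝒥) :
    (StarAlgebra.forget O).Faithful where
  map_injective {A B f g} h := StarAlgebra.Hom.ext (funext fun t =>
    congrArg StarObj.Hom.hom (congrFun h t))

instance (𝒥 : Involution M) : (RevStarMon.forget 𝒥).Faithful where
  map_injective {A B f g} h := RevStarMon.Hom.ext (Mon.Hom.ext (congrArg StarObj.Hom.hom h))

instance {C : Type w} [Category.{v} C] (P : Orthogonality C) (𝒥 : Involution M) :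
    (PerpFunctor.forget P 𝒥).Faithful where
  map_injective {A B f g} h := ObjectProperty.hom_ext _ (NatTrans.ext (funext fun c =>
    (RevStarMon.forget 𝒥).map_injective (congrFun h c)))

end Equalities

/-! ### Algebras and `⊥`-commutative functors are isomorphic categories -/

section AlgebrasAndFunctors
variable {C : Type v} [SmallCategory C] {P : Orthogonality C}
variable {M : Type u} [Category.{v} M] [MonoidalCategory M] [SymmetricCategory M] [MonoidalClosed M]
  [HasColimits M] {𝒥 : Involution M}

namespace StarAlgebra

theorem map_hom {A B : StarAlgebra (aqftOperad P 𝒥)} (φ : A ⟶ B) {s t : C} (f : s ⟶ t) :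
    A.map f ≫ φ.hom t = φ.hom s ≫ B.map f := by
  refine (Category.assoc _ _ _).trans ?_
  refine (congrArg (_ ≫ ·) (op_hom φ (.mk 1 fun _ => f : OpSet P (fun _ : Fin 1 => s) t))).trans ?_
  exact (comp_rightUnitor_inv_comp _ _).symm

theorem one_hom {A B : StarAlgebra (aqftOperad P 𝒥)} (φ : A ⟶ B) (t : C) :
    MonObj.one ≫ φ.hom t = MonObj.one := by
  rw [← A.op_one (fun i => i.elim0) 1, ← B.op_one (fun i => i.elim0) 1]
  exact (op_hom φ (.mk 1 fun i => i.elim0 : OpSet P Fin.elim0 t)).trans (Category.id_comp _)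

theorem mul_hom {A B : StarAlgebra (aqftOperad P 𝒥)} (φ : A ⟶ B) (t : C) :
    MonObj.mul ≫ φ.hom t = (φ.hom t ⊗ₘ φ.hom t) ≫ MonObj.mul := by
  refine (Category.assoc _ _ _).trans ?_
  refine (congrArg (_ ≫ ·)
    (op_hom φ (.mk 1 fun _ => 𝟙 t : OpSet P (fun _ : Fin 2 => t) t))).trans ?_
  exact (tensorHom_comp_whiskerLeft_rightUnitor_inv_comp _ _ _).symm

/-- The order-reversing `*`-monoid given by the value of an algebra at an object. -/
noncomputable def revStarMon (A : StarAlgebra (aqftOperad P 𝒥)) (t : C) : RevStarMon 𝒥 where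
  X := A.X t
  star := A.star t
  star_star := A.star_star t
  mul_star := A.mul_star
  one_star := A.one_star

variable (P 𝒥) in
/-- The `⊥`-commutative functor given by a `*`-algebra over the operad. -/
noncomputable def toPerpFunctor : StarAlgebra (aqftOperad P 𝒥) ⥤ PerpFunctor P 𝒥 where
  obj A :=
    { obj :=
        { obj := A.revStarMon
          map := fun {s t} f => RevStarMon.Hom.mk (Mon.Hom.mk (A.map f) (isMonHom_hom := A.map_isMonHom f))
            (A.map_star f)
          map_id := fun t => RevStarMon.Hom.ext (Mon.Hom.ext A.map_id)
          map_comp := fun f g => RevStarMon.Hom.ext (Mon.Hom.ext (A.map_comp f g)) }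
      property := fun c₁ c₂ c f₁ f₂ h => A.perpCommutative (c := ![c₁, c₂])
        (fun | 0 => f₁ | 1 => f₂) h }
  map {A B} φ := ObjectProperty.homMk
    { app := fun t => RevStarMon.Hom.mk (Mon.Hom.mk' (φ.hom t) (one_hom φ t) (mul_hom φ t))
        (φ.star_hom t)
      naturality := fun s t f => RevStarMon.Hom.ext (Mon.Hom.ext (map_hom φ f)) }
  map_id A := rfl
  map_comp f g := rfl

end StarAlgebra

namespace PerpFunctor

theorem toStarAlgebra_op (A : PerpFunctor P 𝒥) {n : ℕ} {c : Fin n → C} {t : C} (s : OpSet P c t) :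
    ((toStarAlgebra P 𝒥).obj A).op s = A.op s :=
  insertPoint_copDescTensor _ s

theorem toStarAlgebra_map (A : PerpFunctor P 𝒥) {s t : C} (f : s ⟶ t) :
    ((toStarAlgebra P 𝒥).obj A).map f = (A.obj.map f).hom.hom := by
  refine (congrArg ((ρ_ (A.obj.obj s).X).inv ≫ ·) (A.toStarAlgebra_op _)).trans ?_
  rw [op_mk, orderedProd_one]
  refine (congrArg ((ρ_ (A.obj.obj s).X).inv ≫ ·) (fold_singleton _ 0)).trans ?_
  exact Iso.inv_hom_id_assoc _ _

theorem toStarAlgebra_mul (A : PerpFunctor P 𝒥) (t : C) :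
    ((toStarAlgebra P 𝒥).obj A).mul t = MonObj.mul (X := (A.obj.obj t).X) := by
  refine (congrArg ((A.obj.obj t).X ◁ (ρ_ (A.obj.obj t).X).inv ≫ ·)
    (A.toStarAlgebra_op _)).trans ?_
  rw [op_mk, orderedProd_one, A.obj.map_id]
  refine (congrArg (fun x => (A.obj.obj t).X ◁ (ρ_ (A.obj.obj t).X).inv ≫
    (𝟙 (A.obj.obj t).X ⊗ₘ x) ≫ MonObj.mul)
    (fold_singleton (fun _ : Fin 2 => 𝟙 (A.obj.obj t).X) 1)).trans ?_
  refine (whiskerLeft_rightUnitor_inv_tensorHom _ _ _).trans ?_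
  rw [id_tensorHom_id, Category.id_comp]

theorem toPerpFunctor_toStarAlgebra (A : PerpFunctor P 𝒥) :
    (StarAlgebra.toPerpFunctor P 𝒥).obj ((toStarAlgebra P 𝒥).obj A) = A := by
  refine ObjectProperty.FullSubcategory.ext (functor_ext_of_faithful (RevStarMon.forget 𝒥)
    (fun t => ?_) ?_)
  -- Only multiplications are compared: a multiplication determines its unit.
  · exact RevStarMon.eq_of_heq rfl (heq_of_eq (MonObj.ext _ _ (A.toStarAlgebra_mul t))) HEq.rfl
  · exact Functor.hext (fun _ => rfl) fun _ _ f =>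
      heq_of_eq (StarObj.Hom.ext (A.toStarAlgebra_map f))

end PerpFunctor

/-- Carriers and stars are unchanged, and the actions agree on each `[σ, f]` by `op_mk`. -/
theorem StarAlgebra.toStarAlgebra_toPerpFunctor (A : StarAlgebra (aqftOperad P 𝒥)) :
    (PerpFunctor.toStarAlgebra P 𝒥).obj ((toPerpFunctor P 𝒥).obj A) = A := by
  refine StarAlgebra.eq_of_heq rfl (heq_of_eq ?_) HEq.rfl
  funext n c t
  refine insertPoint_ext fun s => ?_
  refine (insertPoint_copDescTensor _ s).trans ?_
  induction s using opSet_ind with | h σ f =>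
  exact (A.op_mk σ f).symm

variable (P 𝒥) in
theorem isIsoOfCategories_toPerpFunctor : IsIsoOfCategories (StarAlgebra.toPerpFunctor P 𝒥) :=
  ⟨PerpFunctor.toStarAlgebra P 𝒥,
    functor_ext_of_faithful (StarAlgebra.forget _) StarAlgebra.toStarAlgebra_toPerpFunctor rfl,
    functor_ext_of_faithful (PerpFunctor.forget P 𝒥) PerpFunctor.toPerpFunctor_toStarAlgebra rfl⟩

end AlgebrasAndFunctors

/-! ### Functors from the point -/

section Point
variable {M : Type u} [Category.{v} M] [MonoidalCategory M] [SymmetricCategory M]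
  (𝒥 : Involution M)

/-- The value of a functor at the unique object of the point. -/
def evalPoint : PerpFunctor (Orthogonality.empty Point.{v}) 𝒥 ⥤ RevStarMon 𝒥 where
  obj A := A.obj.obj ⟨PUnit.unit⟩
  map φ := φ.hom.app ⟨PUnit.unit⟩

/-- The constant functors on the point. -/
def constPoint : RevStarMon 𝒥 ⥤ PerpFunctor (Orthogonality.empty Point.{v}) 𝒥 where
  obj A := ⟨(Functor.const _).obj A, fun _ _ _ _ _ h => h.elim⟩
  map φ := ObjectProperty.homMk ((Functor.const _).map φ)

theorem isIsoOfCategories_evalPoint : IsIsoOfCategories (evalPoint 𝒥) := by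
  refine ⟨constPoint 𝒥, functor_ext_of_faithful (PerpFunctor.forget _ 𝒥) (fun A => ?_) rfl, rfl⟩
  refine ObjectProperty.FullSubcategory.ext (Functor.hext (fun _ => rfl) fun X Y f => ?_)
  obtain ⟨⟨⟩⟩ := X
  obtain ⟨⟨⟩⟩ := Y
  obtain rfl : f = 𝟙 _ := Subsingleton.elim _ _
  exact heq_of_eq (A.obj.map_id _).symm

end Point

/-! ### Order-reversing `*`-monoids of complex vector spaces -/

section ComplexStarAlgebras
open ModuleCat.MonModuleEquivalenceAlgebra TensorProduct

/-- The `*`-algebra over `ℂ` given by an order-reversing `*`-monoid of complex vector spaces. -/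
noncomputable def RevStarMon.toComplexStarAlg (A : RevStarMon vecInvolution) : ComplexStarAlg where
  A := A.X
  ring := MonObj.toRing A.X
  algebra := Algebra_of_Mon_ A.X
  starRing :=
    { star := fun a => A.star.hom a
      star_involutive := fun a => LinearMap.congr_fun (ModuleCat.hom_ext_iff.1 A.star_star) a
      star_mul := fun a b =>
        LinearMap.congr_fun (ModuleCat.hom_ext_iff.1 A.mul_star) (a ⊗ₜ[ℂ] b)
      star_add := fun a b => A.star.hom.map_add a b }
  starModule := @StarModule.mk ℂ A.X _ ⟨fun a => A.star.hom a⟩ _ fun z a => A.star.hom.map_smul z a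

/-- Addition and multiplication determine the ring, and `algebraMap` the algebra structure; the
rest, apart from the involution, is propositional. -/
theorem ComplexStarAlg.mk_eq_mk {A : Type} {r r' : Ring A} {a : @Algebra ℂ A _ r.toSemiring}
    {a' : @Algebra ℂ A _ r'.toSemiring}
    {s : @StarRing A r.toNonAssocRing.toNonUnitalNonAssocRing.toNonUnitalNonAssocSemiring}
    {s' : @StarRing A r'.toNonAssocRing.toNonUnitalNonAssocRing.toNonUnitalNonAssocSemiring} {m m'}
    (hadd : ∀ x y : A, r.add x y = r'.add x y) (hmul : ∀ x y : A, r.mul x y = r'.mul x y)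
    (halg : ∀ z : ℂ, a.algebraMap z = a'.algebraMap z) (hstar : ∀ x : A, s.star x = s'.star x) :
    @ComplexStarAlg.mk A r a s m = @ComplexStarAlg.mk A r' a' s' m' := by
  obtain rfl : r = r' := Ring.ext (funext₂ hadd) (funext₂ hmul)
  obtain rfl : a = a' := Algebra.algebra_ext _ _ halg
  obtain @⟨@⟨@⟨⟨f⟩, _⟩, _⟩, _⟩ := s
  obtain @⟨@⟨@⟨⟨f'⟩, _⟩, _⟩, _⟩ := s'
  obtain rfl : f = f' := funext hstar
  rfl

theorem RevStarMon.toRevStarMon_toComplexStarAlg (A : RevStarMon vecInvolution) :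
    ComplexStarAlg.toRevStarMon.obj A.toComplexStarAlg = A :=
  RevStarMon.eq_of_heq rfl
    (heq_of_eq (MonObj.ext _ _ (ModuleCat.MonoidalCategory.tensor_ext fun a b => rfl))) HEq.rfl

theorem ComplexStarAlg.toComplexStarAlg_toRevStarMon (A : ComplexStarAlg) :
    (ComplexStarAlg.toRevStarMon.obj A).toComplexStarAlg = A :=
  ComplexStarAlg.mk_eq_mk (fun _ _ => rfl) (fun _ _ => rfl) (fun _ => rfl) fun _ => rfl

instance : ComplexStarAlg.toRevStarMon.Faithful where
  map_injective {A B f g} h := StarAlgHom.ext fun a =>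
    LinearMap.congr_fun (ModuleCat.hom_ext_iff.1
      (congrArg (fun x : RevStarMon.Hom _ _ => x.hom.hom) h)) a

instance : ComplexStarAlg.toRevStarMon.Full where
  map_surjective {A B} f := by
    refine ⟨({ toFun := fun a => f.hom.hom.hom a
               map_one' := ?_
               map_mul' := ?_
               map_zero' := ?_
               map_add' := ?_
               commutes' := ?_
               map_star' := ?_ } : A.A →⋆ₐ[ℂ] B.A), rfl⟩
    -- The unit of the monoid is `algebraMap`. Compatibility with it gives preservation of `1` when
    -- evaluated at `1`, and of all scalars when evaluated everywhere.
    · have h : f.hom.hom.hom (algebraMap ℂ A.A 1) = algebraMap ℂ B.A 1 :=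
        LinearMap.congr_fun (ModuleCat.hom_ext_iff.1 (IsMonHom.one_hom f.hom.hom)) (1 : ℂ)
      rwa [map_one, map_one] at h
    · exact fun a b =>
        LinearMap.congr_fun (ModuleCat.hom_ext_iff.1 (IsMonHom.mul_hom f.hom.hom)) (a ⊗ₜ[ℂ] b)
    · exact f.hom.hom.hom.map_zero
    · exact f.hom.hom.hom.map_add
    · exact LinearMap.congr_fun (ModuleCat.hom_ext_iff.1 (IsMonHom.one_hom f.hom.hom))
    · exact LinearMap.congr_fun (ModuleCat.hom_ext_iff.1 f.star_hom)

theorem isIsoOfCategories_toRevStarMon : IsIsoOfCategories ComplexStarAlg.toRevStarMon :=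
  isIsoOfCategories_of_fullyFaithful _ RevStarMon.toComplexStarAlg
    ComplexStarAlg.toComplexStarAlg_toRevStarMon RevStarMon.toRevStarMon_toComplexStarAlg

end ComplexStarAlgebras
end AQFT

theorem proposition7p8 {C : Type v} [SmallCategory C] (P : AQFT.Orthogonality C)
    {M : Type u} [Category.{v} M] [MonoidalCategory M] [SymmetricCategory M] [MonoidalClosed M]
    [HasColimits M] (𝒥 : AQFT.Involution M) :
    (∃ Φ : AQFT.StarAlgebra (AQFT.aqftOperad P 𝒥) ⥤ AQFT.PerpFunctor P 𝒥,
      AQFT.IsIsoOfCategories Φ ∧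
        Φ ⋙ AQFT.PerpFunctor.forget P 𝒥 = AQFT.StarAlgebra.forget (AQFT.aqftOperad P 𝒥)) ∧
    (∃ Ψ : AQFT.StarAlgebra (AQFT.aqftOperad (AQFT.Orthogonality.empty AQFT.Point.{v}) 𝒥) ⥤
        AQFT.RevStarMon 𝒥,
      AQFT.IsIsoOfCategories Ψ ∧
        Ψ ⋙ AQFT.RevStarMon.forget 𝒥 =
          AQFT.StarAlgebra.forget (AQFT.aqftOperad (AQFT.Orthogonality.empty AQFT.Point.{v}) 𝒥) ⋙
            Pi.eval (fun _ => AQFT.StarObj 𝒥) (Discrete.mk PUnit.unit)) ∧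
    AQFT.IsIsoOfCategories AQFT.ComplexStarAlg.toRevStarMon :=
  -- Compatibility with the underlying families is definitional, since the functors keep objects,
  -- stars and components of morphisms.
  ⟨⟨_, AQFT.isIsoOfCategories_toPerpFunctor P 𝒥, rfl⟩,
    ⟨_, AQFT.isIsoOfCategories_comp (AQFT.isIsoOfCategories_toPerpFunctor _ 𝒥)
      (AQFT.isIsoOfCategories_evalPoint 𝒥), rfl⟩,
    AQFT.isIsoOfCategories_toRevStarMon⟩
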